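/- **Setting.** Let $\mathbb S^n_+=\{(y,t)\in\mathbb R^n\times\mathbb R : |y|^2+t^2=1,\ t\ge 0\}$ and let $R:\mathbb R^n\to\mathbb S^n_+$, $R(x)=(x,1)/\langle x\rangle$, be the radial compactification, $\langle x\rangle=\sqrt{1+|x|^2}$. The boundary of the manifold with corners $\mathbb S^n_+\times\mathbb S^n_+$ has the closed faces $\overline{\mathcal W}_e=S^{n-1}\times\mathbb S^n_+$ and $\overline{\mathcal W}_\psi=\mathbb S^n_+\times S^{n-1}$, meeting in the corner $\widetilde{\mathcal W}_{\psi e}=S^{n-1}\times S^{n-1}$; through $R$ their interiors are $\widetilde{\mathcal W}_e=S^{n-1}\times\mathbb R^n$ and $\widetilde{\mathcal W}_\psi=\mathbb R^n\times S^{n-1}$. Let $\rho_N=\langle x\rangle^{-1}$, $\rho_\sigma=\langle\xi\rangle^{-1}$. For $U$ open in the boundary, $C^\infty(U)$ is the set of pairs of smooth functions on $U\cap\overline{\mathcal W}_e$ and $U\cap\overline{\mathcal W}_\psi$ that agree on the corner. A section of $S^{l,m}$ over $U$ is $\rho_N^{-l}\rho_\sigma^{-m}a$ with $a\in C^\infty(U)$;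 it is identified with the pair $a_e(x,\xi)=|x|^l\langle\xi\rangle^m a(x/|x|,R\xi)$, $a_\psi(x,\xi)=\langle x\rangle^l|\xi|^m a(Rx,\xi/|\xi|)$. Let $U,V$ be open in $\partial(\mathbb S^n_+\times\mathbb S^n_+)$. A *scattering canonical transformation* $\chi:U\to V$ that meets the corner ($U\cap\widetilde{\mathcal W}_{\psi e}\ne\emptyset$) is a bijection that preserves each of the two faces and is, on each closed face, smooth with smooth inverse, such that: (a) its restrictions $\chi_e,\chi_\psi$ to the open faces are contact: $\chi_e^*\alpha_e=g_e\alpha_e$, $\chi_\psi^*\alpha_\psi=g_\psi\alpha_\psi$ with $g_e,g_\psi$ smooth and positive, where $\alpha_e=\sum_j\alpha^jd\xi_j$ and $\alpha_\psi=\sum_j\beta_jdx^j$; (b) $\chi$ preserves the Poisson bracket across the corner: pull-back along the symplectisations, i.e. the lifts of $\chi_e,\chi_\psi$ to maps equivariant in $x$, resp. $\xi$, with radial factors $1/g_e$, $1/g_\psi$, maps sections of $S^{l,m}$ over $V$ to sections of $S^{l,m}$ over $U$ and commutes with the Poisson brackets, for all $l,m\in\mathbb R$. For $S\subseteq\partial(\mathbb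 S^n_+\times\mathbb S^n_+)$ let $\mathcal W_e(S)\subseteq(\mathbb R^n\setminus0)\times\mathbb R^n$, $\mathcal W_\psi(S)\subseteq\mathbb R^n\times(\mathbb R^n\setminus 0)$, $\mathcal W_{\psi e}(S)\subseteq(\mathbb R^n\setminus0)\times(\mathbb R^n\setminus0)$ be the sets of $(x,\xi)$ such that $(x/|x|,R\xi)$, $(Rx,\xi/|\xi|)$, $(x/|x|,\xi/|\xi|)$, respectively, lies in $S$. Symbol estimates, eventual homogeneity and asymptotic expansions over an open set are understood uniformly over its compact subsets (for the whole compact face, resp. the whole of $\mathbb S^n_+\times\mathbb S^n_+$, these are the usual global notions). Classical $SG$-symbols of order $(m_e,m_\psi)$ satisfy $|\partial_x^a\partial_\xi^b f|\lesssim\langle x\rangle^{m_e-|a|}\langle\xi\rangle^{m_\psi-|b|}$ and have asymptotic expansions both in symbols eventually homogeneous in $x$ of degrees $m_e-k$ that are classical in $\xi$, and in symbols eventually homogeneous in $\xi$ of degrees $m_\psi-k$ that are classical in $x$, with remainders classical in the other variable; the principal symbol $(\sigma_e,\sigma_\psi,\sigma_{\psi e})$ consists of the homogeneous leading terms of the two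 expansions and of the common bihomogeneous leading term. **Theorem.** Let $\chi:U\to V$ be a scattering canonical transformation with $U\cap\widetilde{\mathcal W}_{\psi e}\neq\emptyset$. Then $\chi$ restricts to diffeomorphisms $\chi_\bullet:U\cap\widetilde{\mathcal W}_\bullet\to V\cap\widetilde{\mathcal W}_\bullet$ for $\bullet\in\{e,\psi,\psi e\}$. Write $\chi_e(\alpha,\xi)=(T(\alpha,\xi),H(\alpha,\xi))\in S^{n-1}\times\mathbb R^n$, $\chi_\psi(x,\beta)=(Y(x,\beta),G(x,\beta))\in\mathbb R^n\times S^{n-1}$, $\chi_{\psi e}(\alpha,\beta)=(A(\alpha,\beta),B(\alpha,\beta))$. 1. The components of $H$ are classical symbols of order $1$ in $\xi$ depending smoothly on $\alpha\in S^{n-1}$. 2. The components of $Y$ are classical symbols of order $1$ in $x$ depending smoothly on $\beta\in S^{n-1}$. Moreover there are smooth positive functions $f_e$ on $U\cap\overline{\mathcal W}_e$ and $f_\psi$ on $U\cap\overline{\mathcal W}_\psi$ such that: 3. For $(x,\xi)\in\mathcal W_{\psi e}(U)$, with $\alpha=x/|x|$, $\beta=\xi/|\xi|$, $$\lim_{\lambda\to\infty}T(\alpha,\lambda\xi)=A(\alpha,\beta),\qquad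 \lim_{\lambda\to\infty}\tfrac1\lambda Y(\lambda x,\beta)=|x|\,f_e(\alpha,\beta)\,A(\alpha,\beta),$$ $$\lim_{\lambda\to\infty}\tfrac1\lambda H(\alpha,\lambda\xi)=|\xi|\,f_\psi(\alpha,\beta)\,B(\alpha,\beta),\qquad \lim_{\lambda\to\infty}G(\lambda x,\beta)=B(\alpha,\beta).$$ 4. The maps $C_e(x,\xi)=(|x|f_eT,\,H)$, $C_\psi(x,\xi)=(Y,\,|\xi|f_\psi G)$ and $C_{\psi e}(x,\xi)=(|x|f_eA,\,|\xi|f_\psi B)$ (the functions being evaluated at $(\alpha,\xi)$, $(x,\beta)$, $(\alpha,\beta)$ respectively) are diffeomorphisms $\mathcal W_\bullet(U)\to\mathcal W_\bullet(V)$ preserving the symplectic form $\sum_jd\xi_j\wedge dx^j$. They extend $\chi_e,\chi_\psi,\chi_{\psi e}$ (they induce these maps on directions) and are equivariant under dilations in $x$, in $\xi$, and in $x$ and $\xi$ separately, respectively. 5. Write $C_\bullet=(Y_\bullet,H^\bullet)$. There are relatively open sets $\Omega\subseteq\Omega_0$ and $\Omega'$ in $\mathbb S^n_+\times\mathbb S^n_+$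 with $\Omega\cap\partial=\Omega_0\cap\partial=U$ and $\Omega'\cap\partial=V$, where $\partial=\partial(\mathbb S^n_+\times\mathbb S^n_+)$ (and $\Omega_0=\mathbb S^n_+\times\mathbb S^n_+$ if $U=\partial$), and a map $C=(Y^1,\dots,Y^n,H_1,\dots,H_n)$ such that over $\Omega_0$ each $Y^j$ is a classical $SG$-symbol of order $(1,0)$ with principal symbol $(Y^j_e,Y^j_\psi,Y^j_{\psi e})$, each $H_k$ is a classical $SG$-symbol of order $(0,1)$ with principal symbol $(H^e_k,H^\psi_k,H^{\psi e}_k)$, and $C$ is a diffeomorphism from the interior part $\{(x,\xi):(Rx,R\xi)\in\Omega\}$ of $\Omega$ onto the interior part of $\Omega'$. -/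

import Mathlib

open Set Filter Topology
open scoped ContDiff

namespace ScGeom

noncomputable section

/-! ## The doubly compactified phase space -/

/-- Euclidean space `ℝⁿ`. -/
abbrev Euc (n : ℕ) := EuclideanSpace ℝ (Fin n)

/-- Phase space `ℝⁿ × ℝⁿ`, with points `(x, ξ)`. -/
abbrev Phase (n : ℕ) := Euc n × Euc n

/-- Ambient space of the product of two half-spheres: each half-sphere lies in `ℝⁿ × ℝ`. -/
abbrev Amb (n : ℕ) := (Euc n × ℝ) × (Euc n × ℝ)

variable {n : ℕ}

/-- The closed upper half-sphere `S₊ⁿ = {(y, t) : |y|² + t² = 1, t ≥ 0}`. The last coordinate `t` is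
a boundary defining function. -/
def hemi (n : ℕ) : Set (Euc n × ℝ) := {p | ‖p.1‖ ^ 2 + p.2 ^ 2 = 1 ∧ 0 ≤ p.2}

/-- The manifold with corners `S₊ⁿ × S₊ⁿ`. -/
def dbl (n : ℕ) : Set (Amb n) := hemi n ×ˢ hemi n

/-- The closed boundary face over spatial infinity, `Sⁿ⁻¹ × S₊ⁿ`. -/
def faceE (n : ℕ) : Set (Amb n) := {p | p ∈ dbl n ∧ p.1.2 = 0}

/-- The closed boundary face at fibre infinity, `S₊ⁿ × Sⁿ⁻¹`. -/
def facePsi (n : ℕ) : Set (Amb n) := {p | p ∈ dbl n ∧ p.2.2 = 0}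

/-- The corner `Sⁿ⁻¹ × Sⁿ⁻¹`. -/
def corner (n : ℕ) : Set (Amb n) := faceE n ∩ facePsi n

/-- The boundary `∂(S₊ⁿ × S₊ⁿ)`. -/
def bdry (n : ℕ) : Set (Amb n) := faceE n ∪ facePsi n

/-- `S` is a relatively open subset of `M`. -/
def RelOpen {X : Type*} [TopologicalSpace X] (S M : Set X) : Prop :=
  ∃ O : Set X, IsOpen O ∧ S = O ∩ M

/-- Smoothness of a map on a subset of a Euclidean space: locally it is the restriction of a smooth
map defined on an open subset of the ambient space. -/
def SmoothOn {X Y : Type*} [NormedAddCommGroup X] [NormedSpace ℝ X]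
    [NormedAddCommGroup Y] [NormedSpace ℝ Y] (f : X → Y) (S : Set X) : Prop :=
  ∀ p ∈ S, ∃ (O : Set X) (F : X → Y), IsOpen O ∧ p ∈ O ∧ ContDiffOn ℝ ∞ F O ∧ EqOn f F (S ∩ O)

/-- A diffeomorphism between open subsets of normed spaces. -/
def IsDiffeoOn {X Y : Type*} [NormedAddCommGroup X] [NormedSpace ℝ X]
    [NormedAddCommGroup Y] [NormedSpace ℝ Y] (C : X → Y) (W : Set X) (W' : Set Y) : Prop :=
  ContDiffOn ℝ ∞ C W ∧ BijOn C W W' ∧ ∃ D : Y → X, ContDiffOn ℝ ∞ D W' ∧ InvOn D C W W'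

/-- The bracket `⟨x⟩ = (1 + |x|²)^{1/2}`. -/
def jb (x : Euc n) : ℝ := Real.sqrt (1 + ‖x‖ ^ 2)

/-- Radial compactification `R : ℝⁿ → S₊ⁿ`, `R x = (x, 1) / ⟨x⟩`. -/
def R (x : Euc n) : Euc n × ℝ := ((jb x)⁻¹ • x, (jb x)⁻¹)

/-- The inverse of `R` on the open half-sphere. -/
def Rinv (p : Euc n × ℝ) : Euc n := p.2⁻¹ • p.1

/-- The point `(x / |x|, 0)` of `∂S₊ⁿ = Sⁿ⁻¹` at the end of the ray through `x ≠ 0`. -/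
def dir (x : Euc n) : Euc n × ℝ := (‖x‖⁻¹ • x, 0)

/-- `(x, ξ) ↦ (x / |x|, R ξ)`, onto the open face `Sⁿ⁻¹ × ℝⁿ`. -/
def ptE (z : Phase n) : Amb n := (dir z.1, R z.2)

/-- `(x, ξ) ↦ (R x, ξ / |ξ|)`, onto the open face `ℝⁿ × Sⁿ⁻¹`. -/
def ptPsi (z : Phase n) : Amb n := (R z.1, dir z.2)

/-- `(x, ξ) ↦ (x / |x|, ξ / |ξ|)`, onto the corner. -/
def ptCorner (z : Phase n) : Amb n := (dir z.1, dir z.2)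

/-- `(x, ξ) ↦ (R x, R ξ)`, onto the interior. -/
def ptInt (z : Phase n) : Amb n := (R z.1, R z.2)

/-- The subset of `ℝⁿ₀ × ℝⁿ`, conic in `x`, over the part of `S` in the open face `Sⁿ⁻¹ × ℝⁿ`. -/
def coneE (S : Set (Amb n)) : Set (Phase n) := {z | z.1 ≠ 0 ∧ ptE z ∈ S}

/-- The subset of `ℝⁿ × ℝⁿ₀`, conic in `ξ`, over the part of `S` in the open face `ℝⁿ × Sⁿ⁻¹`. -/
def conePsi (S : Set (Amb n)) : Set (Phase n) := {z | z.2 ≠ 0 ∧ ptPsi z ∈ S}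

/-- The biconic subset of `ℝⁿ₀ × ℝⁿ₀` over the part of `S` in the corner. -/
def coneCorner (S : Set (Amb n)) : Set (Phase n) := {z | z.1 ≠ 0 ∧ z.2 ≠ 0 ∧ ptCorner z ∈ S}

/-- The part of `S` in the interior, as a subset of `ℝⁿ × ℝⁿ`. -/
def intPart (S : Set (Amb n)) : Set (Phase n) := {z | ptInt z ∈ S}

/-! ## Symplectic structure -/

/-- The symplectic form `∑ dξ_j ∧ dx^j`. -/
def omega (u v : Phase n) : ℝ := inner ℝ u.2 v.1 - inner ℝ v.2 u.1

/-- `C` preserves the symplectic form at each point of the open set `W`. -/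
def IsSymplecticOn (C : Phase n → Phase n) (W : Set (Phase n)) : Prop :=
  ∀ z ∈ W, ∀ u v : Phase n, omega (fderiv ℝ C z u) (fderiv ℝ C z v) = omega u v

/-- The Poisson bracket `{a, b} = ∑ (∂_{ξ_j} a ∂_{x^j} b - ∂_{x^j} a ∂_{ξ_j} b)`. -/
def poisson (a b : Phase n → ℝ) (z : Phase n) : ℝ :=
  ∑ j : Fin n,
    (fderiv ℝ a z (0, EuclideanSpace.single j 1) * fderiv ℝ b z (EuclideanSpace.single j 1, 0)
      - fderiv ℝ a z (EuclideanSpace.single j 1, 0) * fderiv ℝ b z (0, EuclideanSpace.single j 1))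

/-! ## Sections of the weight bundles over an open subset of the boundary

A smooth function on `U ⊆ ∂(S₊ⁿ × S₊ⁿ)` is a pair of smooth functions on the two closed faces which
agree in the corner, that is, a single function on `U` smooth on each closed face. A section of
`S^{l,m}` over `U` is `ρ_N^{-l} ρ_σ^{-m} a` for such a function `a`; on the two open faces and the
corner it is the same as the homogeneous functions `symbE`, `symbPsi`, `symbCorner`. -/

/-- The space `C^∞(U)` of functions smooth across the corner. -/
def SmoothBdry (U : Set (Amb n)) (a : Amb n → ℝ) : Prop :=
  SmoothOn a (U ∩ faceE n) ∧ SmoothOn a (U ∩ facePsi n)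

/-- The `e`-component of the section of `S^{l,m}` given by `a`, homogeneous of degree `l` in `x`. -/
def symbE (l m : ℝ) (a : Amb n → ℝ) (z : Phase n) : ℝ := ‖z.1‖ ^ l * jb z.2 ^ m * a (ptE z)

/-- The `ψ`-component of the section of `S^{l,m}` given by `a`, homogeneous of degree `m` in `ξ`. -/
def symbPsi (l m : ℝ) (a : Amb n → ℝ) (z : Phase n) : ℝ := jb z.1 ^ l * ‖z.2‖ ^ m * a (ptPsi z)

/-! ## Maps between open subsets of the boundary -/

/-- A diffeomorphism between relatively open subsets `χ.source`, `χ.target` of the boundary: it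
preserves each of the two boundary faces, and on each closed face (a manifold with boundary) it is
smooth with smooth inverse. -/
structure IsBdryDiffeo (χ : PartialEquiv (Amb n) (Amb n)) : Prop where
  source_open : RelOpen χ.source (bdry n)
  target_open : RelOpen χ.target (bdry n)
  map_faceE : ∀ p ∈ χ.source, χ p ∈ faceE n ↔ p ∈ faceE n
  map_facePsi : ∀ p ∈ χ.source, χ p ∈ facePsi n ↔ p ∈ facePsi n
  smoothE : SmoothOn χ (χ.source ∩ faceE n)
  smoothPsi : SmoothOn χ (χ.source ∩ facePsi n)
  symm_smoothE : SmoothOn χ.symm (χ.target ∩ faceE n)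
  symm_smoothPsi : SmoothOn χ.symm (χ.target ∩ facePsi n)

/-- `T` in `χ_e (α, ξ) = (T, H)`, as a function of `(x, ξ)` with `α = x / |x|`. -/
def compT (χ : Amb n → Amb n) (z : Phase n) : Euc n := (χ (ptE z)).1.1

/-- `H` in `χ_e (α, ξ) = (T, H)`, as a function of `(x, ξ)` with `α = x / |x|`. -/
def compH (χ : Amb n → Amb n) (z : Phase n) : Euc n := Rinv (χ (ptE z)).2

/-- `Y` in `χ_ψ (x, β) = (Y, G)`, as a function of `(x, ξ)` with `β = ξ / |ξ|`. -/
def compY (χ : Amb n → Amb n) (z : Phase n) : Euc n := Rinv (χ (ptPsi z)).1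

/-- `G` in `χ_ψ (x, β) = (Y, G)`, as a function of `(x, ξ)` with `β = ξ / |ξ|`. -/
def compG (χ : Amb n → Amb n) (z : Phase n) : Euc n := (χ (ptPsi z)).2.1

/-- `A` in `χ_{ψe} (α, β) = (A, B)`. -/
def compA (χ : Amb n → Amb n) (z : Phase n) : Euc n := (χ (ptCorner z)).1.1

/-- `B` in `χ_{ψe} (α, β) = (A, B)`. -/
def compB (χ : Amb n → Amb n) (z : Phase n) : Euc n := (χ (ptCorner z)).2.1

/-- The lift of `χ_e`, equivariant in `x`: `(r, α, ξ) ↦ (f r, χ_e (α, ξ))` in polar coordinates. -/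
def liftE (χ : Amb n → Amb n) (f : Amb n → ℝ) (z : Phase n) : Phase n :=
  ((‖z.1‖ * f (ptE z)) • compT χ z, compH χ z)

/-- The lift of `χ_ψ`, equivariant in `ξ`, with radial factor `f`. -/
def liftPsi (χ : Amb n → Amb n) (f : Amb n → ℝ) (z : Phase n) : Phase n :=
  (compY χ z, (‖z.2‖ * f (ptPsi z)) • compG χ z)

/-- The lift of `χ_{ψe}`, equivariant in `x` and `ξ` separately, with radial factors `f`, `h`. -/
def liftCorner (χ : Amb n → Amb n) (f h : Amb n → ℝ) (z : Phase n) : Phase n :=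
  ((‖z.1‖ * f (ptCorner z)) • compA χ z, (‖z.2‖ * h (ptCorner z)) • compB χ z)

/-- `χ_e` is a contact diffeomorphism of the open face `Sⁿ⁻¹ × ℝⁿ`, with contact form
`α_e = ∑ α^j dξ_j`: one has `χ_e^* α_e = g α_e` with `g` smooth and positive. The identity is written
after pull-back along `(x, ξ) ↦ (x / |x|, ξ)`. -/
def IsContactE (χ : PartialEquiv (Amb n) (Amb n)) (g : Amb n → ℝ) : Prop :=
  SmoothOn g (χ.source ∩ (faceE n \ corner n)) ∧
  (∀ p ∈ χ.source ∩ (faceE n \ corner n), 0 < g p) ∧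
  ∀ z ∈ coneE χ.source, ∀ v : Phase n,
    inner ℝ (compT χ z) (fderiv ℝ (compH χ) z v) = g (ptE z) * inner ℝ (‖z.1‖⁻¹ • z.1) v.2

/-- `χ_ψ` is a contact diffeomorphism of the open face `ℝⁿ × Sⁿ⁻¹`, with contact form
`α_ψ = ∑ β_j dx^j`: one has `χ_ψ^* α_ψ = g α_ψ` with `g` smooth and positive. -/
def IsContactPsi (χ : PartialEquiv (Amb n) (Amb n)) (g : Amb n → ℝ) : Prop :=
  SmoothOn g (χ.source ∩ (facePsi n \ corner n)) ∧
  (∀ p ∈ χ.source ∩ (facePsi n \ corner n), 0 < g p) ∧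
  ∀ z ∈ conePsi χ.source, ∀ v : Phase n,
    inner ℝ (compG χ z) (fderiv ℝ (compY χ) z v) = g (ptPsi z) * inner ℝ (‖z.2‖⁻¹ • z.2) v.1

/-- `χ` preserves the Poisson bracket of sections of the bundles `S^{l,m}` across the corner. A
contact map with factor `g` acts on homogeneous functions by pull-back along its symplectisation, the
lift with radial factor `1 / g`. It is required that sections of `S^{l,m}` over the target are pulled
back to sections of `S^{l,m}` over the source (in particular the pull-backs from the two faces match
in the corner), and that the pull-back commutes with the Poisson bracket. -/
def PreservesPoisson (χ : PartialEquiv (Amb n) (Amb n)) (ge gp : Amb n → ℝ) : Prop :=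
  let Ce := liftE χ (fun p => (ge p)⁻¹)
  let Cp := liftPsi χ (fun p => (gp p)⁻¹)
  (∀ (l m : ℝ) (a : Amb n → ℝ), SmoothBdry χ.target a →
    ∃ a' : Amb n → ℝ, SmoothBdry χ.source a' ∧
      EqOn (symbE l m a') (symbE l m a ∘ Ce) (coneE χ.source) ∧
      EqOn (symbPsi l m a') (symbPsi l m a ∘ Cp) (conePsi χ.source)) ∧
  ∀ (l m l' m' : ℝ) (a b : Amb n → ℝ), SmoothBdry χ.target a → SmoothBdry χ.target b →
    EqOn (poisson (symbE l m a ∘ Ce) (symbE l' m' b ∘ Ce))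
      (poisson (symbE l m a) (symbE l' m' b) ∘ Ce) (coneE χ.source) ∧
    EqOn (poisson (symbPsi l m a ∘ Cp) (symbPsi l' m' b ∘ Cp))
      (poisson (symbPsi l m a) (symbPsi l' m' b) ∘ Cp) (conePsi χ.source)

/-- Scattering canonical transformation (scattering symplectomorphism) between relatively open
subsets of `∂(S₊ⁿ × S₊ⁿ)`. -/
def IsSCT (χ : PartialEquiv (Amb n) (Amb n)) : Prop :=
  IsBdryDiffeo χ ∧ ∃ ge gp : Amb n → ℝ, IsContactE χ ge ∧ IsContactPsi χ gp ∧
    ((χ.source ∩ corner n).Nonempty → PreservesPoisson χ ge gp)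

/-- `χ` restricts to a diffeomorphism between the parts of its source and target in `S`. -/
def RestrictsToDiffeo (χ : PartialEquiv (Amb n) (Amb n)) (S : Set (Amb n)) : Prop :=
  BijOn χ (χ.source ∩ S) (χ.target ∩ S) ∧
    SmoothOn χ (χ.source ∩ S) ∧ SmoothOn χ.symm (χ.target ∩ S)

/-! ## Classical symbols with parameters on the sphere

The estimates are uniform over compact subsets of the (possibly small) open set `U`. If `U` is the
whole boundary, the faces are compact and these are the usual global estimates. -/

/-- The mixed derivative `∂_x^j ∂_ξ^k f`, as a multilinear map. -/
def mixedDeriv (j k : ℕ) (f : Phase n → ℝ) (z : Phase n) :=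
  iteratedFDeriv ℝ j (fun x => iteratedFDeriv ℝ k (fun ξ => f (x, ξ)) z.2) z.1

/-- `C^∞(Sⁿ⁻¹; S^m(ℝⁿ_ξ))`, over the part of `U` in the face `Sⁿ⁻¹ × ℝⁿ`. Functions on the sphere
are regarded as functions of `x`, homogeneous of degree `0`, and estimated at `|x| = 1`. -/
def SymbolE (U : Set (Amb n)) (m : ℝ) (f : Phase n → ℝ) : Prop :=
  ContDiffOn ℝ ∞ f (coneE U) ∧
  (∀ z ∈ coneE U, ∀ s : ℝ, 0 < s → f (s • z.1, z.2) = f z) ∧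
  ∀ K ⊆ U ∩ faceE n, IsCompact K → ∀ j k : ℕ, ∃ c : ℝ, ∀ z : Phase n, ‖z.1‖ = 1 → ptE z ∈ K →
    ‖mixedDeriv j k f z‖ ≤ c * jb z.2 ^ (m - k)

/-- Classical elements of `SymbolE`: they have an asymptotic expansion in functions `p j` which are
homogeneous of degree `m - j` in `ξ` for large `ξ`. -/
def ClassicalE (U : Set (Amb n)) (m : ℝ) (f : Phase n → ℝ) : Prop :=
  SymbolE U m f ∧ ∃ p : ℕ → Phase n → ℝ,
    (∀ j : ℕ, SymbolE U (m - j) (p j) ∧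
      ∀ K ⊆ U ∩ faceE n, IsCompact K → ∃ c : ℝ, ∀ (z : Phase n) (s : ℝ), 1 ≤ s → z.1 ≠ 0 →
        c < ‖z.2‖ → ptE z ∈ K → ptE (z.1, s • z.2) ∈ K →
        p j (z.1, s • z.2) = s ^ (m - j) * p j z) ∧
    ∀ N : ℕ, SymbolE U (m - N - 1) (fun z => f z - ∑ j ∈ Finset.range (N + 1), p j z)

/-- `C^∞(Sⁿ⁻¹; S^m(ℝⁿ_x))`, over the part of `U` in the face `ℝⁿ × Sⁿ⁻¹`. -/
def SymbolPsi (U : Set (Amb n)) (m : ℝ) (f : Phase n → ℝ) : Prop :=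
  ContDiffOn ℝ ∞ f (conePsi U) ∧
  (∀ z ∈ conePsi U, ∀ s : ℝ, 0 < s → f (z.1, s • z.2) = f z) ∧
  ∀ K ⊆ U ∩ facePsi n, IsCompact K → ∀ j k : ℕ, ∃ c : ℝ, ∀ z : Phase n, ‖z.2‖ = 1 → ptPsi z ∈ K →
    ‖mixedDeriv j k f z‖ ≤ c * jb z.1 ^ (m - j)

/-- Classical elements of `SymbolPsi`. -/
def ClassicalPsi (U : Set (Amb n)) (m : ℝ) (f : Phase n → ℝ) : Prop :=
  SymbolPsi U m f ∧ ∃ p : ℕ → Phase n → ℝ,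
    (∀ j : ℕ, SymbolPsi U (m - j) (p j) ∧
      ∀ K ⊆ U ∩ facePsi n, IsCompact K → ∃ c : ℝ, ∀ (z : Phase n) (s : ℝ), 1 ≤ s → z.2 ≠ 0 →
        c < ‖z.1‖ → ptPsi z ∈ K → ptPsi (s • z.1, z.2) ∈ K →
        p j (s • z.1, z.2) = s ^ (m - j) * p j z) ∧
    ∀ N : ℕ, SymbolPsi U (m - N - 1) (fun z => f z - ∑ j ∈ Finset.range (N + 1), p j z)

/-! ## Classical `SG`-symbols

`Ω` is a relatively open subset of `S₊ⁿ × S₊ⁿ`, and all conditions are uniform over compact subsets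
of `Ω`. For `Ω = S₊ⁿ × S₊ⁿ` (which is compact) these are the global classes on `ℝⁿ × ℝⁿ`. -/

/-- `SG^{me, mp}`. -/
def SG (Ω : Set (Amb n)) (me mp : ℝ) (f : Phase n → ℝ) : Prop :=
  ContDiffOn ℝ ∞ f (intPart Ω) ∧
  ∀ K ⊆ Ω, IsCompact K → ∀ j k : ℕ, ∃ c : ℝ, ∀ z : Phase n, ptInt z ∈ K →
    ‖mixedDeriv j k f z‖ ≤ c * (jb z.1 ^ (me - j) * jb z.2 ^ (mp - k))

/-- Homogeneity of degree `me` in `x`, for large `x`. -/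
def EvHomE (Ω : Set (Amb n)) (me : ℝ) (f : Phase n → ℝ) : Prop :=
  ∀ K ⊆ Ω, IsCompact K → ∃ c : ℝ, ∀ (z : Phase n) (s : ℝ), 1 ≤ s → c < ‖z.1‖ →
    ptInt z ∈ K → ptInt (s • z.1, z.2) ∈ K → f (s • z.1, z.2) = s ^ me * f z

/-- Homogeneity of degree `mp` in `ξ`, for large `ξ`. -/
def EvHomPsi (Ω : Set (Amb n)) (mp : ℝ) (f : Phase n → ℝ) : Prop :=
  ∀ K ⊆ Ω, IsCompact K → ∃ c : ℝ, ∀ (z : Phase n) (s : ℝ), 1 ≤ s → c < ‖z.2‖ →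
    ptInt z ∈ K → ptInt (z.1, s • z.2) ∈ K → f (z.1, s • z.2) = s ^ mp * f z

/-- Bihomogeneity of degree `(me, mp)`, for large `x` and large `ξ`. -/
def EvHomBi (Ω : Set (Amb n)) (me mp : ℝ) (f : Phase n → ℝ) : Prop :=
  ∀ K ⊆ Ω, IsCompact K → ∃ c : ℝ, ∀ (z : Phase n) (s t : ℝ), 1 ≤ s → 1 ≤ t →
    c < ‖z.1‖ → c < ‖z.2‖ → ptInt z ∈ K → ptInt (s • z.1, t • z.2) ∈ K →
    f (s • z.1, t • z.2) = s ^ me * t ^ mp * f z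

/-- `a` is an `e`-expansion of the eventually `ψ`-homogeneous symbol `f`. -/
def HomExpansionE (Ω : Set (Amb n)) (me mp : ℝ) (f : Phase n → ℝ) (a : ℕ → Phase n → ℝ) : Prop :=
  (∀ k : ℕ, SG Ω (me - k) mp (a k) ∧ EvHomBi Ω (me - k) mp (a k)) ∧
  ∀ N : ℕ, SG Ω (me - N - 1) mp (fun z => f z - ∑ k ∈ Finset.range (N + 1), a k z)

/-- `a` is a `ψ`-expansion of the eventually `e`-homogeneous symbol `f`. -/
def HomExpansionPsi (Ω : Set (Amb n)) (me mp : ℝ) (f : Phase n → ℝ) (a : ℕ → Phase n → ℝ) : Prop :=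
  (∀ k : ℕ, SG Ω me (mp - k) (a k) ∧ EvHomBi Ω me (mp - k) (a k)) ∧
  ∀ N : ℕ, SG Ω me (mp - N - 1) (fun z => f z - ∑ k ∈ Finset.range (N + 1), a k z)

/-- `SG^{me, [mp]}_{cl(e)}`. -/
def HomClE (Ω : Set (Amb n)) (me mp : ℝ) (f : Phase n → ℝ) : Prop :=
  SG Ω me mp f ∧ EvHomPsi Ω mp f ∧ ∃ a, HomExpansionE Ω me mp f a

/-- `SG^{[me], mp}_{cl(ψ)}`. -/
def HomClPsi (Ω : Set (Amb n)) (me mp : ℝ) (f : Phase n → ℝ) : Prop :=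
  SG Ω me mp f ∧ EvHomE Ω me f ∧ ∃ a, HomExpansionPsi Ω me mp f a

/-- `SG^{me, mp}_{cl(e)}`. -/
def ClE (Ω : Set (Amb n)) (me mp : ℝ) (f : Phase n → ℝ) : Prop :=
  SG Ω me mp f ∧ ∃ a : ℕ → Phase n → ℝ,
    (∀ k : ℕ, SG Ω (me - k) mp (a k) ∧ EvHomE Ω (me - k) (a k)) ∧
    ∀ N : ℕ, SG Ω (me - N - 1) mp (fun z => f z - ∑ k ∈ Finset.range (N + 1), a k z)

/-- `SG^{me, mp}_{cl(ψ)}`. -/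
def ClPsi (Ω : Set (Amb n)) (me mp : ℝ) (f : Phase n → ℝ) : Prop :=
  SG Ω me mp f ∧ ∃ a : ℕ → Phase n → ℝ,
    (∀ k : ℕ, SG Ω me (mp - k) (a k) ∧ EvHomPsi Ω (mp - k) (a k)) ∧
    ∀ N : ℕ, SG Ω me (mp - N - 1) (fun z => f z - ∑ k ∈ Finset.range (N + 1), a k z)

/-- `a` is a `ψ`-asymptotic expansion of `f`, as required of a classical `SG`-symbol. -/
def ExpansionPsi (Ω : Set (Amb n)) (me mp : ℝ) (f : Phase n → ℝ) (a : ℕ → Phase n → ℝ) : Prop :=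
  (∀ k : ℕ, HomClE Ω me (mp - k) (a k)) ∧
  ∀ N : ℕ, ClE Ω me (mp - N - 1) (fun z => f z - ∑ k ∈ Finset.range (N + 1), a k z)

/-- `a` is an `e`-asymptotic expansion of `f`, as required of a classical `SG`-symbol. -/
def ExpansionE (Ω : Set (Amb n)) (me mp : ℝ) (f : Phase n → ℝ) (a : ℕ → Phase n → ℝ) : Prop :=
  (∀ k : ℕ, HomClPsi Ω (me - k) mp (a k)) ∧
  ∀ N : ℕ, ClPsi Ω (me - N - 1) mp (fun z => f z - ∑ k ∈ Finset.range (N + 1), a k z)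

/-- Classical `SG`-symbols of order `(me, mp)`. -/
def ClassicalSG (Ω : Set (Amb n)) (me mp : ℝ) (f : Phase n → ℝ) : Prop :=
  SG Ω me mp f ∧ (∃ a, ExpansionPsi Ω me mp f a) ∧ ∃ a, ExpansionE Ω me mp f a

/-- `σ_e^{me}(f) = s`: the smooth function `s` is homogeneous of degree `me` in `x` and agrees with
the leading term of an `e`-expansion of `f` for large `x`. -/
def HasSymbE (Ω : Set (Amb n)) (me mp : ℝ) (f s : Phase n → ℝ) : Prop :=
  ContDiffOn ℝ ∞ s (coneE Ω) ∧
  (∀ z ∈ coneE Ω, ∀ r : ℝ, 0 < r → s (r • z.1, z.2) = r ^ me * s z) ∧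
  ∃ a, ExpansionE Ω me mp f a ∧ ∀ K ⊆ Ω, IsCompact K → ∃ c : ℝ, ∀ z : Phase n,
    ptInt z ∈ K → c < ‖z.1‖ → a 0 z = s z

/-- `σ_ψ^{mp}(f) = s`: the smooth function `s` is homogeneous of degree `mp` in `ξ` and agrees with
the leading term of a `ψ`-expansion of `f` for large `ξ`. -/
def HasSymbPsi (Ω : Set (Amb n)) (me mp : ℝ) (f s : Phase n → ℝ) : Prop :=
  ContDiffOn ℝ ∞ s (conePsi Ω) ∧
  (∀ z ∈ conePsi Ω, ∀ r : ℝ, 0 < r → s (z.1, r • z.2) = r ^ mp * s z) ∧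
  ∃ a, ExpansionPsi Ω me mp f a ∧ ∀ K ⊆ Ω, IsCompact K → ∃ c : ℝ, ∀ z : Phase n,
    ptInt z ∈ K → c < ‖z.2‖ → a 0 z = s z

/-- `σ_{ψe}(f) = σ_e (σ_ψ (f)) = σ_ψ (σ_e (f)) = s`: the smooth function `s` is bihomogeneous and
agrees, for large `x` and `ξ`, with the leading term of an `e`-expansion of the leading term of a
`ψ`-expansion of `f`, and likewise with the two expansions taken in the other order. -/
def HasSymbCorner (Ω : Set (Amb n)) (me mp : ℝ) (f s : Phase n → ℝ) : Prop :=
  ContDiffOn ℝ ∞ s (coneCorner Ω) ∧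
  (∀ z ∈ coneCorner Ω, ∀ r t : ℝ, 0 < r → 0 < t →
    s (r • z.1, t • z.2) = r ^ me * t ^ mp * s z) ∧
  (∃ a b, ExpansionPsi Ω me mp f a ∧ HomExpansionE Ω me mp (a 0) b ∧
    ∀ K ⊆ Ω, IsCompact K → ∃ c : ℝ, ∀ z : Phase n,
      ptInt z ∈ K → c < ‖z.1‖ → c < ‖z.2‖ → b 0 z = s z) ∧
  ∃ a b, ExpansionE Ω me mp f a ∧ HomExpansionPsi Ω me mp (a 0) b ∧
    ∀ K ⊆ Ω, IsCompact K → ∃ c : ℝ, ∀ z : Phase n,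
      ptInt z ∈ K → c < ‖z.1‖ → c < ‖z.2‖ → b 0 z = s z

/-- `f` is a classical `SG`-symbol of order `(me, mp)` with principal symbol `(se, sp, spe)`. -/
def ClassicalSGWithSymbol (Ω : Set (Amb n)) (me mp : ℝ) (f se sp spe : Phase n → ℝ) : Prop :=
  ClassicalSG Ω me mp f ∧ HasSymbE Ω me mp f se ∧ HasSymbPsi Ω me mp f sp ∧
    HasSymbCorner Ω me mp f spe

end

end ScGeom

open ScGeom

namespace ScGeom

noncomputable section

/-! ## Smooth maps on subsets -/

section SmoothOn

variable {X Y Z : Type*} [NormedAddCommGroup X] [NormedSpace ℝ X]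
  [NormedAddCommGroup Y] [NormedSpace ℝ Y] [NormedAddCommGroup Z] [NormedSpace ℝ Z]

/-! A function `G` on the product of half-spheres extends to the ambient space as a bihomogeneous
function of degree `(l, m)` (`hext`). Fixing the two last coordinates at `(s, u)` with `s, u ∈ {0,
1}` cuts out four slices of this one object: `(1,1)` is a symbol on phase space, `(0,1)` and `(1,0)`
are its components at the two faces, `(0,0)` its component at the corner. Symbol and principal
symbol are therefore restrictions of the same homogeneous function. Symbol estimates follow from
homogeneity and compactness (`norm_mixedDeriv_hext_le`). Asymptotic expansions are Taylor expansions
in the boundary defining functions `1/⟨x⟩` and `1/⟨ξ⟩`: subtract the homogeneous function with the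
right face value, divide by the defining function (Hadamard's lemma, `exists_div_fst`), repeat; each
division lowers the order by one. So smooth functions near the boundary give classical `SG`-symbols
(`classicalSGWithSymbol_symbInt`).

For a scattering canonical transformation `χ`, the pull-backs of the sections `ρ_N^{∓1}` and
`ρ_σ^{∓1}` are again sections. This shows that the radial factors `1/g_e` and `1/g_ψ` are
restrictions of positive functions `φ`, `ψ` on all of `U`, smooth on both faces, and that the
heights (last coordinates) of `p` are those of `χ p` multiplied by `φ p` and `ψ p`
(`exists_isRadial`). Multiplying the two components of `χ` by `φ` and `ψ` thus gives a pair, smooth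
on both faces, whose homogeneous extension has `C_e`, `C_ψ`, `C_ψe` as its three boundary slices.
Extending the pair to the interior (`exists_extension`), one takes for `C` the remaining slice. The
symbol properties and the limits at the corner are then immediate.

The coordinates `x^j`, `ξ_j` are sections of `S^{1,0}` and `S^{0,1}`, so the lifts preserve their
brackets, and linear algebra (`isSympl_of_pb`) makes the derivatives symplectic. Since dilations
only rescale `ω`, this is a condition on the derivative of the homogeneous map at a point of the
product of spheres (`isSympl_slice_iff`). It is a closed condition and passes from the open faces to
the corner (`IsRadial.isSympl_hpairD`).

Finally, add the unchanged heights as further components. The derivative of the resulting ambient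
map is block triangular, with a symplectic block and the identity, hence invertible along `U`. The
local inverses given by the inverse function theorem respect heights, so the normalised map is
locally invertible on the manifold with corners. On `U` it equals `χ`, a homeomorphism onto `V`, and
a topological argument (`exists_isOpen_injOn`) gives injectivity on a neighbourhood of `U`. -/

theorem SmoothOn.of_contDiffOn {f : X → Y} {S O : Set X} (hO : IsOpen O) (hS : S ⊆ O)
    (hf : ContDiffOn ℝ ∞ f O) : SmoothOn f S :=
  fun _ hp => ⟨O, f, hO, hS hp, hf, fun _ _ => rfl⟩

theorem SmoothOn.of_contDiff {f : X → Y} {S : Set X} (hf : ContDiff ℝ ∞ f) : SmoothOn f S :=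
  .of_contDiffOn isOpen_univ (subset_univ _) hf.contDiffOn

theorem SmoothOn.mono {f : X → Y} {S T : Set X} (hf : SmoothOn f T) (h : S ⊆ T) :
    SmoothOn f S := fun p hp => by
  obtain ⟨O, F, hO, hpO, hF, he⟩ := hf p (h hp)
  exact ⟨O, F, hO, hpO, hF, he.mono (inter_subset_inter_left _ h)⟩

theorem SmoothOn.comp {g : Y → Z} {f : X → Y} {S : Set X} {T : Set Y} (hg : SmoothOn g T)
    (hf : SmoothOn f S) (h : MapsTo f S T) : SmoothOn (fun x => g (f x)) S := fun p hp => by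
  obtain ⟨O, F, hO, hpO, hF, he⟩ := hf p hp
  obtain ⟨Q, G, hQ, hpQ, hG, he'⟩ := hg (f p) (h hp)
  have hop : IsOpen (O ∩ F ⁻¹' Q) := hF.continuousOn.isOpen_inter_preimage hO hQ
  refine ⟨O ∩ F ⁻¹' Q, G ∘ F, hop, ⟨hpO, ?_⟩,
    hG.comp (hF.mono inter_subset_left) fun x hx => hx.2, fun q hq => ?_⟩
  · rw [mem_preimage, ← he ⟨hp, hpO⟩]; exact hpQ
  · have h1 := he ⟨hq.1, hq.2.1⟩
    have h2 : f q ∈ Q := by rw [h1]; exact hq.2.2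
    change g (f q) = G (F q)
    rw [he' ⟨h hq.1, h2⟩, h1]

theorem SmoothOn.prodMk {f : X → Y} {g : X → Z} {S : Set X} (hf : SmoothOn f S)
    (hg : SmoothOn g S) : SmoothOn (fun x => (f x, g x)) S := fun p hp => by
  obtain ⟨O, F, hO, hpO, hF, he⟩ := hf p hp
  obtain ⟨Q, G, hQ, hpQ, hG, he'⟩ := hg p hp
  refine ⟨O ∩ Q, fun x => (F x, G x), hO.inter hQ, ⟨hpO, hpQ⟩,
    (hF.mono inter_subset_left).prodMk (hG.mono inter_subset_right), fun q hq => ?_⟩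
  simp only [he ⟨hq.1, hq.2.1⟩, he' ⟨hq.1, hq.2.2⟩]

theorem SmoothOn.smul {f : X → ℝ} {g : X → Y} {S : Set X} (hf : SmoothOn f S)
    (hg : SmoothOn g S) : SmoothOn (fun x => f x • g x) S :=
  SmoothOn.comp (T := univ) (g := fun p : ℝ × Y => p.1 • p.2)
    (.of_contDiff (contDiff_fst.smul contDiff_snd)) (hf.prodMk hg) (mapsTo_univ _ _)

theorem SmoothOn.mul {f g : X → ℝ} {S : Set X} (hf : SmoothOn f S) (hg : SmoothOn g S) :
    SmoothOn (fun x => f x * g x) S := hf.smul hg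

theorem SmoothOn.sub {f g : X → Y} {S : Set X} (hf : SmoothOn f S) (hg : SmoothOn g S) :
    SmoothOn (fun x => f x - g x) S :=
  SmoothOn.comp (T := univ) (g := fun p : Y × Y => p.1 - p.2)
    (.of_contDiff (contDiff_fst.sub contDiff_snd)) (hf.prodMk hg) (mapsTo_univ _ _)

theorem SmoothOn.inv {f : X → ℝ} {S : Set X} (hf : SmoothOn f S) (h : ∀ p ∈ S, f p ≠ 0) :
    SmoothOn (fun x => (f x)⁻¹) S :=
  SmoothOn.comp (T := {t : ℝ | t ≠ 0}) (g := fun t : ℝ => t⁻¹)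
    (.of_contDiffOn isOpen_ne subset_rfl fun _ ht => (contDiffAt_inv ℝ ht).contDiffWithinAt) hf h

theorem SmoothOn.continuousOn {f : X → Y} {S : Set X} (hf : SmoothOn f S) : ContinuousOn f S :=
  fun p hp => by
    obtain ⟨O, F, hO, hpO, hF, he⟩ := hf p hp
    have h1 : ContinuousWithinAt F S p :=
      (hF.continuousOn.continuousAt (hO.mem_nhds hpO)).continuousWithinAt
    refine h1.congr_of_eventuallyEq ?_ (he ⟨hp, hpO⟩)
    filter_upwards [self_mem_nhdsWithin, mem_nhdsWithin_of_mem_nhds (hO.mem_nhds hpO)] with q h h'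
    exact he ⟨h, h'⟩

/-- A locally smooth function agrees near a point with a globally smooth one. -/
theorem exists_contDiff_eventuallyEq [FiniteDimensional ℝ X] {F : X → Y} {O : Set X}
    (hO : IsOpen O) (hF : ContDiffOn ℝ ∞ F O) {p : X} (hp : p ∈ O) :
    ∃ G : X → Y, ContDiff ℝ ∞ G ∧ G =ᶠ[𝓝 p] F := by
  obtain ⟨b, hbO⟩ : ∃ b : ContDiffBump p, Metric.closedBall p b.rOut ⊆ O := by
    obtain ⟨ε, hε, h⟩ := Metric.isOpen_iff.1 hO p hp
    exact ⟨⟨ε / 4, ε / 2, by positivity, by linarith⟩,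
      (Metric.closedBall_subset_ball (by simpa using hε)).trans h⟩
  refine ⟨fun x => b x • F x, ?_, ?_⟩
  · rw [contDiff_iff_contDiffAt]
    intro x
    by_cases hx : x ∈ O
    · exact b.contDiff.contDiffAt.smul (hF.contDiffAt (hO.mem_nhds hx))
    · have hxt : x ∉ tsupport b := fun h => hx (hbO (b.tsupport_eq ▸ h))
      have : (fun x => b x • F x) =ᶠ[𝓝 x] fun _ => 0 := by
        filter_upwards [notMem_tsupport_iff_eventuallyEq.1 hxt] with y hy
        simp [hy]
      exact contDiffAt_const.congr_of_eventuallyEq this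
  · filter_upwards [b.eventuallyEq_one] with x hx
    simp [hx]

theorem SmoothOn.exists_contDiff [FiniteDimensional ℝ X] {f : X → Y} {S : Set X}
    (hf : SmoothOn f S) {p : X} (hp : p ∈ S) :
    ∃ F : X → Y, ContDiff ℝ ∞ F ∧ ∀ᶠ q in 𝓝 p, q ∈ S → f q = F q := by
  obtain ⟨O, F, hO, hpO, hF, he⟩ := hf p hp
  obtain ⟨G, hG, hGF⟩ := exists_contDiff_eventuallyEq hO hF hpO
  refine ⟨G, hG, ?_⟩
  filter_upwards [hGF, hO.mem_nhds hpO] with q h h' hq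
  rw [h, he ⟨hq, h'⟩]

theorem SmoothOn.of_eventually {f : X → Y} {S : Set X}
    (h : ∀ p ∈ S, ∃ (F : X → Y) (O : Set X), IsOpen O ∧ p ∈ O ∧ ContDiffOn ℝ ∞ F O ∧
      ∀ᶠ q in 𝓝 p, q ∈ S → f q = F q) : SmoothOn f S := fun p hp => by
  obtain ⟨F, O, hO, hpO, hF, he⟩ := h p hp
  obtain ⟨Q, hQ, hQo, hpQ⟩ := eventually_nhds_iff.1 he
  exact ⟨O ∩ Q, F, hO.inter hQo, ⟨hpO, hpQ⟩, hF.mono inter_subset_left,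
    fun q hq => hQ q hq.2.2 hq.1⟩

end SmoothOn

/-! ## Normalisation -/

variable {n : ℕ}

/-- The Euclidean norm on `ℝⁿ × ℝ`. -/
def nrm (X : Euc n × ℝ) : ℝ := Real.sqrt (‖X.1‖ ^ 2 + X.2 ^ 2)

/-- Radial projection onto the unit sphere of `ℝⁿ × ℝ`. -/
def nu (X : Euc n × ℝ) : Euc n × ℝ := (nrm X)⁻¹ • X

/-- Radial projection in both factors. -/
def nu2 (p : Amb n) : Amb n := (nu p.1, nu p.2)

theorem nrm_nonneg (X : Euc n × ℝ) : 0 ≤ nrm X := Real.sqrt_nonneg _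

theorem nrm_sq (X : Euc n × ℝ) : nrm X ^ 2 = ‖X.1‖ ^ 2 + X.2 ^ 2 :=
  Real.sq_sqrt (by positivity)

theorem nrm_eq_zero {X : Euc n × ℝ} : nrm X = 0 ↔ X = 0 := by
  rw [nrm, Real.sqrt_eq_zero (by positivity)]
  constructor
  · intro h
    have h1 : ‖X.1‖ ^ 2 = 0 := by nlinarith [sq_nonneg ‖X.1‖, sq_nonneg X.2]
    have h2 : X.2 ^ 2 = 0 := by nlinarith [sq_nonneg ‖X.1‖, sq_nonneg X.2]
    exact Prod.ext (by simpa using h1) (by simpa using h2)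
  · rintro rfl; simp

theorem nrm_pos {X : Euc n × ℝ} (h : X ≠ 0) : 0 < nrm X :=
  (nrm_nonneg X).lt_of_ne fun h' => h (nrm_eq_zero.1 h'.symm)

theorem nrm_smul (a : ℝ) (X : Euc n × ℝ) : nrm (a • X) = |a| * nrm X := by
  rw [nrm, nrm, ← Real.sqrt_sq_eq_abs, ← Real.sqrt_mul (sq_nonneg a)]
  congr 1
  simp [norm_smul, mul_pow]; ring

theorem nrm_smul_nu {X : Euc n × ℝ} (h : X ≠ 0) : nrm X • nu X = X := by
  rw [nu, smul_smul, mul_inv_cancel₀ (nrm_pos h).ne', one_smul]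

theorem nrm_nu {X : Euc n × ℝ} (h : X ≠ 0) : nrm (nu X) = 1 := by
  rw [nu, nrm_smul, abs_of_pos (inv_pos.2 (nrm_pos h)), inv_mul_cancel₀ (nrm_pos h).ne']

theorem nu_smul {a : ℝ} (ha : 0 < a) (X : Euc n × ℝ) : nu (a • X) = nu X := by
  rw [nu, nu, nrm_smul, abs_of_pos ha, smul_smul, mul_inv, mul_assoc, mul_comm _ a, ← mul_assoc,
    inv_mul_cancel₀ ha.ne', one_mul]

theorem mem_hemi {X : Euc n × ℝ} : X ∈ hemi n ↔ nrm X = 1 ∧ 0 ≤ X.2 := by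
  rw [hemi, mem_ofPred_eq, ← nrm_sq, pow_eq_one_iff_of_nonneg (nrm_nonneg X) two_ne_zero]

theorem ne_zero_of_hemi {X : Euc n × ℝ} (h : X ∈ hemi n) : X ≠ 0 := by
  rintro rfl
  have := (mem_hemi.1 h).1
  rw [nrm_eq_zero.2 rfl] at this
  exact zero_ne_one this

theorem nu_mem_hemi {X : Euc n × ℝ} (h : X ≠ 0) (h' : 0 ≤ X.2) : nu X ∈ hemi n :=
  mem_hemi.2 ⟨nrm_nu h, mul_nonneg (inv_nonneg.2 (nrm_nonneg X)) h'⟩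

theorem nu_of_nrm {X : Euc n × ℝ} (h : nrm X = 1) : nu X = X := by simp [nu, h]

theorem nu_of_hemi {X : Euc n × ℝ} (h : X ∈ hemi n) : nu X = X := nu_of_nrm (mem_hemi.1 h).1

theorem nu2_of_dbl {p : Amb n} (h : p ∈ dbl n) : nu2 p = p :=
  Prod.ext (nu_of_hemi h.1) (nu_of_hemi h.2)

theorem nu_snd (X : Euc n × ℝ) : (nu X).2 = (nrm X)⁻¹ * X.2 := rfl

theorem nu_fst (X : Euc n × ℝ) : (nu X).1 = (nrm X)⁻¹ • X.1 := rfl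

theorem nu_snd_eq_zero {X : Euc n × ℝ} (h : X ≠ 0) : (nu X).2 = 0 ↔ X.2 = 0 := by
  rw [nu_snd, mul_eq_zero, inv_eq_zero]
  exact or_iff_right (nrm_pos h).ne'

theorem nu_snd_pos {X : Euc n × ℝ} (h : 0 < X.2) : 0 < (nu X).2 :=
  mul_pos (inv_pos.2 (nrm_pos fun h' => by simp [h'] at h)) h

theorem jb_eq (x : Euc n) : jb x = nrm (x, 1) := by simp [jb, nrm, add_comm]

theorem R_eq (x : Euc n) : R x = nu (x, 1) := by simp [R, nu, jb_eq]

theorem norm_eq_nrm (x : Euc n) : ‖x‖ = nrm (x, 0) := by simp [nrm]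

theorem dir_eq (x : Euc n) : dir x = nu (x, 0) := by simp [dir, nu, norm_eq_nrm]

theorem jb_pos (x : Euc n) : 0 < jb x := Real.sqrt_pos.2 (by positivity)

theorem norm_le_jb (x : Euc n) : ‖x‖ ≤ jb x := Real.le_sqrt_of_sq_le (by linarith)

theorem mk_one_ne_zero (x : Euc n) : (x, (1 : ℝ)) ≠ 0 := fun h => by
  simpa using congrArg Prod.snd h

theorem mk_zero_ne_zero {x : Euc n} (h : x ≠ 0) : (x, (0 : ℝ)) ≠ 0 := fun h' =>
  h (congrArg Prod.fst h')

theorem R_mem_hemi (x : Euc n) : R x ∈ hemi n := by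
  rw [R_eq]; exact nu_mem_hemi (mk_one_ne_zero x) zero_le_one

theorem R_snd (x : Euc n) : (R x).2 = (jb x)⁻¹ := rfl

theorem R_snd_pos (x : Euc n) : 0 < (R x).2 := inv_pos.2 (jb_pos x)

theorem dir_mem_hemi {x : Euc n} (h : x ≠ 0) : dir x ∈ hemi n := by
  rw [dir_eq]; exact nu_mem_hemi (mk_zero_ne_zero h) le_rfl

theorem Rinv_R (x : Euc n) : Rinv (R x) = x := by
  simp [Rinv, R, smul_smul, mul_inv_cancel₀ (jb_pos x).ne']

theorem jb_Rinv {p : Euc n × ℝ} (h : p ∈ hemi n) (h0 : 0 < p.2) : jb (Rinv p) = p.2⁻¹ := by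
  have h1 : (Rinv p, (1 : ℝ)) = p.2⁻¹ • p := by
    refine Prod.ext rfl ?_
    simp [inv_mul_cancel₀ h0.ne']
  rw [jb_eq, h1, nrm_smul, (mem_hemi.1 h).1, mul_one, abs_of_pos (inv_pos.2 h0)]

theorem R_Rinv {p : Euc n × ℝ} (h : p ∈ hemi n) (h0 : 0 < p.2) : R (Rinv p) = p := by
  rw [R, jb_Rinv h h0, inv_inv, Rinv, smul_smul, mul_inv_cancel₀ h0.ne', one_smul]

theorem nrm_fst_of_zero {p : Euc n × ℝ} (h : p ∈ hemi n) (h0 : p.2 = 0) : ‖p.1‖ = 1 := by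
  have h1 := nrm_sq p
  rw [(mem_hemi.1 h).1, h0] at h1
  have h2 : ‖p.1‖ ^ 2 = 1 := by linarith
  rwa [pow_eq_one_iff_of_nonneg (norm_nonneg _) two_ne_zero] at h2

theorem dir_fst {p : Euc n × ℝ} (h : p ∈ hemi n) (h0 : p.2 = 0) : dir p.1 = p := by
  rw [dir, nrm_fst_of_zero h h0]
  exact Prod.ext (by simp) h0.symm

theorem continuous_nrm : Continuous (nrm : Euc n × ℝ → ℝ) := by unfold nrm; fun_prop

theorem contDiffAt_nrm {X : Euc n × ℝ} (h : X ≠ 0) : ContDiffAt ℝ ∞ nrm X := by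
  unfold nrm
  refine ContDiffAt.sqrt ?_ ?_
  · exact ((contDiff_fst.norm_sq ℝ).add (contDiff_snd.pow 2)).contDiffAt
  · have := nrm_pos h
    rw [nrm, Real.sqrt_pos] at this
    exact this.ne'

theorem contDiffAt_nu {X : Euc n × ℝ} (h : X ≠ 0) : ContDiffAt ℝ ∞ nu X :=
  ((contDiffAt_nrm h).inv (nrm_pos h).ne').smul contDiffAt_id

theorem contDiffAt_nu2 {p : Amb n} (h : p.1 ≠ 0) (h' : p.2 ≠ 0) : ContDiffAt ℝ ∞ nu2 p :=
  ((contDiffAt_nu h).comp p contDiffAt_fst).prodMk ((contDiffAt_nu h').comp p contDiffAt_snd)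

/-! ## Homogeneous extension -/

/-- Homogeneous extension of degree `(l, m)` of a function on the product of spheres. -/
def hext {F : Type*} [SMul ℝ F] (l m : ℝ) (G : Amb n → F) (p : Amb n) : F :=
  (nrm p.1 ^ l * nrm p.2 ^ m) • G (nu2 p)

/-- The embeddings of phase space as slices of the ambient space. -/
def emb (s u : ℝ) (z : Phase n) : Amb n := ((z.1, s), (z.2, u))

/-- The symbol on the interior given by `a`. -/
def symbInt (l m : ℝ) (a : Amb n → ℝ) (z : Phase n) : ℝ :=
  jb z.1 ^ l * jb z.2 ^ m * a (ptInt z)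

/-- The bihomogeneous function given by `a`. -/
def symbCorner (l m : ℝ) (a : Amb n → ℝ) (z : Phase n) : ℝ :=
  ‖z.1‖ ^ l * ‖z.2‖ ^ m * a (ptCorner z)

theorem ptInt_eq (z : Phase n) : ptInt z = nu2 (emb 1 1 z) := by simp [ptInt, nu2, emb, R_eq]
theorem ptE_eq (z : Phase n) : ptE z = nu2 (emb 0 1 z) := by simp [ptE, nu2, emb, R_eq, dir_eq]
theorem ptPsi_eq (z : Phase n) : ptPsi z = nu2 (emb 1 0 z) := by
  simp [ptPsi, nu2, emb, R_eq, dir_eq]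
theorem ptCorner_eq (z : Phase n) : ptCorner z = nu2 (emb 0 0 z) := by
  simp [ptCorner, nu2, emb, dir_eq]

theorem symbInt_eq (l m : ℝ) (a : Amb n → ℝ) : symbInt l m a = hext l m a ∘ emb 1 1 := by
  ext z; simp [symbInt, hext, ptInt_eq, jb_eq, emb]
theorem symbE_eq (l m : ℝ) (a : Amb n → ℝ) : symbE l m a = hext l m a ∘ emb 0 1 := by
  ext z; simp [symbE, hext, ptE_eq, jb_eq, emb, norm_eq_nrm]
theorem symbPsi_eq (l m : ℝ) (a : Amb n → ℝ) : symbPsi l m a = hext l m a ∘ emb 1 0 := by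
  ext z; simp [symbPsi, hext, ptPsi_eq, jb_eq, emb, norm_eq_nrm]
theorem symbCorner_eq (l m : ℝ) (a : Amb n → ℝ) :
    symbCorner l m a = hext l m a ∘ emb 0 0 := by
  ext z; simp [symbCorner, hext, ptCorner_eq, emb, norm_eq_nrm]

section hext

variable {F : Type*} [NormedAddCommGroup F] [NormedSpace ℝ F]

theorem hext_smul (l m : ℝ) (G : Amb n → F) {a b : ℝ} (ha : 0 < a) (hb : 0 < b) (p : Amb n) :
    hext l m G (a • p.1, b • p.2) = (a ^ l * b ^ m) • hext l m G p := by
  simp only [hext, nu2, nu_smul ha, nu_smul hb, nrm_smul, abs_of_pos ha, abs_of_pos hb,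
    Real.mul_rpow ha.le (nrm_nonneg _), Real.mul_rpow hb.le (nrm_nonneg _), smul_smul]
  congr 1; ring

theorem contDiffAt_hext (l m : ℝ) {G : Amb n → F} (hG : ContDiff ℝ ∞ G) {p : Amb n}
    (h : p.1 ≠ 0) (h' : p.2 ≠ 0) : ContDiffAt ℝ ∞ (hext l m G) p := by
  refine ContDiffAt.smul (ContDiffAt.mul ?_ ?_) (hG.contDiffAt.comp p (contDiffAt_nu2 h h'))
  · exact ((contDiffAt_nrm h).comp p contDiffAt_fst).rpow_const_of_ne (nrm_pos h).ne'
  · exact ((contDiffAt_nrm h').comp p contDiffAt_snd).rpow_const_of_ne (nrm_pos h').ne'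

theorem hext_of_dbl (l m : ℝ) (G : Amb n → F) {p : Amb n} (h : p ∈ dbl n) :
    hext l m G p = G p := by
  simp [hext, nu2_of_dbl h, (mem_hemi.1 h.1).1, (mem_hemi.1 h.2).1]

end hext

theorem contDiff_emb (s u : ℝ) : ContDiff ℝ ∞ (emb s u : Phase n → Amb n) := by
  unfold emb; fun_prop

theorem isOpen_ne_ne : IsOpen {p : Amb n | p.1 ≠ 0 ∧ p.2 ≠ 0} :=
  (isOpen_ne.preimage continuous_fst).inter (isOpen_ne.preimage continuous_snd)

theorem continuousAt_nu2 {p : Amb n} (h : p.1 ≠ 0) (h' : p.2 ≠ 0) : ContinuousAt nu2 p :=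
  (contDiffAt_nu2 h h').continuousAt

theorem nu2_mem_dbl {p : Amb n} (h : p.1 ≠ 0) (h' : p.2 ≠ 0) (hs : 0 ≤ p.1.2) (hu : 0 ≤ p.2.2) :
    nu2 p ∈ dbl n := ⟨nu_mem_hemi h hs, nu_mem_hemi h' hu⟩

/-! ## Faces -/

theorem mem_dbl_of_faceE {p : Amb n} (h : p ∈ faceE n) : p ∈ dbl n := h.1
theorem mem_dbl_of_facePsi {p : Amb n} (h : p ∈ facePsi n) : p ∈ dbl n := h.1
theorem mem_dbl_of_bdry {p : Amb n} (h : p ∈ bdry n) : p ∈ dbl n := h.elim And.left And.left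

theorem isClosed_hemi : IsClosed (hemi n) :=
  (isClosed_eq (by fun_prop) continuous_const).inter (isClosed_le continuous_const continuous_snd)

theorem isClosed_dbl : IsClosed (dbl n) := isClosed_hemi.prod isClosed_hemi

theorem isClosed_faceE : IsClosed (faceE n) :=
  isClosed_dbl.inter (isClosed_eq (by fun_prop) continuous_const)

theorem isClosed_facePsi : IsClosed (facePsi n) :=
  isClosed_dbl.inter (isClosed_eq (by fun_prop) continuous_const)

theorem isClosed_bdry : IsClosed (bdry n) := isClosed_faceE.union isClosed_facePsi

theorem ptInt_mem_dbl (z : Phase n) : ptInt z ∈ dbl n := ⟨R_mem_hemi _, R_mem_hemi _⟩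
theorem ptE_mem_faceE {z : Phase n} (h : z.1 ≠ 0) : ptE z ∈ faceE n :=
  ⟨⟨dir_mem_hemi h, R_mem_hemi _⟩, rfl⟩
theorem ptPsi_mem_facePsi {z : Phase n} (h : z.2 ≠ 0) : ptPsi z ∈ facePsi n :=
  ⟨⟨R_mem_hemi _, dir_mem_hemi h⟩, rfl⟩
theorem ptCorner_mem_corner {z : Phase n} (h : z.1 ≠ 0) (h' : z.2 ≠ 0) : ptCorner z ∈ corner n :=
  ⟨⟨⟨dir_mem_hemi h, dir_mem_hemi h'⟩, rfl⟩, ⟨dir_mem_hemi h, dir_mem_hemi h'⟩, rfl⟩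
theorem ptE_notMem_facePsi (z : Phase n) : ptE z ∉ facePsi n := fun h =>
  (R_snd_pos z.2).ne' h.2
theorem ptPsi_notMem_faceE (z : Phase n) : ptPsi z ∉ faceE n := fun h =>
  (R_snd_pos z.1).ne' h.2
theorem ptInt_notMem_bdry (z : Phase n) : ptInt z ∉ bdry n := fun h =>
  h.elim (fun h => (R_snd_pos z.1).ne' h.2) fun h => (R_snd_pos z.2).ne' h.2

theorem exists_ptInt {p : Amb n} (h : p ∈ dbl n) (hb : p ∉ bdry n) : ∃ z, ptInt z = p := by
  have h1 : 0 < p.1.2 := h.1.2.lt_of_ne fun h' => hb (.inl ⟨h, h'.symm⟩)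
  have h2 : 0 < p.2.2 := h.2.2.lt_of_ne fun h' => hb (.inr ⟨h, h'.symm⟩)
  exact ⟨(Rinv p.1, Rinv p.2), Prod.ext (R_Rinv h.1 h1) (R_Rinv h.2 h2)⟩

theorem exists_ptE {p : Amb n} (h : p ∈ faceE n) (hb : p ∉ facePsi n) :
    ∃ z : Phase n, z.1 ≠ 0 ∧ ‖z.1‖ = 1 ∧ ptE z = p := by
  have h2 : 0 < p.2.2 := h.1.2.2.lt_of_ne fun h' => hb ⟨h.1, h'.symm⟩
  have h3 := nrm_fst_of_zero h.1.1 h.2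
  exact ⟨(p.1.1, Rinv p.2), fun h0 => by simp [show p.1.1 = 0 from h0] at h3, h3,
    Prod.ext (dir_fst h.1.1 h.2) (R_Rinv h.1.2 h2)⟩

theorem exists_ptPsi {p : Amb n} (h : p ∈ facePsi n) (hb : p ∉ faceE n) :
    ∃ z : Phase n, z.2 ≠ 0 ∧ ‖z.2‖ = 1 ∧ ptPsi z = p := by
  have h2 : 0 < p.1.2 := h.1.1.2.lt_of_ne fun h' => hb ⟨h.1, h'.symm⟩
  have h3 := nrm_fst_of_zero h.1.2 h.2
  exact ⟨(Rinv p.1, p.2.1), fun h0 => by simp [show p.2.1 = 0 from h0] at h3, h3,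
    Prod.ext (R_Rinv h.1.1 h2) (dir_fst h.1.2 h.2)⟩

theorem ptInt_injective : Function.Injective (ptInt : Phase n → Amb n) := fun z w h => by
  have h1 := congrArg (fun p : Amb n => Rinv p.1) h
  have h2 := congrArg (fun p : Amb n => Rinv p.2) h
  simp only [ptInt, Rinv_R] at h1 h2
  exact Prod.ext h1 h2

/-! ## Relatively open sets -/

theorem RelOpen.subset {X : Type*} [TopologicalSpace X] {S M : Set X} (h : RelOpen S M) :
    S ⊆ M := by
  obtain ⟨O, -, rfl⟩ := h
  exact inter_subset_right

theorem RelOpen.eventually {X : Type*} [TopologicalSpace X] {S M : Set X} (h : RelOpen S M)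
    {p : X} (hp : p ∈ S) : ∀ᶠ q in 𝓝 p, q ∈ M → q ∈ S := by
  obtain ⟨O, hO, rfl⟩ := h
  filter_upwards [hO.mem_nhds hp.1] with q hq hqM using ⟨hq, hqM⟩

theorem relOpen_of_eventually {X : Type*} [TopologicalSpace X] {S M : Set X} (hS : S ⊆ M)
    (h : ∀ p ∈ S, ∀ᶠ q in 𝓝 p, q ∈ M → q ∈ S) : RelOpen S M := by
  refine ⟨interior {q | q ∈ M → q ∈ S}, isOpen_interior, Subset.antisymm (fun p hp => ?_) ?_⟩
  · exact ⟨mem_interior_iff_mem_nhds.2 (h p hp), hS hp⟩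
  · rintro p ⟨hp, hpM⟩
    exact interior_subset hp hpM

/-- Points of a slice whose normalisation lies in a relatively open set form an open set. -/
theorem eventually_nu2_emb_mem {S M : Set (Amb n)} (hS : RelOpen S M) {s u : ℝ} {z : Phase n}
    (h : (emb s u z).1 ≠ 0) (h' : (emb s u z).2 ≠ 0) (hz : nu2 (emb s u z) ∈ S)
    (hM : ∀ w, (emb s u w).1 ≠ 0 → (emb s u w).2 ≠ 0 → nu2 (emb s u w) ∈ M) :
    ∀ᶠ w in 𝓝 z, nu2 (emb s u w) ∈ S := by
  have hc : ContinuousAt (fun w => nu2 (emb s u w)) z :=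
    ContinuousAt.comp (f := emb s u) (continuousAt_nu2 h h')
      (contDiff_emb s u).continuous.continuousAt
  have h0 : ∀ᶠ w in 𝓝 z, emb s u w ∈ {p : Amb n | p.1 ≠ 0 ∧ p.2 ≠ 0} :=
    (contDiff_emb s u).continuous.continuousAt.eventually (isOpen_ne_ne.mem_nhds ⟨h, h'⟩)
  filter_upwards [hc.eventually (hS.eventually hz), h0] with w hw h0w
  exact hw (hM w h0w.1 h0w.2)

theorem isOpen_intPart {Ω : Set (Amb n)} (h : RelOpen Ω (dbl n)) : IsOpen (intPart Ω) := by
  rw [isOpen_iff_mem_nhds]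
  intro z hz
  have := eventually_nu2_emb_mem h (s := 1) (u := 1) (z := z) (mk_one_ne_zero _)
    (mk_one_ne_zero _) (ptInt_eq z ▸ hz) fun w _ _ => ptInt_eq w ▸ ptInt_mem_dbl w
  filter_upwards [this] with w hw
  rw [← ptInt_eq] at hw; exact hw

theorem isOpen_coneE {U : Set (Amb n)} (h : RelOpen U (bdry n)) : IsOpen (coneE U) := by
  rw [isOpen_iff_mem_nhds]
  rintro z ⟨hz, hzU⟩
  have := eventually_nu2_emb_mem h (s := 0) (u := 1) (z := z) (mk_zero_ne_zero hz)
    (mk_one_ne_zero _) (ptE_eq z ▸ hzU) fun w hw _ => .inl (ptE_eq w ▸ ptE_mem_faceE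
      fun h0 => hw (by simp [emb, h0]))
  filter_upwards [this, (isOpen_ne.preimage continuous_fst).mem_nhds hz] with w hw hw0
  rw [← ptE_eq] at hw; exact ⟨hw0, hw⟩

theorem isOpen_conePsi {U : Set (Amb n)} (h : RelOpen U (bdry n)) : IsOpen (conePsi U) := by
  rw [isOpen_iff_mem_nhds]
  rintro z ⟨hz, hzU⟩
  have := eventually_nu2_emb_mem h (s := 1) (u := 0) (z := z) (mk_one_ne_zero _)
    (mk_zero_ne_zero hz) (ptPsi_eq z ▸ hzU) fun w _ hw => .inr (ptPsi_eq w ▸ ptPsi_mem_facePsi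
      fun h0 => hw (by simp [emb, h0]))
  filter_upwards [this, (isOpen_ne.preimage continuous_snd).mem_nhds hz] with w hw hw0
  rw [← ptPsi_eq] at hw; exact ⟨hw0, hw⟩

theorem isOpen_coneCorner {U : Set (Amb n)} (h : RelOpen U (bdry n)) : IsOpen (coneCorner U) := by
  rw [isOpen_iff_mem_nhds]
  rintro z ⟨hz, hz', hzU⟩
  have := eventually_nu2_emb_mem h (s := 0) (u := 0) (z := z) (mk_zero_ne_zero hz)
    (mk_zero_ne_zero hz') (ptCorner_eq z ▸ hzU) fun w hw hw' => .inl (ptCorner_eq w ▸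
      (ptCorner_mem_corner (fun h0 => hw (by simp [emb, h0]))
        (fun h0 => hw' (by simp [emb, h0]))).1)
  filter_upwards [this, (isOpen_ne.preimage continuous_fst).mem_nhds hz,
    (isOpen_ne.preimage continuous_snd).mem_nhds hz'] with w hw hw0 hw0'
  rw [← ptCorner_eq] at hw; exact ⟨hw0, hw0', hw⟩

end

end ScGeom

namespace ScGeom

noncomputable section

variable {n : ℕ}

/-! ## Symbol estimates -/

theorem iteratedFDeriv_comp_affine {A V F : Type*} [NormedAddCommGroup A] [NormedSpace ℝ A]
    [NormedAddCommGroup V] [NormedSpace ℝ V] [NormedAddCommGroup F] [NormedSpace ℝ F]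
    {φ : A → F} (hφ : ContDiff ℝ ∞ φ) (L : V →L[ℝ] A) (q : A) (k : ℕ) (v : V) :
    iteratedFDeriv ℝ k (fun v => φ (L v + q)) v =
      (iteratedFDeriv ℝ k φ (L v + q)).compContinuousLinearMap fun _ => L := by
  have h : ContDiff ℝ ∞ fun a => φ (a + q) := hφ.comp (contDiff_id.add contDiff_const)
  have := L.iteratedFDeriv_comp_right h v (i := k) (by exact_mod_cast le_top)
  rw [iteratedFDeriv_comp_add_right] at this
  exact this

/-- The chain rule for an affine map has no lower order terms. The inner derivative is the composite
with a fixed linear operator `Λ` on multilinear maps, which can be taken out of the outer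
derivative. Each derivative in `x` or `ξ` costs one factor of the norm of `L` on that variable. -/
theorem norm_mixedDeriv_comp_affine_le {A : Type} [NormedAddCommGroup A] [NormedSpace ℝ A]
    {φ : A → ℝ} (hφ : ContDiff ℝ ∞ φ) (L : Phase n →L[ℝ] A) (q : A) (j k : ℕ) (c : ℝ)
    (z : Phase n) :
    ‖mixedDeriv j k (fun z => c * φ (L z + q)) z‖ ≤
      |c| * ‖iteratedFDeriv ℝ j (iteratedFDeriv ℝ k φ) (L z + q)‖ *
        (‖L.comp (.inl ℝ (Euc n) (Euc n))‖ ^ j * ‖L.comp (.inr ℝ (Euc n) (Euc n))‖ ^ k) := by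
  set L₁ := L.comp (.inl ℝ (Euc n) (Euc n))
  set L₂ := L.comp (.inr ℝ (Euc n) (Euc n))
  have hsplit : ∀ x ξ, L (x, ξ) + q = L₂ ξ + (L₁ x + q) := fun x ξ => by
    have : ((x, ξ) : Phase n) = (x, 0) + (0, ξ) := by simp
    rw [this, map_add]; simp only [L₁, L₂, ContinuousLinearMap.comp_apply,
      ContinuousLinearMap.inl_apply, ContinuousLinearMap.inr_apply]; abel
  set Λ₀ : (A [×k]→L[ℝ] ℝ) →L[ℝ] (Euc n [×k]→L[ℝ] ℝ) :=
    ContinuousMultilinearMap.compContinuousLinearMapL (fun _ : Fin k => L₂) with hΛ₀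
  set Λ := c • Λ₀
  have hΛ : ‖Λ‖ ≤ |c| * ‖L₂‖ ^ k := by
    refine (ContinuousLinearMap.opNorm_smul_le c Λ₀).trans ?_
    rw [Real.norm_eq_abs]
    gcongr
    rw [hΛ₀]
    simpa using ContinuousMultilinearMap.norm_compContinuousLinearMapL_le (𝕜 := ℝ) (G := ℝ) (fun _ : Fin k => L₂)
  have hΦ : ContDiff ℝ ∞ (iteratedFDeriv ℝ k φ) :=
    hφ.iteratedFDeriv_right (by exact_mod_cast le_top)
  have hin : (fun x => iteratedFDeriv ℝ k (fun ξ => c * φ (L (x, ξ) + q)) z.2) =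
      Λ ∘ fun x => iteratedFDeriv ℝ k φ (L₁ x + (L₂ z.2 + q)) := by
    funext x
    have h1 : (fun ξ => c * φ (L (x, ξ) + q)) = fun ξ => (fun a => c * φ a) (L₂ ξ + (L₁ x + q)) := by
      funext ξ; rw [hsplit]
    have h2 : ContDiff ℝ ∞ (fun a => c * φ a) := contDiff_const.mul hφ
    have h3 : iteratedFDeriv ℝ k (fun a => c * φ a) = c • iteratedFDeriv ℝ k φ := by
      funext a
      exact iteratedFDeriv_const_smul_apply (a := c) (hφ.of_le (by exact_mod_cast le_top)).contDiffAt
    rw [h1, iteratedFDeriv_comp_affine h2, h3]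
    have h4 : L₂ z.2 + (L₁ x + q) = L₁ x + (L₂ z.2 + q) := by abel
    rw [h4]
    rfl
  have hz : L₁ z.1 + (L₂ z.2 + q) = L z + q := by rw [← Prod.mk.eta (p := z), hsplit]; abel
  rw [mixedDeriv, hin]
  have hd : ContDiff ℝ ∞ fun x => iteratedFDeriv ℝ k φ (L₁ x + (L₂ z.2 + q)) :=
    hΦ.comp (L₁.contDiff.add contDiff_const)
  refine (Λ.norm_iteratedFDeriv_comp_left (N := ∞) (hd.contDiffAt)
    (by exact_mod_cast le_top)).trans ?_
  rw [iteratedFDeriv_comp_affine hΦ, hz]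
  have h5 := (iteratedFDeriv ℝ j (iteratedFDeriv ℝ k φ) (L z + q)).norm_compContinuousLinearMap_le
    (fun _ => L₁)
  simp only [Finset.prod_const, Finset.card_univ, Fintype.card_fin] at h5
  calc _ ≤ (|c| * ‖L₂‖ ^ k) *
        (‖iteratedFDeriv ℝ j (iteratedFDeriv ℝ k φ) (L z + q)‖ * ‖L₁‖ ^ j) := by gcongr
    _ = _ := by ring

theorem mixedDeriv_congr {f g : Phase n → ℝ} {z : Phase n} (h : f =ᶠ[𝓝 z] g) (j k : ℕ) :
    mixedDeriv j k f z = mixedDeriv j k g z := by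
  unfold mixedDeriv
  refine Filter.EventuallyEq.eq_of_nhds (Filter.EventuallyEq.iteratedFDeriv (𝕜 := ℝ) ?_ j)
  have h1 : Tendsto (fun x => (x, z.2)) (𝓝 z.1) (𝓝 z) :=
    (Continuous.prodMk_left z.2).tendsto' _ _ rfl
  filter_upwards [h1.eventually (eventually_eventually_nhds.2 h)] with x hx
  refine Filter.EventuallyEq.eq_of_nhds (Filter.EventuallyEq.iteratedFDeriv (𝕜 := ℝ) ?_ k)
  exact ((Continuous.prodMk_right x).tendsto' _ _ rfl : Tendsto _ (𝓝 z.2) (𝓝 (x, z.2))).eventually hx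

/-! ### Smoothness and locality of slices of homogeneous extensions -/

section hext

variable {F : Type*} [NormedAddCommGroup F] [NormedSpace ℝ F]

theorem hext_emb_eventuallyEq {G G' : Amb n → F} {S : Set (Amb n)} {s u : ℝ}
    {z : Phase n} (h : (emb s u z).1 ≠ 0) (h' : (emb s u z).2 ≠ 0)
    (hS : ∀ᶠ w in 𝓝 z, nu2 (emb s u w) ∈ S)
    (hG : ∀ᶠ q in 𝓝 (nu2 (emb s u z)), q ∈ S → G q = G' q) (l m : ℝ) :
    (fun w => hext l m G (emb s u w)) =ᶠ[𝓝 z] fun w => hext l m G' (emb s u w) := by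
  have hc : ContinuousAt (fun w => nu2 (emb s u w)) z :=
    ContinuousAt.comp (f := emb s u) (continuousAt_nu2 h h')
      (contDiff_emb s u).continuous.continuousAt
  filter_upwards [hS, hc.eventually hG] with w h1 h2
  simp only [hext, h2 h1]

theorem contDiffAt_hext_emb {G : Amb n → F} {S : Set (Amb n)} (hG : SmoothOn G S) {s u : ℝ}
    {z : Phase n} (h : (emb s u z).1 ≠ 0) (h' : (emb s u z).2 ≠ 0)
    (hS : ∀ᶠ w in 𝓝 z, nu2 (emb s u w) ∈ S) (l m : ℝ) :
    ContDiffAt ℝ ∞ (fun w => hext l m G (emb s u w)) z := by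
  obtain ⟨G', hG', he⟩ := hG.exists_contDiff hS.self_of_nhds
  refine ContDiffAt.congr_of_eventuallyEq ?_ (hext_emb_eventuallyEq h h' hS he l m)
  exact ContDiffAt.comp z (contDiffAt_hext l m hG' h h') (contDiff_emb s u).contDiffAt

end hext

/-- The slice `w ↦ (w₁ / a, w₂ / b)` as a linear map into the ambient space. -/
def scaleL (a b : ℝ) : Phase n →L[ℝ] Amb n :=
  ((a • ContinuousLinearMap.fst ℝ (Euc n) (Euc n)).prod 0).prod
    ((b • ContinuousLinearMap.snd ℝ (Euc n) (Euc n)).prod 0)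

theorem scaleL_apply (a b : ℝ) (w : Phase n) : scaleL a b w = ((a • w.1, 0), (b • w.2, 0)) := rfl

theorem norm_scaleL_inl {a : ℝ} (ha : 0 ≤ a) (b : ℝ) :
    ‖(scaleL a b).comp (.inl ℝ (Euc n) (Euc n))‖ ≤ a := by
  refine ContinuousLinearMap.opNorm_le_bound _ ha fun x => ?_
  simp [scaleL_apply, Prod.norm_def, norm_smul, abs_of_nonneg ha]
  exact mul_nonneg ha (norm_nonneg x)

theorem norm_scaleL_inr {b : ℝ} (hb : 0 ≤ b) (a : ℝ) :
    ‖(scaleL a b).comp (.inr ℝ (Euc n) (Euc n))‖ ≤ b := by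
  refine ContinuousLinearMap.opNorm_le_bound _ hb fun x => ?_
  simp [scaleL_apply, Prod.norm_def, norm_smul, abs_of_nonneg hb]
  exact mul_nonneg hb (norm_nonneg x)

/-- Near `z` the slice is `a^l b^m` times a fixed smooth function composed with a map that shrinks
`x` by `a` and `ξ` by `b`, where `a` and `b` are the norms at `z`. Derivatives therefore gain powers
of `a⁻¹` and `b⁻¹`, and what remains is evaluated near `p₀`, where it is bounded. -/
theorem norm_mixedDeriv_hext_le_near {G : Amb n → ℝ} {S : Set (Amb n)} (hG : SmoothOn G S)
    (hSd : S ⊆ dbl n) {p₀ : Amb n} (hp₀ : p₀ ∈ S) (l m s u : ℝ) (j k : ℕ) :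
    ∃ c : ℝ, ∀ᶠ p in 𝓝 p₀, ∀ z : Phase n, (emb s u z).1 ≠ 0 → (emb s u z).2 ≠ 0 →
      nu2 (emb s u z) = p → (∀ᶠ w in 𝓝 z, nu2 (emb s u w) ∈ S) →
      ‖mixedDeriv j k (fun w => hext l m G (emb s u w)) z‖ ≤
        c * (nrm (emb s u z).1 ^ (l - j) * nrm (emb s u z).2 ^ (m - k)) := by
  obtain ⟨F, hF, he⟩ := hG.exists_contDiff hp₀
  have hmem : p₀ ∈ {p : Amb n | p.1 ≠ 0 ∧ p.2 ≠ 0} :=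
    ⟨ne_zero_of_hemi (hSd hp₀).1, ne_zero_of_hemi (hSd hp₀).2⟩
  -- The homogeneous extension is singular where a factor vanishes; `φ` is a globally smooth
  -- function equal to it near `p₀`.
  obtain ⟨φ, hφ, hφF⟩ := exists_contDiff_eventuallyEq isOpen_ne_ne
    (F := hext l m F) (fun p hp => (contDiffAt_hext l m hF hp.1 hp.2).contDiffWithinAt) hmem
  have hcont : Continuous fun p => ‖iteratedFDeriv ℝ j (iteratedFDeriv ℝ k φ) p‖ := by
    have h1 : ContDiff ℝ ∞ (iteratedFDeriv ℝ k φ) :=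
      hφ.iteratedFDeriv_right (by exact_mod_cast le_top)
    exact (h1.continuous_iteratedFDeriv (by exact_mod_cast le_top)).norm
  refine ⟨‖iteratedFDeriv ℝ j (iteratedFDeriv ℝ k φ) p₀‖ + 1, ?_⟩
  filter_upwards [hcont.continuousAt.eventually (eventually_lt_nhds (lt_add_one _)),
    eventually_eventually_nhds.2 he, eventually_eventually_nhds.2 hφF] with p hb hp1 hp2 z h h' hz hS
  set a := nrm (emb s u z).1 with ha
  set b := nrm (emb s u z).2 with hb'
  have ha0 : 0 < a := nrm_pos h
  have hb0 : 0 < b := nrm_pos h'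
  -- `q` carries the heights of the normalised point, so that the affine map sends `z` itself to
  -- `p`.
  set q : Amb n := ((0, a⁻¹ * s), (0, b⁻¹ * u))
  have hLq : ∀ w, scaleL a⁻¹ b⁻¹ w + q = (a⁻¹ • (emb s u w).1, b⁻¹ • (emb s u w).2) := fun w => by
    simp [scaleL_apply, q, emb]
  have hLz : scaleL a⁻¹ b⁻¹ z + q = p := by rw [hLq, ← hz]; rfl
  have heq : (fun w => hext l m G (emb s u w)) =ᶠ[𝓝 z]
      fun w => (a ^ l * b ^ m) * φ (scaleL a⁻¹ b⁻¹ w + q) := by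
    have ht : Tendsto (fun w => scaleL a⁻¹ b⁻¹ w + q) (𝓝 z) (𝓝 p) :=
      Continuous.tendsto' (by fun_prop) _ _ hLz
    filter_upwards [hext_emb_eventuallyEq h h' hS (hz.symm ▸ hp1) l m, ht.eventually hp2]
      with w h1 h2
    rw [h1, h2, hLq, hext_smul _ _ _ (inv_pos.2 ha0) (inv_pos.2 hb0), Real.inv_rpow ha0.le,
      Real.inv_rpow hb0.le, smul_eq_mul]
    have := (Real.rpow_pos_of_pos ha0 l).ne'
    have := (Real.rpow_pos_of_pos hb0 m).ne'
    field_simp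
  rw [mixedDeriv_congr heq]
  refine (norm_mixedDeriv_comp_affine_le hφ _ q j k _ z).trans ?_
  rw [hLz, Real.rpow_sub_natCast ha0.ne', Real.rpow_sub_natCast hb0.ne',
    abs_of_nonneg (by positivity)]
  calc _ ≤ a ^ l * b ^ m * (‖iteratedFDeriv ℝ j (iteratedFDeriv ℝ k φ) p₀‖ + 1) *
        (a⁻¹ ^ j * b⁻¹ ^ k) := by
        gcongr
        · exact norm_scaleL_inl (inv_nonneg.2 ha0.le) _
        · exact norm_scaleL_inr (inv_nonneg.2 hb0.le) _
    _ = _ := by simp only [inv_pow, div_eq_mul_inv]; ring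

/-- Symbol estimates, uniform over compact sets, of the homogeneous extension of a smooth
function. -/
theorem norm_mixedDeriv_hext_le {G : Amb n → ℝ} {S K : Set (Amb n)} (hG : SmoothOn G S)
    (hSd : S ⊆ dbl n) (hK : IsCompact K) (hKS : K ⊆ S) (l m s u : ℝ) (j k : ℕ) :
    ∃ c : ℝ, ∀ z : Phase n, (emb s u z).1 ≠ 0 → (emb s u z).2 ≠ 0 →
      nu2 (emb s u z) ∈ K → (∀ᶠ w in 𝓝 z, nu2 (emb s u w) ∈ S) →
      ‖mixedDeriv j k (fun w => hext l m G (emb s u w)) z‖ ≤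
        c * (nrm (emb s u z).1 ^ (l - j) * nrm (emb s u z).2 ^ (m - k)) := by
  refine hK.induction_on (p := fun K => ∃ c : ℝ, ∀ z : Phase n, (emb s u z).1 ≠ 0 →
      (emb s u z).2 ≠ 0 → nu2 (emb s u z) ∈ K → (∀ᶠ w in 𝓝 z, nu2 (emb s u w) ∈ S) →
      ‖mixedDeriv j k (fun w => hext l m G (emb s u w)) z‖ ≤
        c * (nrm (emb s u z).1 ^ (l - j) * nrm (emb s u z).2 ^ (m - k))) ?_ ?_ ?_ ?_
  · exact ⟨0, fun z _ _ h => h.elim⟩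
  · rintro K₁ K₂ h ⟨c, hc⟩
    exact ⟨c, fun z h1 h2 h3 => hc z h1 h2 (h h3)⟩
  · rintro K₁ K₂ ⟨c₁, h₁⟩ ⟨c₂, h₂⟩
    refine ⟨max c₁ c₂, fun z h1 h2 h3 h4 => ?_⟩
    have hnn : 0 ≤ nrm (emb s u z).1 ^ (l - j) * nrm (emb s u z).2 ^ (m - k) :=
      mul_nonneg (Real.rpow_nonneg (nrm_nonneg _) _) (Real.rpow_nonneg (nrm_nonneg _) _)
    rcases h3 with h3 | h3
    · exact (h₁ z h1 h2 h3 h4).trans (mul_le_mul_of_nonneg_right (le_max_left _ _) hnn)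
    · exact (h₂ z h1 h2 h3 h4).trans (mul_le_mul_of_nonneg_right (le_max_right _ _) hnn)
  · intro p hp
    obtain ⟨c, hc⟩ := norm_mixedDeriv_hext_le_near hG hSd (hKS hp) l m s u j k
    refine ⟨_, mem_nhdsWithin_of_mem_nhds hc, c, fun z h1 h2 h3 h4 => h3 z h1 h2 rfl h4⟩

/-! ### Neighbourhoods in the four slices -/

theorem eventually_ptInt_mem {Ω : Set (Amb n)} (hΩ : RelOpen Ω (dbl n)) {z : Phase n}
    (hz : ptInt z ∈ Ω) : ∀ᶠ w in 𝓝 z, nu2 (emb 1 1 w) ∈ Ω := by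
  filter_upwards [(isOpen_intPart hΩ).mem_nhds hz] with w hw
  rw [← ptInt_eq]; exact hw

theorem eventually_ptE_mem {U : Set (Amb n)} (hU : RelOpen U (bdry n)) {z : Phase n}
    (hz : z ∈ coneE U) : ∀ᶠ w in 𝓝 z, nu2 (emb 0 1 w) ∈ U ∩ faceE n := by
  filter_upwards [(isOpen_coneE hU).mem_nhds hz] with w hw
  rw [← ptE_eq]; exact ⟨hw.2, ptE_mem_faceE hw.1⟩

theorem eventually_ptPsi_mem {U : Set (Amb n)} (hU : RelOpen U (bdry n)) {z : Phase n}
    (hz : z ∈ conePsi U) : ∀ᶠ w in 𝓝 z, nu2 (emb 1 0 w) ∈ U ∩ facePsi n := by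
  filter_upwards [(isOpen_conePsi hU).mem_nhds hz] with w hw
  rw [← ptPsi_eq]; exact ⟨hw.2, ptPsi_mem_facePsi hw.1⟩

theorem eventually_ptCorner_mem {U : Set (Amb n)} (hU : RelOpen U (bdry n)) {z : Phase n}
    (hz : z ∈ coneCorner U) : ∀ᶠ w in 𝓝 z, nu2 (emb 0 0 w) ∈ U ∩ corner n := by
  filter_upwards [(isOpen_coneCorner hU).mem_nhds hz] with w hw
  rw [← ptCorner_eq]; exact ⟨hw.2.2, ptCorner_mem_corner hw.1 hw.2.1⟩

section

variable {F : Type*} [NormedAddCommGroup F] [NormedSpace ℝ F]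

theorem contDiffOn_hext_int {Ω : Set (Amb n)} (hΩ : RelOpen Ω (dbl n)) {G : Amb n → F}
    (hG : SmoothOn G Ω) (l m : ℝ) :
    ContDiffOn ℝ ∞ (fun z => hext l m G (emb 1 1 z)) (intPart Ω) := fun _ hz =>
  (contDiffAt_hext_emb hG (mk_one_ne_zero _) (mk_one_ne_zero _)
    (eventually_ptInt_mem hΩ hz) l m).contDiffWithinAt

theorem contDiffOn_hext_E {U : Set (Amb n)} (hU : RelOpen U (bdry n)) {G : Amb n → F}
    (hG : SmoothOn G (U ∩ faceE n)) (l m : ℝ) :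
    ContDiffOn ℝ ∞ (fun z => hext l m G (emb 0 1 z)) (coneE U) := fun _ hz =>
  (contDiffAt_hext_emb hG (mk_zero_ne_zero hz.1) (mk_one_ne_zero _)
    (eventually_ptE_mem hU hz) l m).contDiffWithinAt

theorem contDiffOn_hext_Psi {U : Set (Amb n)} (hU : RelOpen U (bdry n)) {G : Amb n → F}
    (hG : SmoothOn G (U ∩ facePsi n)) (l m : ℝ) :
    ContDiffOn ℝ ∞ (fun z => hext l m G (emb 1 0 z)) (conePsi U) := fun _ hz =>
  (contDiffAt_hext_emb hG (mk_one_ne_zero _) (mk_zero_ne_zero hz.1)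
    (eventually_ptPsi_mem hU hz) l m).contDiffWithinAt

theorem contDiffOn_hext_corner {U : Set (Amb n)} (hU : RelOpen U (bdry n)) {G : Amb n → F}
    (hG : SmoothOn G (U ∩ corner n)) (l m : ℝ) :
    ContDiffOn ℝ ∞ (fun z => hext l m G (emb 0 0 z)) (coneCorner U) := fun _ hz =>
  (contDiffAt_hext_emb hG (mk_zero_ne_zero hz.1) (mk_zero_ne_zero hz.2.1)
    (eventually_ptCorner_mem hU hz) l m).contDiffWithinAt

end

/-! ### Symbol classes of sections -/

theorem SG_symbInt {Ω : Set (Amb n)} (hΩ : RelOpen Ω (dbl n)) {G : Amb n → ℝ}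
    (hG : SmoothOn G Ω) (l m : ℝ) : SG Ω l m (symbInt l m G) := by
  rw [symbInt_eq]
  refine ⟨contDiffOn_hext_int hΩ hG l m, fun K hK hKc j k => ?_⟩
  obtain ⟨c, hc⟩ := norm_mixedDeriv_hext_le hG hΩ.subset hKc hK l m 1 1 j k
  refine ⟨c, fun z hz => ?_⟩
  have := hc z (mk_one_ne_zero _) (mk_one_ne_zero _) (ptInt_eq z ▸ hz)
    (eventually_ptInt_mem hΩ (hK hz))
  simp only [jb_eq]
  exact this

theorem SymbolE_symbE {U : Set (Amb n)} (hU : RelOpen U (bdry n)) {G : Amb n → ℝ}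
    (hG : SmoothOn G (U ∩ faceE n)) (m : ℝ) : SymbolE U m (symbE 0 m G) := by
  refine ⟨symbE_eq (n := n) 0 m G ▸ contDiffOn_hext_E hU hG 0 m, fun z hz s hs => ?_,
    fun K hK hKc j k => ?_⟩
  · simp only [symbE, ptE, dir_eq, Real.rpow_zero]
    rw [show ((s • z.1, (0 : ℝ)) : Euc n × ℝ) = s • (z.1, (0 : ℝ)) by simp, nu_smul hs]
  · obtain ⟨c, hc⟩ := norm_mixedDeriv_hext_le hG
      (fun p hp => mem_dbl_of_faceE hp.2) hKc hK 0 m 0 1 j k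
    refine ⟨c, fun z hz1 hz => ?_⟩
    have hz0 : z.1 ≠ 0 := fun h => by simp [h] at hz1
    have := hc z (mk_zero_ne_zero hz0) (mk_one_ne_zero _) (ptE_eq z ▸ hz)
      (eventually_ptE_mem hU ⟨hz0, (hK hz).1⟩)
    simp only [emb, ← norm_eq_nrm, hz1, Real.one_rpow, one_mul] at this
    rw [symbE_eq, jb_eq]
    exact this

theorem SymbolPsi_symbPsi {U : Set (Amb n)} (hU : RelOpen U (bdry n)) {G : Amb n → ℝ}
    (hG : SmoothOn G (U ∩ facePsi n)) (m : ℝ) : SymbolPsi U m (symbPsi m 0 G) := by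
  refine ⟨symbPsi_eq (n := n) m 0 G ▸ contDiffOn_hext_Psi hU hG m 0, fun z hz s hs => ?_,
    fun K hK hKc j k => ?_⟩
  · simp only [symbPsi, ptPsi, dir_eq, Real.rpow_zero]
    rw [show ((s • z.2, (0 : ℝ)) : Euc n × ℝ) = s • (z.2, (0 : ℝ)) by simp, nu_smul hs]
  · obtain ⟨c, hc⟩ := norm_mixedDeriv_hext_le hG
      (fun p hp => mem_dbl_of_facePsi hp.2) hKc hK m 0 1 0 j k
    refine ⟨c, fun z hz1 hz => ?_⟩
    have hz0 : z.2 ≠ 0 := fun h => by simp [h] at hz1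
    have := hc z (mk_one_ne_zero _) (mk_zero_ne_zero hz0) (ptPsi_eq z ▸ hz)
      (eventually_ptPsi_mem hU ⟨hz0, (hK hz).1⟩)
    simp only [emb, ← norm_eq_nrm, hz1, Real.one_rpow, mul_one] at this
    rw [symbPsi_eq, jb_eq]
    exact this

theorem SymbolE.congr {U : Set (Amb n)} (hU : RelOpen U (bdry n)) {m : ℝ} {f g : Phase n → ℝ}
    (hf : SymbolE U m f) (h : EqOn g f (coneE U)) : SymbolE U m g := by
  refine ⟨hf.1.congr h, fun z hz s hs => ?_, fun K hK hKc j k => ?_⟩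
  · have hz' : (s • z.1, z.2) ∈ coneE U := by
      refine ⟨smul_ne_zero hs.ne' hz.1, ?_⟩
      have : ptE (s • z.1, z.2) = ptE z := by
        simp only [ptE, dir_eq]
        rw [show ((s • z.1, (0 : ℝ)) : Euc n × ℝ) = s • (z.1, (0 : ℝ)) by simp, nu_smul hs]
      rw [this]; exact hz.2
    rw [h hz, h hz', hf.2.1 z hz s hs]
  · obtain ⟨c, hc⟩ := hf.2.2 K hK hKc j k
    refine ⟨c, fun z hz1 hz => ?_⟩
    have hz0 : z.1 ≠ 0 := fun h => by simp [h] at hz1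
    rw [mixedDeriv_congr (h.eventuallyEq_of_mem ((isOpen_coneE hU).mem_nhds ⟨hz0, (hK hz).1⟩))]
    exact hc z hz1 hz

theorem SymbolPsi.congr {U : Set (Amb n)} (hU : RelOpen U (bdry n)) {m : ℝ} {f g : Phase n → ℝ}
    (hf : SymbolPsi U m f) (h : EqOn g f (conePsi U)) : SymbolPsi U m g := by
  refine ⟨hf.1.congr h, fun z hz s hs => ?_, fun K hK hKc j k => ?_⟩
  · have hz' : (z.1, s • z.2) ∈ conePsi U := by
      refine ⟨smul_ne_zero hs.ne' hz.1, ?_⟩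
      have : ptPsi (z.1, s • z.2) = ptPsi z := by
        simp only [ptPsi, dir_eq]
        rw [show ((s • z.2, (0 : ℝ)) : Euc n × ℝ) = s • (z.2, (0 : ℝ)) by simp, nu_smul hs]
      rw [this]; exact hz.2
    rw [h hz, h hz', hf.2.1 z hz s hs]
  · obtain ⟨c, hc⟩ := hf.2.2 K hK hKc j k
    refine ⟨c, fun z hz1 hz => ?_⟩
    have hz0 : z.2 ≠ 0 := fun h => by simp [h] at hz1
    rw [mixedDeriv_congr (h.eventuallyEq_of_mem ((isOpen_conePsi hU).mem_nhds ⟨hz0, (hK hz).1⟩))]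
    exact hc z hz1 hz

end

end ScGeom

namespace ScGeom

noncomputable section

variable {n : ℕ}

/-! ## Parametric integrals and cutoff functions -/

theorem hasFDerivAt_integral_zero_one {X F : Type} [NormedAddCommGroup X] [NormedSpace ℝ X]
    [FiniteDimensional ℝ X] [NormedAddCommGroup F] [NormedSpace ℝ F] [CompleteSpace F]
    {g : X × ℝ → F} (hg : ContDiff ℝ 1 g) (x : X) :
    HasFDerivAt (fun x => ∫ τ in (0 : ℝ)..1, g (x, τ))
      (∫ τ in (0 : ℝ)..1, (fderiv ℝ g (x, τ)).comp (.inl ℝ X ℝ)) x := by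
  have hcont : Continuous fun p : X × ℝ => (fderiv ℝ g p).comp (.inl ℝ X ℝ) :=
    (hg.continuous_fderiv one_ne_zero).clm_comp continuous_const
  obtain ⟨C, hC⟩ := ((isCompact_closedBall x 1).prod (isCompact_Icc (a := (0:ℝ)) (b := 1))).bddAbove_image
    hcont.norm.continuousOn
  have hsub : ∀ y, Continuous fun τ : ℝ => g (y, τ) := fun y =>
    hg.continuous.comp (Continuous.prodMk_right y)
  refine (intervalIntegral.hasFDerivAt_integral_of_dominated_of_fderiv_le
    (F := fun y τ => g (y, τ)) (F' := fun y τ => (fderiv ℝ g (y, τ)).comp (.inl ℝ X ℝ))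
    (bound := fun _ => C)
    (Metric.closedBall_mem_nhds x one_pos) (Eventually.of_forall fun y => ?_) ?_ ?_ ?_ ?_ ?_)
  · exact (hsub y).aestronglyMeasurable
  · exact (hsub x).intervalIntegrable _ _
  · exact (hcont.comp (Continuous.prodMk_right x)).aestronglyMeasurable
  · refine Eventually.of_forall fun τ hτ y hy => hC ⟨(y, τ), ⟨hy, ?_⟩, rfl⟩
    rw [uIoc_of_le zero_le_one] at hτ
    exact ⟨hτ.1.le, hτ.2⟩
  · exact intervalIntegrable_const
  · refine Eventually.of_forall fun τ _ y _ => ?_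
    have h1 : HasFDerivAt g (fderiv ℝ g (y, τ)) (y, τ) :=
      (hg.differentiable one_ne_zero _).hasFDerivAt
    have h2 : HasFDerivAt (fun y : X => (y, τ)) (.inl ℝ X ℝ) y := hasFDerivAt_prodMk_left y τ
    exact h1.comp y h2

theorem contDiff_integral_zero_one {X F : Type} [NormedAddCommGroup X] [NormedSpace ℝ X]
    [FiniteDimensional ℝ X] [NormedAddCommGroup F] [NormedSpace ℝ F] [CompleteSpace F]
    {g : X × ℝ → F} (hg : ContDiff ℝ ∞ g) :
    ContDiff ℝ ∞ fun x => ∫ τ in (0 : ℝ)..1, g (x, τ) := by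
  rw [contDiff_infty]
  intro N
  -- The derivative is an integral of the same kind with values in the linear maps into `F`, so the
  -- target space has to vary.
  induction N generalizing F with
  | zero =>
    refine contDiff_zero.2 ?_
    exact intervalIntegral.continuous_parametric_intervalIntegral_of_continuous'
      (f := fun x τ => g (x, τ)) hg.continuous 0 1
  | succ N ih =>
    have h1 : ContDiff ℝ ∞ fun p : X × ℝ => (fderiv ℝ g p).comp (.inl ℝ X ℝ) :=
      (hg.fderiv_right (m := ∞) le_rfl).clm_comp contDiff_const
    push_cast
    rw [contDiff_succ_iff_hasFDerivAt]
    exact ⟨_, ih h1, hasFDerivAt_integral_zero_one (hg.of_le (by exact_mod_cast le_top))⟩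

/-- Smooth cutoff on an open set `O`, equal to `1` near `M` and supported in `W`. -/
theorem exists_cutoff {E : Type*} [NormedAddCommGroup E] [NormedSpace ℝ E] [FiniteDimensional ℝ E]
    {O W M : Set E} (hW : IsOpen W) (hM : IsClosed M) (hMW : O ∩ M ⊆ W) :
    ∃ κ : E → ℝ, SmoothOn κ O ∧ (∀ p ∈ O ∩ M, ∀ᶠ q in 𝓝 p, κ q = 1) ∧
      ∀ p ∈ O, p ∈ W ∨ ∀ᶠ q in 𝓝 p, κ q = 0 := by
  obtain ⟨f, hfs, hf, hfr⟩ := hW.exists_contDiff_support_eq (n := ⊤)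
  obtain ⟨g, hgs, hg, hgr⟩ := hM.isOpen_compl.exists_contDiff_support_eq (n := ⊤)
  have hf0 : ∀ p, 0 ≤ f p := fun p => (hfr ⟨p, rfl⟩).1
  have hg0 : ∀ p, 0 ≤ g p := fun p => (hgr ⟨p, rfl⟩).1
  have hfW : ∀ p, p ∈ W ↔ f p ≠ 0 := fun p => by rw [← hfs, Function.mem_support]
  have hgM : ∀ p, p ∉ M ↔ g p ≠ 0 := fun p => by rw [← mem_compl_iff, ← hgs, Function.mem_support]
  have hpos : ∀ p ∈ O, f p + g p ≠ 0 := fun p hp h => by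
    have h1 : f p = 0 := by linarith [hf0 p, hg0 p]
    have h2 : g p = 0 := by linarith [hf0 p, hg0 p]
    by_cases hpM : p ∈ M
    · exact (hfW p).1 (hMW ⟨hp, hpM⟩) h1
    · exact (hgM p).1 hpM h2
  have hcd : ∀ p, f p + g p ≠ 0 → ContDiffAt ℝ ∞ (fun p => f p / (f p + g p)) p := fun p h =>
    hf.contDiffAt.div (hf.add hg).contDiffAt h
  -- The quotient `f / (f + g)` is `1` on `O ∩ M` and `0` off `W`. The rescaled transition is
  -- constant where the quotient is below `1/3` or above `2/3`, so both values are attained on whole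
  -- neighbourhoods.
  refine ⟨fun p => Real.smoothTransition (3 * (f p / (f p + g p)) - 1), ?_, ?_, ?_⟩
  · refine .of_contDiffOn (O := {p | f p + g p ≠ 0})
      (isOpen_ne.preimage (hf.continuous.add hg.continuous)) hpos fun p hp => ?_
    exact (Real.smoothTransition.contDiffAt.comp p
      ((contDiffAt_const.mul (hcd p hp)).sub contDiffAt_const)).contDiffWithinAt
  · rintro p ⟨hp, hpM⟩
    have h2 : g p = 0 := by by_contra h; exact (hgM p).2 h hpM
    have h1 : f p ≠ 0 := (hfW p).1 (hMW ⟨hp, hpM⟩)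
    have h3 : f p / (f p + g p) = 1 := by rw [h2, add_zero, div_self h1]
    have h4 := (hcd p (hpos p hp)).continuousAt.eventually (lt_mem_nhds (a := 2 / 3) (by
      simp only [h3]; norm_num))
    filter_upwards [h4] with q hq
    exact Real.smoothTransition.one_of_one_le (by linarith)
  · intro p hp
    by_cases hpW : p ∈ W
    · exact .inl hpW
    · right
      have h1 : f p = 0 := by by_contra h; exact hpW ((hfW p).2 h)
      have h3 : f p / (f p + g p) < 1 / 3 := by rw [h1, zero_div]; norm_num
      have h4 := (hcd p (hpos p hp)).continuousAt.tendsto.eventually_lt_const h3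
      filter_upwards [h4] with q hq
      exact Real.smoothTransition.zero_of_nonpos (by linarith)

/-! ## Projections to the faces -/

/-- The radial projection to the face over spatial infinity. -/
def prE (p : Amb n) : Amb n := (nu (p.1.1, 0), p.2)

/-- The radial projection to the face at fibre infinity. -/
def prPsi (p : Amb n) : Amb n := (p.1, nu (p.2.1, 0))

theorem fst_ne_zero_of_hemi {X : Euc n × ℝ} (h : X ∈ hemi n) (h0 : X.2 = 0) : X.1 ≠ 0 := fun h' => by
  have := nrm_fst_of_zero h h0
  rw [h', norm_zero] at this
  exact zero_ne_one this

theorem nu_fst_zero {X : Euc n × ℝ} (h : X ∈ hemi n) (h0 : X.2 = 0) : nu (X.1, 0) = X := by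
  rw [← dir_eq, dir_fst h h0]

theorem prE_of_faceE {p : Amb n} (h : p ∈ faceE n) : prE p = p :=
  Prod.ext (nu_fst_zero h.1.1 h.2) rfl

theorem prPsi_of_facePsi {p : Amb n} (h : p ∈ facePsi n) : prPsi p = p :=
  Prod.ext rfl (nu_fst_zero h.1.2 h.2)

theorem prE_mem_faceE {p : Amb n} (h : p ∈ dbl n) (h' : p.1.1 ≠ 0) : prE p ∈ faceE n :=
  ⟨⟨nu_mem_hemi (mk_zero_ne_zero h') le_rfl, h.2⟩, by simp [prE, nu]⟩

theorem prPsi_mem_facePsi {p : Amb n} (h : p ∈ dbl n) (h' : p.2.1 ≠ 0) : prPsi p ∈ facePsi n :=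
  ⟨⟨h.1, nu_mem_hemi (mk_zero_ne_zero h') le_rfl⟩, by simp [prPsi, nu]⟩

theorem contDiffAt_prE {p : Amb n} (h : p.1.1 ≠ 0) : ContDiffAt ℝ ∞ prE p := by
  refine ContDiffAt.prodMk ?_ contDiffAt_snd
  exact ContDiffAt.comp (g := nu) p (contDiffAt_nu (mk_zero_ne_zero h))
    (contDiff_fst.fst.prodMk contDiff_const).contDiffAt

theorem contDiffAt_prPsi {p : Amb n} (h : p.2.1 ≠ 0) : ContDiffAt ℝ ∞ prPsi p := by
  refine ContDiffAt.prodMk contDiffAt_fst ?_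
  exact ContDiffAt.comp (g := nu) p (contDiffAt_nu (mk_zero_ne_zero h))
    (contDiff_snd.fst.prodMk contDiff_const).contDiffAt

theorem isOpen_fst_ne : IsOpen {p : Amb n | p.1.1 ≠ 0} :=
  isOpen_ne.preimage (continuous_fst.comp continuous_fst)

theorem smoothOn_prE {S : Set (Amb n)} (h : ∀ p ∈ S, p.1.1 ≠ 0) : SmoothOn prE S :=
  .of_contDiffOn isOpen_fst_ne h fun _ hp => (contDiffAt_prE hp).contDiffWithinAt

/-! ## Density of the complement of a face -/

/-- Raising the last coordinate by `ε` and renormalising pushes any point off the boundary. -/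
theorem exists_path_hemi {X : Euc n × ℝ} (hX : X ∈ hemi n) :
    ∃ γ : ℝ → Euc n × ℝ, Tendsto γ (𝓝[>] 0) (𝓝 X) ∧ ∀ ε, 0 < ε → γ ε ∈ hemi n ∧ 0 < (γ ε).2 := by
  have hne : ∀ ε : ℝ, 0 < ε → 0 < (X + (0, ε)).2 := fun ε hε => by
    have := hX.2; simp only [Prod.snd_add]; linarith
  refine ⟨fun ε => nu (X + (0, ε)), ?_, fun ε hε => ⟨nu_mem_hemi (fun h => ?_) (hne ε hε).le,
    nu_snd_pos (hne ε hε)⟩⟩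
  · have h1 : ContinuousAt (fun ε : ℝ => nu (X + (0, ε))) 0 := by
      refine ContinuousAt.comp (g := nu) (f := fun ε : ℝ => X + (0, ε)) ?_ (by fun_prop)
      exact (contDiffAt_nu (by rw [Prod.mk_zero_zero, add_zero]; exact ne_zero_of_hemi hX)).continuousAt
    have h2 := h1.tendsto
    simp only [Prod.mk_zero_zero, add_zero, nu_of_hemi hX] at h2
    exact h2.mono_left nhdsWithin_le_nhds
  · have := hne ε hε; rw [h] at this; exact lt_irrefl _ this

theorem frequently_pos_fst {p : Amb n} (hp : p ∈ dbl n) :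
    ∃ᶠ q in 𝓝 p, q ∈ dbl n ∧ 0 < q.1.2 ∧ q.2 = p.2 := by
  obtain ⟨γ, hγ, h⟩ := exists_path_hemi hp.1
  have h1 : Tendsto (fun ε => (γ ε, p.2)) (𝓝[>] 0) (𝓝 p) := hγ.prodMk_nhds tendsto_const_nhds
  refine h1.frequently (Eventually.frequently ?_)
  filter_upwards [self_mem_nhdsWithin] with ε hε
  exact ⟨⟨(h ε hε).1, hp.2⟩, (h ε hε).2, rfl⟩

theorem frequently_pos_snd {p : Amb n} (hp : p ∈ dbl n) :
    ∃ᶠ q in 𝓝 p, q ∈ dbl n ∧ 0 < q.2.2 ∧ q.1 = p.1 := by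
  obtain ⟨γ, hγ, h⟩ := exists_path_hemi hp.2
  have h1 : Tendsto (fun ε => (p.1, γ ε)) (𝓝[>] 0) (𝓝 p) := tendsto_const_nhds.prodMk_nhds hγ
  refine h1.frequently (Eventually.frequently ?_)
  filter_upwards [self_mem_nhdsWithin] with ε hε
  exact ⟨⟨hp.1, (h ε hε).1⟩, (h ε hε).2, rfl⟩

/-- In a Hausdorff space the set where two continuous maps differ is open. This carries identities
from an open face to the corner, or from positive heights to the boundary. -/
theorem eq_of_frequently_eq {X Y : Type*} [TopologicalSpace X] [TopologicalSpace Y] [T2Space Y]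
    {f g : X → Y} {S : Set X} {p : X} (hf : ContinuousWithinAt f S p)
    (hg : ContinuousWithinAt g S p) (h : ∃ᶠ q in 𝓝 p, q ∈ S ∧ f q = g q) : f p = g p := by
  by_contra hne
  have h1 : ∀ᶠ q in 𝓝[S] p, f q ≠ g q :=
    (hf.tendsto.prodMk_nhds hg.tendsto).eventually (isClosed_diagonal.isOpen_compl.mem_nhds hne)
  refine h ?_
  filter_upwards [eventually_nhdsWithin_iff.1 h1] with q hq h' using hq h'.1 h'.2

end

end ScGeom

namespace ScGeom

noncomputable section

variable {n : ℕ}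

/-! ## Division by a boundary defining function -/

theorem fst_ne_zero_of_faceE {p : Amb n} (h : p ∈ faceE n) : p.1.1 ≠ 0 :=
  fst_ne_zero_of_hemi h.1.1 h.2

theorem continuousAt_prE {p : Amb n} (h : p ∈ faceE n) : ContinuousAt prE p :=
  (contDiffAt_prE (fst_ne_zero_of_faceE h)).continuousAt

theorem tendsto_prE {p : Amb n} (h : p ∈ faceE n) : Tendsto prE (𝓝 p) (𝓝 p) := by
  have := (continuousAt_prE h).tendsto
  rwa [prE_of_faceE h] at this

theorem tendsto_prPsi {p : Amb n} (h : p ∈ facePsi n) : Tendsto prPsi (𝓝 p) (𝓝 p) := by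
  have := (contDiffAt_prPsi (fst_ne_zero_of_hemi h.1.2 h.2)).continuousAt.tendsto
  rwa [prPsi_of_facePsi h] at this

theorem eventually_fst_ne_zero {p : Amb n} (h : p ∈ faceE n) : ∀ᶠ q : Amb n in 𝓝 p, q.1.1 ≠ 0 :=
  isOpen_fst_ne.mem_nhds (fst_ne_zero_of_faceE h)

theorem eventually_snd_ne_zero {p : Amb n} (h : p ∈ facePsi n) : ∀ᶠ q : Amb n in 𝓝 p, q.2.1 ≠ 0 :=
  (isOpen_ne.preimage (continuous_fst.comp continuous_snd)).mem_nhds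
    (fst_ne_zero_of_hemi h.1.2 h.2)

theorem eventually_prE_mem {Ω : Set (Amb n)} (hΩ : RelOpen Ω (dbl n)) {p : Amb n}
    (hp : p ∈ Ω ∩ faceE n) : ∀ᶠ q in 𝓝 p, q ∈ Ω → prE q ∈ Ω ∩ faceE n := by
  filter_upwards [(tendsto_prE hp.2).eventually (hΩ.eventually hp.1), eventually_fst_ne_zero hp.2]
    with q h1 h2 hq
  have h3 := prE_mem_faceE (hΩ.subset hq) h2
  exact ⟨h1 h3.1, h3⟩

theorem eventually_prPsi_mem {Ω : Set (Amb n)} (hΩ : RelOpen Ω (dbl n)) {p : Amb n}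
    (hp : p ∈ Ω ∩ facePsi n) : ∀ᶠ q in 𝓝 p, q ∈ Ω → prPsi q ∈ Ω ∩ facePsi n := by
  filter_upwards [(tendsto_prPsi hp.2).eventually (hΩ.eventually hp.1), eventually_snd_ne_zero hp.2]
    with q h1 h2 hq
  have h3 := prPsi_mem_facePsi (hΩ.subset hq) h2
  exact ⟨h1 h3.1, h3⟩

/-- Hadamard's lemma: the quotient is the integral of the derivative in the height along the segment
down to height zero. -/
theorem exists_div_fst_near {Ω : Set (Amb n)} (hΩ : RelOpen Ω (dbl n)) {G : Amb n → ℝ}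
    (hG : SmoothOn G Ω) (h0 : ∀ p ∈ Ω ∩ faceE n, G p = 0) {p₀ : Amb n} (hp₀ : p₀ ∈ Ω ∩ faceE n) :
    ∃ H : Amb n → ℝ, ContDiff ℝ ∞ H ∧ ∀ᶠ p in 𝓝 p₀, p ∈ Ω → G p = p.1.2 * H p := by
  obtain ⟨F, hF, he⟩ := hG.exists_contDiff hp₀.1
  have hX : IsOpen {p : Amb n | p.1 ≠ 0} := isOpen_ne.preimage continuous_fst
  -- The segment in the height variable leaves the sphere, hence the precomposition with `nu`. At
  -- its lower end the function becomes `F` at `prE p`, which is a value of `G` on the face and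
  -- vanishes.
  obtain ⟨φ, hφ, hφF⟩ := exists_contDiff_eventuallyEq hX (F := fun p : Amb n => F (nu p.1, p.2))
    (fun p hp => (hF.contDiffAt.comp (g := F) p (((contDiffAt_nu hp).comp p contDiffAt_fst).prodMk
      contDiffAt_snd)).contDiffWithinAt) (ne_zero_of_hemi (hΩ.subset hp₀.1).1)
  set e : Amb n := ((0, 1), 0)
  set g : Amb n × ℝ → ℝ := fun x => fderiv ℝ φ ((x.1.1.1, x.2 * x.1.1.2), x.1.2) e
  have hg : ContDiff ℝ ∞ g := by
    have h1 : ContDiff ℝ ∞ (fderiv ℝ φ) := hφ.fderiv_right le_rfl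
    exact (h1.comp (by fun_prop)).clm_apply contDiff_const
  refine ⟨fun p => ∫ τ in (0 : ℝ)..1, g (p, τ), contDiff_integral_zero_one hg, ?_⟩
  have hint : ∀ p : Amb n, φ p - φ ((p.1.1, 0), p.2) = p.1.2 * ∫ τ in (0 : ℝ)..1, g (p, τ) := by
    intro p
    have hd : ∀ τ : ℝ, HasDerivAt (fun τ : ℝ => φ ((p.1.1, τ * p.1.2), p.2)) (p.1.2 * g (p, τ)) τ := by
      intro τ
      have h1 : HasDerivAt (fun τ : ℝ => (((p.1.1, τ * p.1.2), p.2) : Amb n)) (p.1.2 • e) τ := by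
        have h2 : HasDerivAt (fun τ : ℝ => τ * p.1.2) p.1.2 τ := by
          simpa using (hasDerivAt_id τ).mul_const p.1.2
        have := ((hasDerivAt_const τ p.1.1).prodMk h2).prodMk (hasDerivAt_const τ p.2)
        simpa [e] using this
      have h3 := (hφ.differentiable (by simp) ((p.1.1, τ * p.1.2), p.2)).hasFDerivAt.comp_hasDerivAt
        τ h1
      exact h3.congr_deriv (by simp [g])
    have hc : Continuous fun τ : ℝ => p.1.2 * g (p, τ) :=
      continuous_const.mul (hg.continuous.comp (Continuous.prodMk_right p))
    have := intervalIntegral.integral_eq_sub_of_hasDerivAt (a := 0) (b := 1)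
      (fun τ _ => hd τ) (hc.intervalIntegrable _ _)
    rw [intervalIntegral.integral_const_mul] at this
    simpa using this.symm
  have ht : Tendsto (fun p : Amb n => (((p.1.1, 0), p.2) : Amb n)) (𝓝 p₀) (𝓝 p₀) := by
    refine Continuous.tendsto' (by fun_prop) _ _ ?_
    exact Prod.ext (Prod.ext rfl hp₀.2.2.symm) rfl
  filter_upwards [he, hφF, ht.eventually hφF, (tendsto_prE hp₀.2).eventually he,
    eventually_prE_mem hΩ hp₀] with p h1 h2 h3 h4 h5 hp
  rw [← hint p, h2, h3, h1 hp]
  have h6 := h4 (h5 hp).1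
  rw [h0 _ (h5 hp)] at h6
  have h7 : F ((nu (p.1.1, 0)), p.2) = 0 := h6.symm
  rw [nu_of_hemi (hΩ.subset hp).1]
  simp only [h7, sub_zero]

/-- A smooth function which vanishes on a face is divisible by the boundary defining function. -/
theorem exists_div_fst {Ω : Set (Amb n)} (hΩ : RelOpen Ω (dbl n)) {G : Amb n → ℝ}
    (hG : SmoothOn G Ω) (h0 : ∀ p ∈ Ω ∩ faceE n, G p = 0) :
    ∃ G' : Amb n → ℝ, SmoothOn G' Ω ∧ ∀ p, p.1.2 ≠ 0 → G p = p.1.2 * G' p := by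
  classical
  choose H hH hGH using fun p : ↥(Ω ∩ faceE n) => exists_div_fst_near hΩ hG h0 p.2
  refine ⟨fun p => if h : p ∈ Ω ∩ faceE n then H ⟨p, h⟩ p else G p / p.1.2, ?_, fun p hp => ?_⟩
  swap
  · have : p ∉ Ω ∩ faceE n := fun h => hp h.2.2
    simp only [this, dif_neg, not_false_eq_true]
    field_simp
  refine .of_eventually fun p hp => ?_
  by_cases hpE : p ∈ Ω ∩ faceE n
  · refine ⟨H ⟨p, hpE⟩, univ, isOpen_univ, mem_univ _, (hH _).contDiffOn, ?_⟩
    filter_upwards [eventually_eventually_nhds.2 (hGH ⟨p, hpE⟩)] with q hq hqΩ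
    by_cases hqE : q ∈ Ω ∩ faceE n
    · simp only [hqE, dif_pos]
      -- The local quotients chosen at `p` and at the face point `q` agree where the height is
      -- positive, since there the quotient is unique; by density they agree at `q`.
      refine eq_of_frequently_eq (S := Ω) (hH _).continuous.continuousWithinAt
        (hH _).continuous.continuousWithinAt ?_
      refine ((frequently_pos_fst (hΩ.subset hqΩ)).and_eventually
        ((hΩ.eventually hqΩ).and (hq.and (hGH ⟨q, hqE⟩)))).mono ?_
      rintro r ⟨⟨hr1, hr2, -⟩, h1, h2, h3⟩
      refine ⟨h1 hr1, mul_left_cancel₀ hr2.ne' ?_⟩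
      rw [← h2 (h1 hr1), ← h3 (h1 hr1)]
    · simp only [hqE, dif_neg, not_false_eq_true]
      have hq0 : q.1.2 ≠ 0 := fun h => hqE ⟨hqΩ, hΩ.subset hqΩ, h⟩
      rw [hq.self_of_nhds hqΩ]
      field_simp
  · have hp0 : p.1.2 ≠ 0 := fun h => hpE ⟨hp, hΩ.subset hp, h⟩
    obtain ⟨F, hF, he⟩ := hG.exists_contDiff hp
    have hO : IsOpen {q : Amb n | q.1.2 ≠ 0} := isOpen_ne.preimage (by fun_prop)
    refine ⟨fun q => F q / q.1.2, {q | q.1.2 ≠ 0}, hO, hp0,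
      hF.contDiffOn.div (contDiff_fst.snd.contDiffOn) (fun q hq => hq), ?_⟩
    filter_upwards [he, hO.mem_nhds hp0] with q h1 h2 hq
    have : q ∉ Ω ∩ faceE n := fun h => h2 h.2.2
    simp only [this, dif_neg, not_false_eq_true]
    rw [h1 hq]

/-! ## Leading terms -/

/-- The leading term at the face over spatial infinity, cut off by `κ`. -/
def leadE (κ : Amb n → ℝ) (l : ℝ) (G : Amb n → ℝ) (p : Amb n) : ℝ :=
  κ p * (‖p.1.1‖ ^ l * G (prE p))

/-- The leading term at fibre infinity, cut off by `κ`. -/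
def leadPsi (κ : Amb n → ℝ) (m : ℝ) (G : Amb n → ℝ) (p : Amb n) : ℝ :=
  κ p * (‖p.2.1‖ ^ m * G (prPsi p))

/-- `κ` is a smooth cutoff near the face over spatial infinity in `Ω`. -/
structure IsCutE (Ω : Set (Amb n)) (κ : Amb n → ℝ) : Prop where
  smooth : SmoothOn κ Ω
  one : ∀ p ∈ Ω ∩ faceE n, ∀ᶠ q in 𝓝 p, κ q = 1
  zero : ∀ p ∈ Ω, (p.1.1 ≠ 0 ∧ prE p ∈ Ω) ∨ ∀ᶠ q in 𝓝 p, κ q = 0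

/-- `κ` is a smooth cutoff near the face at fibre infinity in `Ω`. -/
structure IsCutPsi (Ω : Set (Amb n)) (κ : Amb n → ℝ) : Prop where
  smooth : SmoothOn κ Ω
  one : ∀ p ∈ Ω ∩ facePsi n, ∀ᶠ q in 𝓝 p, κ q = 1
  zero : ∀ p ∈ Ω, (p.2.1 ≠ 0 ∧ prPsi p ∈ Ω) ∨ ∀ᶠ q in 𝓝 p, κ q = 0

theorem exists_isCutE {Ω : Set (Amb n)} (hΩ : RelOpen Ω (dbl n)) : ∃ κ, IsCutE Ω κ := by
  obtain ⟨O, hO, rfl⟩ := id hΩ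
  have hc : ContinuousOn (prE : Amb n → Amb n) {p | p.1.1 ≠ 0} := fun p hp =>
    (contDiffAt_prE hp).continuousAt.continuousWithinAt
  have hW : IsOpen ({p : Amb n | p.1.1 ≠ 0} ∩ prE ⁻¹' O) := hc.isOpen_inter_preimage isOpen_fst_ne hO
  obtain ⟨κ, h1, h2, h3⟩ := exists_cutoff (O := O) hW (isClosed_faceE (n := n)) (by
    rintro p ⟨hp, hpE⟩
    exact ⟨fst_ne_zero_of_faceE hpE, by rw [mem_preimage, prE_of_faceE hpE]; exact hp⟩)
  refine ⟨κ, h1.mono inter_subset_left, fun p hp => h2 p ⟨hp.1.1, hp.2⟩, fun p hp => ?_⟩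
  exact (h3 p hp.1).imp_left fun h => ⟨h.1, h.2, (prE_mem_faceE hp.2 h.1).1⟩

theorem SmoothOn.of_local {X Y : Type*} [NormedAddCommGroup X] [NormedSpace ℝ X]
    [NormedAddCommGroup Y] [NormedSpace ℝ Y] {f : X → Y} {S : Set X}
    (h : ∀ p ∈ S, ∃ T, SmoothOn f T ∧ p ∈ T ∧ ∀ᶠ q in 𝓝 p, q ∈ S → q ∈ T) : SmoothOn f S := by
  refine .of_eventually fun p hp => ?_
  obtain ⟨T, hT, hpT, he⟩ := h p hp
  obtain ⟨O, F, hO, hpO, hF, hE⟩ := hT p hpT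
  refine ⟨F, O, hO, hpO, hF, ?_⟩
  filter_upwards [he, hO.mem_nhds hpO] with q h1 h2 hq using hE ⟨h1 hq, h2⟩

theorem smoothOn_norm_rpow (l : ℝ) {S : Set (Amb n)} (h : ∀ p ∈ S, p.1.1 ≠ 0) :
    SmoothOn (fun p : Amb n => ‖p.1.1‖ ^ l) S :=
  .of_contDiffOn isOpen_fst_ne h fun _ hp =>
    ((contDiffAt_fst.fst.norm ℝ hp).rpow_const_of_ne (norm_ne_zero_iff.2 hp)).contDiffWithinAt

/-- Near a point whose projection to the face lies in `Ω`, the factor `G ∘ prE` is smooth. Near any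
other point it is uncontrolled, but there the cutoff vanishes identically. -/
theorem smoothOn_leadE {Ω : Set (Amb n)} (hΩ : RelOpen Ω (dbl n)) {κ : Amb n → ℝ}
    (hκ : IsCutE Ω κ) {G : Amb n → ℝ} (hG : SmoothOn G Ω) (l : ℝ) :
    SmoothOn (leadE κ l G) Ω := by
  have hT : SmoothOn (leadE κ l G) {p | p ∈ Ω ∧ p.1.1 ≠ 0 ∧ prE p ∈ Ω} :=
    (hκ.smooth.mono fun p hp => hp.1).mul ((smoothOn_norm_rpow l fun p hp => hp.2.1).mul
      (hG.comp (smoothOn_prE fun p hp => hp.2.1) fun p hp => hp.2.2))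
  refine .of_local fun p hp => ?_
  rcases hκ.zero p hp with h | h
  · refine ⟨_, hT, ⟨hp, h⟩, ?_⟩
    have hc := (contDiffAt_prE h.1).continuousAt
    filter_upwards [isOpen_fst_ne.mem_nhds h.1, hc.eventually (hΩ.eventually h.2)] with q h1 h2 hq
    exact ⟨hq, h1, h2 (prE_mem_faceE (hΩ.subset hq) h1).1⟩
  · refine ⟨{q | ∀ᶠ r in 𝓝 q, κ r = 0}, ?_, h, ?_⟩
    · refine .of_contDiffOn isOpen_setOfPred_eventually_nhds subset_rfl fun q hq => ?_
      refine (contDiffAt_const (c := (0 : ℝ))).congr_of_eventuallyEq ?_ |>.contDiffWithinAt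
      filter_upwards [hq] with r hr
      simp [leadE, hr]
    · filter_upwards [eventually_eventually_nhds.2 h] with q hq _ using hq

theorem leadE_of_faceE {Ω : Set (Amb n)} {κ : Amb n → ℝ} (hκ : IsCutE Ω κ) (G : Amb n → ℝ)
    (l : ℝ) {p : Amb n} (hp : p ∈ Ω ∩ faceE n) : leadE κ l G p = G p := by
  rw [leadE, (hκ.one p hp).self_of_nhds, prE_of_faceE hp.2, nrm_fst_of_zero hp.2.1.1 hp.2.2]
  simp

/-- Successive leading terms and remainders at the face over spatial infinity. -/
theorem exists_expansion_fst {Ω : Set (Amb n)} (hΩ : RelOpen Ω (dbl n)) {κ : Amb n → ℝ}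
    (hκ : IsCutE Ω κ) {G : Amb n → ℝ} (hG : SmoothOn G Ω) (l : ℝ) :
    ∃ Gs : ℕ → Amb n → ℝ, Gs 0 = G ∧ (∀ k, SmoothOn (Gs k) Ω) ∧
      ∀ (k : ℕ) (p : Amb n), p.1.2 ≠ 0 →
        Gs k p - leadE κ (l - k) (Gs k) p = p.1.2 * Gs (k + 1) p := by
  -- Dividing by the height, which is `1/⟨x⟩` on the interior, lowers the order by one, so the
  -- leading term at stage `k` is taken with degree `l - k`. Smoothness is carried along in a
  -- subtype so that the division can be iterated.
  have step : ∀ (k : ℕ) (G : {G : Amb n → ℝ // SmoothOn G Ω}), ∃ G' : {G : Amb n → ℝ // SmoothOn G Ω},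
      ∀ p : Amb n, p.1.2 ≠ 0 → G.1 p - leadE κ (l - k) G.1 p = p.1.2 * G'.1 p := fun k G => by
    obtain ⟨G', h1, h2⟩ := exists_div_fst hΩ (G.2.sub (smoothOn_leadE hΩ hκ G.2 (l - k)))
      fun p hp => by simp only [leadE_of_faceE hκ _ _ hp, sub_self]
    exact ⟨⟨G', h1⟩, h2⟩
  choose next hnext using step
  let Gs : ℕ → {G : Amb n → ℝ // SmoothOn G Ω} := fun k => Nat.rec ⟨G, hG⟩ (fun k G => next k G) k
  exact ⟨fun k => (Gs k).1, rfl, fun k => (Gs k).2, fun k p hp => hnext k (Gs k) p hp⟩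

/-- Homogeneity at fibre infinity near the corner. -/
def HomPsiNear (Ω : Set (Amb n)) (m : ℝ) (G : Amb n → ℝ) : Prop :=
  ∀ p ∈ Ω ∩ corner n, ∀ᶠ q in 𝓝 p, q ∈ Ω → G q = ‖q.2.1‖ ^ m * G (prPsi q)

/-- Homogeneity at spatial infinity near the corner. -/
def HomENear (Ω : Set (Amb n)) (l : ℝ) (G : Amb n → ℝ) : Prop :=
  ∀ p ∈ Ω ∩ corner n, ∀ᶠ q in 𝓝 p, q ∈ Ω → G q = ‖q.1.1‖ ^ l * G (prE q)

/-- The projections `prE` and `prPsi` act on different factors and commute, so taking the leading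
term at one face keeps homogeneity at the other and yields the bihomogeneous formula near the
corner. -/
theorem HomPsiNear.leadE {Ω : Set (Amb n)} (hΩ : RelOpen Ω (dbl n)) {κ : Amb n → ℝ}
    (hκ : IsCutE Ω κ) {G : Amb n → ℝ} {m : ℝ} (h : HomPsiNear Ω m G) (l : ℝ) :
    ∀ p ∈ Ω ∩ corner n, ∀ᶠ q in 𝓝 p, q ∈ Ω →
      leadE κ l G q = ‖q.1.1‖ ^ l * ‖q.2.1‖ ^ m * G (prE (prPsi q)) ∧
      leadE κ l G q = ‖q.2.1‖ ^ m * leadE κ l G (prPsi q) := by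
  intro p hp
  filter_upwards [hκ.one p ⟨hp.1, hp.2.1⟩, (tendsto_prPsi hp.2.2).eventually (hκ.one p ⟨hp.1, hp.2.1⟩),
    (tendsto_prE hp.2.1).eventually (h p hp), eventually_prE_mem hΩ ⟨hp.1, hp.2.1⟩]
    with q h1 h2 h3 h4 hq
  have h5 : G (prE q) = ‖q.2.1‖ ^ m * G (prE (prPsi q)) := h3 (h4 hq).1
  simp only [ScGeom.leadE, h1, h2, h5]
  have h6 : (prPsi q).1 = q.1 := rfl
  rw [h6]
  constructor <;> ring

/-- The projection `prPsi` does not change the first height, so a homogeneous identity can be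
divided by that height where it is positive. Continuity extends the result to the face. -/
theorem HomPsiNear.div {Ω : Set (Amb n)} (hΩ : RelOpen Ω (dbl n)) {κ : Amb n → ℝ}
    (hκ : IsCutE Ω κ) {G G' : Amb n → ℝ} {m : ℝ} (h : HomPsiNear Ω m G) (l : ℝ)
    (hG' : SmoothOn G' Ω) (hd : ∀ p : Amb n, p.1.2 ≠ 0 → G p - ScGeom.leadE κ l G p = p.1.2 * G' p) :
    HomPsiNear Ω m G' := by
  intro p hp
  have hpos : ∀ᶠ q in 𝓝 p, q ∈ Ω → q.1.2 ≠ 0 → G' q = ‖q.2.1‖ ^ m * G' (prPsi q) := by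
    filter_upwards [h p hp, h.leadE hΩ hκ l p hp] with q h1 h2 hq h0
    have h3 : (prPsi q).1 = q.1 := rfl
    have h4 := hd q h0
    rw [h1 hq, (h2 hq).2, ← mul_sub, hd (prPsi q) (h3 ▸ h0), h3] at h4
    refine mul_left_cancel₀ h0 ?_
    rw [← h4]; ring
  filter_upwards [eventually_eventually_nhds.2 hpos, eventually_snd_ne_zero hp.2.2,
    eventually_prPsi_mem hΩ ⟨hp.1, hp.2.2⟩] with q hq h2 h3 hqΩ
  have hc : ContinuousWithinAt (fun q : Amb n => ‖q.2.1‖ ^ m * G' (prPsi q)) Ω q := by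
    have h4 : ContinuousWithinAt (fun q : Amb n => ‖q.2.1‖ ^ m) Ω q :=
      ((by fun_prop : ContinuousAt (fun q : Amb n => ‖q.2.1‖) q).rpow_const
        (.inl (norm_ne_zero_iff.2 h2))).continuousWithinAt
    refine h4.mul ?_
    have h5 := (hG'.continuousOn _ (h3 hqΩ).1)
    have h6 : Tendsto prPsi (𝓝[Ω] q) (𝓝[Ω] (prPsi q)) := by
      have h7 := (contDiffAt_prPsi h2).continuousAt
      refine tendsto_nhdsWithin_iff.2 ⟨h7.continuousWithinAt, ?_⟩
      refine eventually_nhdsWithin_iff.2 ?_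
      filter_upwards [h7.eventually (hΩ.eventually (h3 hqΩ).1),
        (isOpen_ne.preimage (continuous_fst.comp continuous_snd)).mem_nhds h2] with r hr hr2 hrΩ
      exact hr (prPsi_mem_facePsi (hΩ.subset hrΩ) hr2).1
    exact h5.tendsto.comp h6
  refine eq_of_frequently_eq (hG'.continuousOn q hqΩ) hc ?_
  refine ((frequently_pos_fst (hΩ.subset hqΩ)).and_eventually
    ((hΩ.eventually hqΩ).and hq)).mono ?_
  rintro r ⟨⟨hr1, hr2, -⟩, h1, h2⟩
  exact ⟨h1 hr1, h2 (h1 hr1) hr2.ne'⟩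

theorem HomPsiNear.expansion {Ω : Set (Amb n)} (hΩ : RelOpen Ω (dbl n)) {κ : Amb n → ℝ}
    (hκ : IsCutE Ω κ) {m l : ℝ} {Gs : ℕ → Amb n → ℝ} (h : HomPsiNear Ω m (Gs 0))
    (hs : ∀ k, SmoothOn (Gs k) Ω) (hd : ∀ (k : ℕ) (p : Amb n), p.1.2 ≠ 0 →
        Gs k p - ScGeom.leadE κ (l - k) (Gs k) p = p.1.2 * Gs (k + 1) p) (k : ℕ) :
    HomPsiNear Ω m (Gs k) := by
  induction k with
  | zero => exact h
  | succ k ih => exact ih.div hΩ hκ _ (hs _) (hd k)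

end

end ScGeom

namespace ScGeom

noncomputable section

variable {n : ℕ}

/-! ## Exchanging the two factors -/

/-- Exchanging the factors exchanges the two faces. The results at fibre infinity on cutoffs,
leading terms and expansions are the ones at spatial infinity transported by this symmetry. -/
theorem swap_mem_dbl {p : Amb n} : p.swap ∈ dbl n ↔ p ∈ dbl n := and_comm

theorem swap_mem_faceE {p : Amb n} : p.swap ∈ faceE n ↔ p ∈ facePsi n :=
  and_congr_left' swap_mem_dbl

theorem swap_mem_facePsi {p : Amb n} : p.swap ∈ facePsi n ↔ p ∈ faceE n :=
  and_congr_left' swap_mem_dbl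

theorem swap_mem_corner {p : Amb n} : p.swap ∈ corner n ↔ p ∈ corner n :=
  (and_congr swap_mem_faceE swap_mem_facePsi).trans and_comm

theorem tendsto_swap (p : Amb n) : Tendsto Prod.swap (𝓝 p) (𝓝 p.swap) :=
  continuous_swap.tendsto p

theorem RelOpen.swap {Ω : Set (Amb n)} (h : RelOpen Ω (dbl n)) :
    RelOpen (Prod.swap ⁻¹' Ω) (dbl n) := by
  obtain ⟨O, hO, rfl⟩ := h
  refine ⟨Prod.swap ⁻¹' O, hO.preimage continuous_swap, ?_⟩
  ext p
  exact and_congr_right' swap_mem_dbl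

theorem SmoothOn.swap {F : Type*} [NormedAddCommGroup F] [NormedSpace ℝ F] {Ω : Set (Amb n)}
    {G : Amb n → F} (h : SmoothOn G Ω) : SmoothOn (G ∘ Prod.swap) (Prod.swap ⁻¹' Ω) :=
  h.comp (.of_contDiff (contDiff_snd.prodMk contDiff_fst)) fun _ hp => hp

theorem IsCutPsi.swap {Ω : Set (Amb n)} {κ : Amb n → ℝ} (h : IsCutPsi Ω κ) :
    IsCutE (Prod.swap ⁻¹' Ω) (κ ∘ Prod.swap) where
  smooth := h.smooth.swap
  one p hp := (tendsto_swap p).eventually (h.one _ ⟨hp.1, swap_mem_facePsi.2 hp.2⟩)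
  zero p hp := (h.zero _ hp).imp id fun h => (tendsto_swap p).eventually h

theorem IsCutE.swap {Ω : Set (Amb n)} {κ : Amb n → ℝ} (h : IsCutE Ω κ) :
    IsCutPsi (Prod.swap ⁻¹' Ω) (κ ∘ Prod.swap) where
  smooth := h.smooth.swap
  one p hp := (tendsto_swap p).eventually (h.one _ ⟨hp.1, swap_mem_faceE.2 hp.2⟩)
  zero p hp := (h.zero _ hp).imp id fun h => (tendsto_swap p).eventually h

theorem exists_isCutPsi {Ω : Set (Amb n)} (hΩ : RelOpen Ω (dbl n)) : ∃ κ, IsCutPsi Ω κ := by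
  obtain ⟨κ, h⟩ := exists_isCutE hΩ.swap
  exact ⟨_, h.swap⟩

theorem HomENear.swap {Ω : Set (Amb n)} {l : ℝ} {G : Amb n → ℝ} (h : HomENear Ω l G) :
    HomPsiNear (Prod.swap ⁻¹' Ω) l (G ∘ Prod.swap) := fun p hp =>
  (tendsto_swap p).eventually (h _ ⟨hp.1, swap_mem_corner.2 hp.2⟩)

theorem HomPsiNear.swap {Ω : Set (Amb n)} {l : ℝ} {G : Amb n → ℝ} (h : HomPsiNear Ω l G) :
    HomENear (Prod.swap ⁻¹' Ω) l (G ∘ Prod.swap) := fun p hp =>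
  (tendsto_swap p).eventually (h _ ⟨hp.1, swap_mem_corner.2 hp.2⟩)

theorem smoothOn_leadPsi {Ω : Set (Amb n)} (hΩ : RelOpen Ω (dbl n)) {κ : Amb n → ℝ}
    (hκ : IsCutPsi Ω κ) {G : Amb n → ℝ} (hG : SmoothOn G Ω) (m : ℝ) :
    SmoothOn (leadPsi κ m G) Ω :=
  (smoothOn_leadE hΩ.swap hκ.swap hG.swap m).swap

/-- Successive leading terms and remainders at fibre infinity. -/
theorem exists_expansion_snd {Ω : Set (Amb n)} (hΩ : RelOpen Ω (dbl n)) {κ : Amb n → ℝ}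
    (hκ : IsCutPsi Ω κ) {G : Amb n → ℝ} (hG : SmoothOn G Ω) (m : ℝ) :
    ∃ Gs : ℕ → Amb n → ℝ, Gs 0 = G ∧ (∀ k, SmoothOn (Gs k) Ω) ∧
      ∀ (k : ℕ) (p : Amb n), p.2.2 ≠ 0 →
        Gs k p - leadPsi κ (m - k) (Gs k) p = p.2.2 * Gs (k + 1) p := by
  obtain ⟨Gs, h1, h2, h3⟩ := exists_expansion_fst hΩ.swap hκ.swap hG.swap m
  exact ⟨fun k => Gs k ∘ Prod.swap, by beta_reduce; rw [h1]; rfl, fun k => (h2 k).swap,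
    fun k p hp => h3 k p.swap hp⟩

theorem HomENear.leadPsi {Ω : Set (Amb n)} (hΩ : RelOpen Ω (dbl n)) {κ : Amb n → ℝ}
    (hκ : IsCutPsi Ω κ) {G : Amb n → ℝ} {l : ℝ} (h : HomENear Ω l G) (m : ℝ) :
    ∀ p ∈ Ω ∩ corner n, ∀ᶠ q in 𝓝 p, q ∈ Ω →
      leadPsi κ m G q = ‖q.1.1‖ ^ l * ‖q.2.1‖ ^ m * G (prE (prPsi q)) := by
  intro p hp
  have := (tendsto_swap p).eventually
    (h.swap.leadE hΩ.swap hκ.swap m p.swap ⟨hp.1, swap_mem_corner.2 hp.2⟩)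
  filter_upwards [this] with q hq hqΩ
  exact (hq hqΩ).1.trans (by rw [mul_comm (‖q.swap.1.1‖ ^ m)]; rfl)

theorem HomENear.expansion {Ω : Set (Amb n)} (hΩ : RelOpen Ω (dbl n)) {κ : Amb n → ℝ}
    (hκ : IsCutPsi Ω κ) {m l : ℝ} {Gs : ℕ → Amb n → ℝ} (h : HomENear Ω l (Gs 0))
    (hs : ∀ k, SmoothOn (Gs k) Ω) (hd : ∀ (k : ℕ) (p : Amb n), p.2.2 ≠ 0 →
        Gs k p - ScGeom.leadPsi κ (m - k) (Gs k) p = p.2.2 * Gs (k + 1) p) (k : ℕ) :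
    HomENear Ω l (Gs k) := by
  have := HomPsiNear.expansion hΩ.swap hκ.swap (Gs := fun k => Gs k ∘ Prod.swap) h.swap
    (fun k => (hs k).swap) (fun k p hp => hd k p.swap hp) k
  exact this.swap

/-- Near the corner the cutoff is `1` both at `q` and at `prE q`; `prE` is idempotent, and the first
component of `prE q` has norm one. -/
theorem homENear_leadE {Ω : Set (Amb n)} {κ : Amb n → ℝ}
    (hκ : IsCutE Ω κ) (G : Amb n → ℝ) (l : ℝ) : HomENear Ω l (leadE κ l G) := by
  intro p hp
  have hp' : p ∈ Ω ∩ faceE n := ⟨hp.1, hp.2.1⟩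
  filter_upwards [hκ.one p hp', (tendsto_prE hp.2.1).eventually (hκ.one p hp'),
    eventually_fst_ne_zero hp.2.1] with q h1 h2 h3 _
  have h4 : prE (prE q) = prE q := by
    refine Prod.ext ?_ rfl
    change nu ((nrm (q.1.1, (0 : ℝ)))⁻¹ • q.1.1, (0 : ℝ)) = nu (q.1.1, 0)
    have := nu_smul (inv_pos.2 (nrm_pos (mk_zero_ne_zero h3))) (q.1.1, (0 : ℝ))
    simpa using this
  have h5 : ‖(prE q).1.1‖ = 1 := by
    change ‖(nrm (q.1.1, (0 : ℝ)))⁻¹ • q.1.1‖ = 1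
    rw [← norm_eq_nrm, norm_smul, norm_inv, norm_norm, inv_mul_cancel₀ (norm_ne_zero_iff.2 h3)]
  simp [leadE, h1, h2, h4, h5]

theorem homPsiNear_leadPsi {Ω : Set (Amb n)} {κ : Amb n → ℝ}
    (hκ : IsCutPsi Ω κ) (G : Amb n → ℝ) (m : ℝ) : HomPsiNear Ω m (leadPsi κ m G) := fun p hp =>
  (tendsto_swap p).eventually (homENear_leadE hκ.swap (G ∘ Prod.swap) m p.swap
    ⟨hp.1, swap_mem_corner.2 hp.2⟩)

/-! ## Leading terms of homogeneous extensions -/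

theorem nu_smul_fst {x : Euc n} {a : ℝ} (ha : 0 < a) : nu (a • x, (0 : ℝ)) = nu (x, (0 : ℝ)) := by
  have := nu_smul ha (x, (0 : ℝ))
  simpa using this

theorem prE_nu2 {p : Amb n} (h : p.1 ≠ 0) : prE (nu2 p) = nu2 ((p.1.1, 0), p.2) :=
  Prod.ext (nu_smul_fst (inv_pos.2 (nrm_pos h))) rfl

theorem prPsi_nu2 {p : Amb n} (h : p.2 ≠ 0) : prPsi (nu2 p) = nu2 (p.1, (p.2.1, 0)) :=
  Prod.ext rfl (nu_smul_fst (inv_pos.2 (nrm_pos h)))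

theorem nrm_rpow_mul_norm_nu {X : Euc n × ℝ} (h : X ≠ 0) (l : ℝ) :
    nrm X ^ l * ‖(nu X).1‖ ^ l = ‖X.1‖ ^ l := by
  have h0 := nrm_pos h
  rw [← Real.mul_rpow h0.le (norm_nonneg _), nu_fst, norm_smul, norm_inv, Real.norm_eq_abs,
    abs_of_pos h0, ← mul_assoc, mul_inv_cancel₀ h0.ne', one_mul]

/-- The factor `‖p.1.1‖ ^ l` in `leadE` is what turns `nrm ^ l` into `‖x‖ ^ l`: where the cutoff is
`1`, the leading term becomes the exactly homogeneous extension of the face value. -/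
theorem hext_leadE {κ : Amb n → ℝ} {p : Amb n} (h : p.1 ≠ 0) (hκ : κ (nu2 p) = 1)
    (G : Amb n → ℝ) (l m : ℝ) :
    hext l m (leadE κ l G) p = hext l m G ((p.1.1, 0), p.2) := by
  simp only [hext, leadE, hκ, smul_eq_mul, one_mul, prE_nu2 h, ← norm_eq_nrm]
  rw [← nrm_rpow_mul_norm_nu h]
  simp only [nu2]; ring

theorem hext_leadPsi {κ : Amb n → ℝ} {p : Amb n} (h : p.2 ≠ 0) (hκ : κ (nu2 p) = 1)
    (G : Amb n → ℝ) (l m : ℝ) :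
    hext l m (leadPsi κ m G) p = hext l m G (p.1, (p.2.1, 0)) := by
  simp only [hext, leadPsi, hκ, smul_eq_mul, one_mul, prPsi_nu2 h, ← norm_eq_nrm]
  rw [← nrm_rpow_mul_norm_nu h]
  simp only [nu2]; ring

theorem hext_corner {p : Amb n} (h : p.1 ≠ 0) (h' : p.2 ≠ 0) {A G : Amb n → ℝ} {l m : ℝ}
    (hA : A (nu2 p) = ‖(nu2 p).1.1‖ ^ l * ‖(nu2 p).2.1‖ ^ m * G (prE (prPsi (nu2 p)))) :
    hext l m A p = hext l m G ((p.1.1, 0), (p.2.1, 0)) := by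
  rw [prPsi_nu2 h', prE_nu2 (p := (p.1, (p.2.1, 0))) h] at hA
  simp only [hext, hA, smul_eq_mul, ← norm_eq_nrm]
  rw [← nrm_rpow_mul_norm_nu h, ← nrm_rpow_mul_norm_nu h']
  simp only [nu2]; ring

/-- A telescoping sum. On the slice of height one, the height of the normalised point is `(nrm
p.1)⁻¹`, so each factor of the height left over by the division lowers the degree by one. -/
theorem hext_sub_sum_leadE {κ : Amb n → ℝ} {Gs : ℕ → Amb n → ℝ} {l : ℝ}
    (hd : ∀ (k : ℕ) (p : Amb n), p.1.2 ≠ 0 →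
        Gs k p - leadE κ (l - k) (Gs k) p = p.1.2 * Gs (k + 1) p) (m : ℝ) {p : Amb n}
    (hp : p.1.2 = 1) (N : ℕ) :
    hext l m (Gs 0) p - ∑ k ∈ Finset.range N, hext (l - k) m (leadE κ (l - k) (Gs k)) p =
      hext (l - N) m (Gs N) p := by
  induction N with
  | zero => simp
  | succ N ih =>
    have hp0 : p.1 ≠ 0 := fun h => by simp [h] at hp
    have h0 := nrm_pos hp0
    have h1 : (nu2 p).1.2 = (nrm p.1)⁻¹ := by simp [nu2, nu_snd, hp]
    have h2 := hd N (nu2 p) (by rw [h1]; exact (inv_pos.2 h0).ne')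
    rw [Finset.sum_range_succ, ← sub_sub, ih]
    simp only [hext, smul_eq_mul, ← mul_sub, h2, h1]
    push_cast
    rw [show l - ((N : ℝ) + 1) = l - N - 1 by ring, Real.rpow_sub_one h0.ne']
    field_simp

theorem hext_swap (l m : ℝ) (G : Amb n → ℝ) (p : Amb n) :
    hext l m G p = hext m l (G ∘ Prod.swap) p.swap := by
  simp [hext, nu2, mul_comm]

theorem hext_sub_sum_leadPsi {κ : Amb n → ℝ} {Gs : ℕ → Amb n → ℝ} {m : ℝ}
    (hd : ∀ (k : ℕ) (p : Amb n), p.2.2 ≠ 0 →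
        Gs k p - leadPsi κ (m - k) (Gs k) p = p.2.2 * Gs (k + 1) p) (l : ℝ) {p : Amb n}
    (hp : p.2.2 = 1) (N : ℕ) :
    hext l m (Gs 0) p - ∑ k ∈ Finset.range N, hext l (m - k) (leadPsi κ (m - k) (Gs k)) p =
      hext l (m - N) (Gs N) p := by
  have := hext_sub_sum_leadE (κ := κ ∘ Prod.swap) (Gs := fun k => Gs k ∘ Prod.swap) (l := m)
    (fun k p hp => hd k p.swap hp) l (p := p.swap) hp N
  simp only [hext_swap l]
  exact this

theorem hext_smul_fst (l m : ℝ) (G : Amb n → ℝ) {r : ℝ} (hr : 0 < r) (z : Phase n) (u : ℝ) :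
    hext l m G (emb 0 u (r • z.1, z.2)) = r ^ l * hext l m G (emb 0 u z) := by
  have := hext_smul l m G hr one_pos (emb 0 u z)
  simpa [emb] using this

theorem hext_smul_snd (l m : ℝ) (G : Amb n → ℝ) {r : ℝ} (hr : 0 < r) (z : Phase n) (s : ℝ) :
    hext l m G (emb s 0 (z.1, r • z.2)) = r ^ m * hext l m G (emb s 0 z) := by
  have := hext_smul l m G one_pos hr (emb s 0 z)
  simpa [emb] using this

theorem hext_smul_both (l m : ℝ) (G : Amb n → ℝ) {r t : ℝ} (hr : 0 < r) (ht : 0 < t)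
    (z : Phase n) :
    hext l m G (emb 0 0 (r • z.1, t • z.2)) = r ^ l * t ^ m * hext l m G (emb 0 0 z) := by
  have := hext_smul l m G hr ht (emb 0 0 z)
  simpa [emb] using this

/-! ## Uniformity on compact sets -/

/-- The part of `K` where the property is not known to hold in a neighbourhood is compact and lies
in `d > 0`; the minimum of `d` on it serves as `δ`. With `d` a height, or the larger of the two
heights, this turns statements near a face or the corner into statements for large arguments. -/
theorem exists_pos_of_isCompact {Ω K : Set (Amb n)} (hK : IsCompact K) (hKΩ : K ⊆ Ω)
    {d : Amb n → ℝ} (hd : Continuous d) {P : Amb n → Prop}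
    (h : ∀ p ∈ Ω, d p ≤ 0 → ∀ᶠ q in 𝓝 p, q ∈ Ω → P q) :
    ∃ δ > 0, ∀ q ∈ K, d q < δ → P q := by
  set N := interior {q | q ∈ Ω → P q}
  have hN : ∀ p ∈ Ω, d p ≤ 0 → p ∈ N := fun p hp hdp => mem_interior_iff_mem_nhds.2 (h p hp hdp)
  rcases (K \ N).eq_empty_or_nonempty with he | hne
  · refine ⟨1, one_pos, fun q hq _ => ?_⟩
    have : q ∈ N := by by_contra hq'; exact he.subset ⟨hq, hq'⟩
    exact interior_subset this (hKΩ hq)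
  · obtain ⟨p, hp, hmin⟩ := (hK.diff isOpen_interior).exists_isMinOn hne hd.continuousOn
    refine ⟨d p, ?_, fun q hq hdq => ?_⟩
    · by_contra hle
      exact hp.2 (hN p (hKΩ hp.1) (not_lt.1 hle))
    · have : q ∈ N := by
        by_contra hq'
        exact absurd (hmin ⟨hq, hq'⟩) (not_le.2 hdq)
      exact interior_subset this (hKΩ hq)

theorem inv_jb_lt {x : Euc n} {δ : ℝ} (hδ : 0 < δ) (h : δ⁻¹ < ‖x‖) : (jb x)⁻¹ < δ :=
  inv_lt_of_inv_lt₀ hδ (h.trans_le (norm_le_jb x))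

/-- The height of `R x` is `1/⟨x⟩`, so a small height means large `x`. The second factor stays an
arbitrary point of the ambient half-space factor, so that the lemma applies both on the interior and
on the face at fibre infinity. -/
theorem exists_large_fst {Ω K : Set (Amb n)} (hΩ : RelOpen Ω (dbl n)) (hK : IsCompact K)
    (hKΩ : K ⊆ Ω) {P : Amb n → Prop} (h : ∀ p ∈ Ω ∩ faceE n, ∀ᶠ q in 𝓝 p, q ∈ Ω → P q) :
    ∃ c : ℝ, 0 < c ∧ ∀ (x : Euc n) (Ξ : Euc n × ℝ), (R x, Ξ) ∈ K → c < ‖x‖ → P (R x, Ξ) := by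
  obtain ⟨δ, hδ, hP⟩ := exists_pos_of_isCompact hK hKΩ (d := fun p => p.1.2) (by fun_prop)
    fun p hp hd => h p ⟨hp, hΩ.subset hp, le_antisymm hd (hΩ.subset hp).1.2⟩
  exact ⟨δ⁻¹, inv_pos.2 hδ, fun x Ξ hz hc => hP _ hz (inv_jb_lt hδ hc)⟩

theorem exists_large_snd {Ω K : Set (Amb n)} (hΩ : RelOpen Ω (dbl n)) (hK : IsCompact K)
    (hKΩ : K ⊆ Ω) {P : Amb n → Prop} (h : ∀ p ∈ Ω ∩ facePsi n, ∀ᶠ q in 𝓝 p, q ∈ Ω → P q) :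
    ∃ c : ℝ, 0 < c ∧ ∀ (X : Euc n × ℝ) (ξ : Euc n), (X, R ξ) ∈ K → c < ‖ξ‖ → P (X, R ξ) := by
  obtain ⟨δ, hδ, hP⟩ := exists_pos_of_isCompact hK hKΩ (d := fun p => p.2.2) (by fun_prop)
    fun p hp hd => h p ⟨hp, hΩ.subset hp, le_antisymm hd (hΩ.subset hp).2.2⟩
  exact ⟨δ⁻¹, inv_pos.2 hδ, fun X ξ hz hc => hP _ hz (inv_jb_lt hδ hc)⟩

theorem exists_large_both {Ω K : Set (Amb n)} (hΩ : RelOpen Ω (dbl n)) (hK : IsCompact K)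
    (hKΩ : K ⊆ Ω) {P : Amb n → Prop} (h : ∀ p ∈ Ω ∩ corner n, ∀ᶠ q in 𝓝 p, q ∈ Ω → P q) :
    ∃ c : ℝ, 0 < c ∧ ∀ z : Phase n, ptInt z ∈ K → c < ‖z.1‖ → c < ‖z.2‖ → P (ptInt z) := by
  obtain ⟨δ, hδ, hP⟩ := exists_pos_of_isCompact hK hKΩ (d := fun p => max p.1.2 p.2.2)
    (by fun_prop) fun p hp hd => h p ⟨hp, ⟨hΩ.subset hp, le_antisymm ((le_max_left _ _).trans hd)
      (hΩ.subset hp).1.2⟩, hΩ.subset hp, le_antisymm ((le_max_right _ _).trans hd)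
      (hΩ.subset hp).2.2⟩
  exact ⟨δ⁻¹, inv_pos.2 hδ, fun z hz hc hc' =>
    hP _ hz (max_lt (inv_jb_lt hδ hc) (inv_jb_lt hδ hc'))⟩

theorem ne_zero_of_lt_norm {x : Euc n} {c : ℝ} (hc : 0 < c) (h : c < ‖x‖) : x ≠ 0 :=
  norm_pos_iff.1 (hc.trans h)

end

end ScGeom

namespace ScGeom

noncomputable section

variable {n : ℕ}

/-! ## Classical symbols from smooth functions on the compactified phase space -/

theorem symbInt_apply (l m : ℝ) (a : Amb n → ℝ) (z : Phase n) :
    symbInt l m a z = hext l m a (emb 1 1 z) := congrFun (symbInt_eq l m a) z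
theorem symbE_apply (l m : ℝ) (a : Amb n → ℝ) (z : Phase n) :
    symbE l m a z = hext l m a (emb 0 1 z) := congrFun (symbE_eq l m a) z
theorem symbPsi_apply (l m : ℝ) (a : Amb n → ℝ) (z : Phase n) :
    symbPsi l m a z = hext l m a (emb 1 0 z) := congrFun (symbPsi_eq l m a) z
theorem symbCorner_apply (l m : ℝ) (a : Amb n → ℝ) (z : Phase n) :
    symbCorner l m a z = hext l m a (emb 0 0 z) := congrFun (symbCorner_eq l m a) z

theorem symbInt_leadE {κ : Amb n → ℝ} {z : Phase n} (hκ : κ (ptInt z) = 1) (G : Amb n → ℝ)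
    (l m : ℝ) : symbInt l m (leadE κ l G) z = symbE l m G z := by
  rw [symbInt_apply, symbE_apply]
  exact hext_leadE (mk_one_ne_zero _) (by rwa [← ptInt_eq]) G l m

theorem symbInt_leadPsi {κ : Amb n → ℝ} {z : Phase n} (hκ : κ (ptInt z) = 1) (G : Amb n → ℝ)
    (l m : ℝ) : symbInt l m (leadPsi κ m G) z = symbPsi l m G z := by
  rw [symbInt_apply, symbPsi_apply]
  exact hext_leadPsi (mk_one_ne_zero _) (by rwa [← ptInt_eq]) G l m

theorem symbInt_corner {z : Phase n} {A G : Amb n → ℝ} {l m : ℝ}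
    (hA : A (ptInt z) = ‖(ptInt z).1.1‖ ^ l * ‖(ptInt z).2.1‖ ^ m * G (prE (prPsi (ptInt z)))) :
    symbInt l m A z = symbCorner l m G z := by
  rw [symbInt_apply, symbCorner_apply]
  exact hext_corner (mk_one_ne_zero _) (mk_one_ne_zero _) (by rwa [← ptInt_eq])

theorem symbE_smul (l m : ℝ) (G : Amb n → ℝ) {r : ℝ} (hr : 0 < r) (z : Phase n) :
    symbE l m G (r • z.1, z.2) = r ^ l * symbE l m G z := by
  simp only [symbE_apply]; exact hext_smul_fst l m G hr z 1

theorem symbPsi_smul (l m : ℝ) (G : Amb n → ℝ) {r : ℝ} (hr : 0 < r) (z : Phase n) :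
    symbPsi l m G (z.1, r • z.2) = r ^ m * symbPsi l m G z := by
  simp only [symbPsi_apply]; exact hext_smul_snd l m G hr z 1

theorem symbCorner_smul (l m : ℝ) (G : Amb n → ℝ) {r t : ℝ} (hr : 0 < r) (ht : 0 < t)
    (z : Phase n) : symbCorner l m G (r • z.1, t • z.2) = r ^ l * t ^ m * symbCorner l m G z := by
  simp only [symbCorner_apply]; exact hext_smul_both l m G hr ht z

theorem lt_norm_smul {x : Euc n} {c s : ℝ} (hs : 1 ≤ s) (h : c < ‖x‖) : c < ‖s • x‖ := by
  rw [norm_smul, Real.norm_eq_abs, abs_of_nonneg (zero_le_one.trans hs)]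
  nlinarith [norm_nonneg x]

section

variable {Ω : Set (Amb n)} (hΩ : RelOpen Ω (dbl n)) {κ : Amb n → ℝ}

include hΩ

theorem evHomE_leadE (hκ : IsCutE Ω κ) (G : Amb n → ℝ) (l m : ℝ) :
    EvHomE Ω l (symbInt l m (leadE κ l G)) := by
  intro K hK hKc
  obtain ⟨c, hc0, hc⟩ := exists_large_fst hΩ hKc hK (P := fun q => κ q = 1)
    fun p hp => (hκ.one p hp).mono fun q hq _ => hq
  refine ⟨c, fun z s hs hz h1 h2 => ?_⟩
  rw [symbInt_leadE (hc _ _ h1 hz), symbInt_leadE (hc _ _ h2 (lt_norm_smul hs hz)),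
    symbE_smul _ _ _ (one_pos.trans_le hs)]

theorem evHomPsi_leadPsi (hκ : IsCutPsi Ω κ) (G : Amb n → ℝ) (l m : ℝ) :
    EvHomPsi Ω m (symbInt l m (leadPsi κ m G)) := by
  intro K hK hKc
  obtain ⟨c, hc0, hc⟩ := exists_large_snd hΩ hKc hK (P := fun q => κ q = 1)
    fun p hp => (hκ.one p hp).mono fun q hq _ => hq
  refine ⟨c, fun z s hs hz h1 h2 => ?_⟩
  rw [symbInt_leadPsi (hc _ _ h1 hz), symbInt_leadPsi (hc _ _ h2 (lt_norm_smul hs hz)),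
    symbPsi_smul _ _ _ (one_pos.trans_le hs)]

theorem exists_large_symbCorner {A G : Amb n → ℝ} {l m : ℝ}
    (h : ∀ p ∈ Ω ∩ corner n, ∀ᶠ q in 𝓝 p, q ∈ Ω →
      A q = ‖q.1.1‖ ^ l * ‖q.2.1‖ ^ m * G (prE (prPsi q))) {K : Set (Amb n)} (hK : K ⊆ Ω)
    (hKc : IsCompact K) :
    ∃ c : ℝ, ∀ z : Phase n, ptInt z ∈ K → c < ‖z.1‖ → c < ‖z.2‖ →
      symbInt l m A z = symbCorner l m G z := by
  obtain ⟨c, hc0, hc⟩ := exists_large_both hΩ hKc hK h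
  exact ⟨c, fun z hz h1 h2 => symbInt_corner (hc z hz h1 h2)⟩

theorem evHomBi_of_corner {A G : Amb n → ℝ} {l m : ℝ}
    (h : ∀ p ∈ Ω ∩ corner n, ∀ᶠ q in 𝓝 p, q ∈ Ω →
      A q = ‖q.1.1‖ ^ l * ‖q.2.1‖ ^ m * G (prE (prPsi q))) :
    EvHomBi Ω l m (symbInt l m A) := by
  intro K hK hKc
  obtain ⟨c, hc⟩ := exists_large_symbCorner hΩ h hK hKc
  refine ⟨c, fun z s t hs ht h1 h2 h3 h4 => ?_⟩
  rw [hc z h3 h1 h2, hc _ h4 (lt_norm_smul hs h1) (lt_norm_smul ht h2),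
    symbCorner_smul _ _ _ (one_pos.trans_le hs) (one_pos.trans_le ht)]

omit hΩ in
theorem symbInt_sub_sum_leadE {Gs : ℕ → Amb n → ℝ} {l : ℝ}
    (hd : ∀ (k : ℕ) (p : Amb n), p.1.2 ≠ 0 →
        Gs k p - leadE κ (l - k) (Gs k) p = p.1.2 * Gs (k + 1) p) (m : ℝ) (N : ℕ) :
    (fun z => symbInt l m (Gs 0) z -
      ∑ k ∈ Finset.range (N + 1), symbInt (l - k) m (leadE κ (l - k) (Gs k)) z) =
      symbInt (l - N - 1) m (Gs (N + 1)) := by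
  funext z
  simp only [symbInt_apply]
  rw [hext_sub_sum_leadE hd m (p := emb 1 1 z) rfl]
  push_cast; rw [sub_sub]

omit hΩ in
theorem symbInt_sub_sum_leadPsi {Gs : ℕ → Amb n → ℝ} {m : ℝ}
    (hd : ∀ (k : ℕ) (p : Amb n), p.2.2 ≠ 0 →
        Gs k p - leadPsi κ (m - k) (Gs k) p = p.2.2 * Gs (k + 1) p) (l : ℝ) (N : ℕ) :
    (fun z => symbInt l m (Gs 0) z -
      ∑ k ∈ Finset.range (N + 1), symbInt l (m - k) (leadPsi κ (m - k) (Gs k)) z) =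
      symbInt l (m - N - 1) (Gs (N + 1)) := by
  funext z
  simp only [symbInt_apply]
  rw [hext_sub_sum_leadPsi hd l (p := emb 1 1 z) rfl]
  push_cast; rw [sub_sub]

theorem clE_symbInt {G : Amb n → ℝ} (hG : SmoothOn G Ω) (l m : ℝ) :
    ClE Ω l m (symbInt l m G) := by
  obtain ⟨κ, hκ⟩ := exists_isCutE hΩ
  obtain ⟨Gs, rfl, hs, hd⟩ := exists_expansion_fst hΩ hκ hG l
  refine ⟨SG_symbInt hΩ hG l m, fun k => symbInt (l - k) m (leadE κ (l - k) (Gs k)),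
    fun k => ⟨SG_symbInt hΩ (smoothOn_leadE hΩ hκ (hs k) _) _ _, evHomE_leadE hΩ hκ _ _ _⟩,
    fun N => ?_⟩
  rw [symbInt_sub_sum_leadE hd]
  exact SG_symbInt hΩ (hs _) _ _

theorem clPsi_symbInt {G : Amb n → ℝ} (hG : SmoothOn G Ω) (l m : ℝ) :
    ClPsi Ω l m (symbInt l m G) := by
  obtain ⟨κ, hκ⟩ := exists_isCutPsi hΩ
  obtain ⟨Gs, rfl, hs, hd⟩ := exists_expansion_snd hΩ hκ hG m
  refine ⟨SG_symbInt hΩ hG l m, fun k => symbInt l (m - k) (leadPsi κ (m - k) (Gs k)),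
    fun k => ⟨SG_symbInt hΩ (smoothOn_leadPsi hΩ hκ (hs k) _) _ _, evHomPsi_leadPsi hΩ hκ _ _ _⟩,
    fun N => ?_⟩
  rw [symbInt_sub_sum_leadPsi hd]
  exact SG_symbInt hΩ (hs _) _ _

/-- Homogeneity at fibre infinity passes from `G` to all successive remainders, so every term of the
expansion is bihomogeneous near the corner. -/
theorem exists_homExpansionE {G : Amb n → ℝ} (hG : SmoothOn G Ω) (l m : ℝ)
    (h : HomPsiNear Ω m G) :
    ∃ b, HomExpansionE Ω l m (symbInt l m G) b ∧ ∀ K ⊆ Ω, IsCompact K → ∃ c : ℝ,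
      ∀ z : Phase n, ptInt z ∈ K → c < ‖z.1‖ → c < ‖z.2‖ → b 0 z = symbCorner l m G z := by
  obtain ⟨κ, hκ⟩ := exists_isCutE hΩ
  obtain ⟨Gs, rfl, hs, hd⟩ := exists_expansion_fst hΩ hκ hG l
  have hk : ∀ k : ℕ, ∀ p ∈ Ω ∩ corner n, ∀ᶠ q in 𝓝 p, q ∈ Ω → leadE κ (l - k) (Gs k) q =
      ‖q.1.1‖ ^ (l - k) * ‖q.2.1‖ ^ m * Gs k (prE (prPsi q)) := fun k p hp => by
    filter_upwards [((h.expansion hΩ hκ hs hd k).leadE hΩ hκ (l - k)) p hp] with q hq hqΩ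
      using (hq hqΩ).1
  refine ⟨fun k => symbInt (l - k) m (leadE κ (l - k) (Gs k)),
    ⟨fun k => ⟨SG_symbInt hΩ (smoothOn_leadE hΩ hκ (hs k) _) _ _, evHomBi_of_corner hΩ (hk k)⟩,
    fun N => ?_⟩, fun K hK hKc => ?_⟩
  · rw [symbInt_sub_sum_leadE hd]
    exact SG_symbInt hΩ (hs _) _ _
  · have := exists_large_symbCorner hΩ (hk 0) hK hKc
    simpa using this

theorem exists_homExpansionPsi {G : Amb n → ℝ} (hG : SmoothOn G Ω) (l m : ℝ)
    (h : HomENear Ω l G) :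
    ∃ b, HomExpansionPsi Ω l m (symbInt l m G) b ∧ ∀ K ⊆ Ω, IsCompact K → ∃ c : ℝ,
      ∀ z : Phase n, ptInt z ∈ K → c < ‖z.1‖ → c < ‖z.2‖ → b 0 z = symbCorner l m G z := by
  obtain ⟨κ, hκ⟩ := exists_isCutPsi hΩ
  obtain ⟨Gs, rfl, hs, hd⟩ := exists_expansion_snd hΩ hκ hG m
  have hk : ∀ k : ℕ, ∀ p ∈ Ω ∩ corner n, ∀ᶠ q in 𝓝 p, q ∈ Ω → leadPsi κ (m - k) (Gs k) q =
      ‖q.1.1‖ ^ l * ‖q.2.1‖ ^ (m - k) * Gs k (prE (prPsi q)) := fun k =>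
    (h.expansion hΩ hκ hs hd k).leadPsi hΩ hκ (m - k)
  refine ⟨fun k => symbInt l (m - k) (leadPsi κ (m - k) (Gs k)),
    ⟨fun k => ⟨SG_symbInt hΩ (smoothOn_leadPsi hΩ hκ (hs k) _) _ _, evHomBi_of_corner hΩ (hk k)⟩,
    fun N => ?_⟩, fun K hK hKc => ?_⟩
  · rw [symbInt_sub_sum_leadPsi hd]
    exact SG_symbInt hΩ (hs _) _ _
  · have := exists_large_symbCorner hΩ (hk 0) hK hKc
    simpa using this

/-- Each term is homogeneous at spatial infinity by construction, so `exists_homExpansionPsi`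
expands it further; the remainder is again a section, of lower order. The initial term is recorded
because the principal symbol is read off from it. -/
theorem exists_expansionE (hκ : IsCutE Ω κ) {G : Amb n → ℝ} (hG : SmoothOn G Ω) (l m : ℝ) :
    ∃ a, ExpansionE Ω l m (symbInt l m G) a ∧ a 0 = symbInt l m (leadE κ l G) := by
  obtain ⟨Gs, rfl, hs, hd⟩ := exists_expansion_fst hΩ hκ hG l
  refine ⟨fun k => symbInt (l - k) m (leadE κ (l - k) (Gs k)), ⟨fun k => ?_, fun N => ?_⟩, by simp⟩
  · have hS := smoothOn_leadE hΩ hκ (hs k) (l - k)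
    obtain ⟨b, hb, -⟩ := exists_homExpansionPsi hΩ hS (l - k) m (homENear_leadE hκ (Gs k) (l - k))
    exact ⟨SG_symbInt hΩ hS _ _, evHomE_leadE hΩ hκ _ _ _, b, hb⟩
  · rw [symbInt_sub_sum_leadE hd]
    exact clPsi_symbInt hΩ (hs _) _ _

theorem exists_expansionPsi (hκ : IsCutPsi Ω κ) {G : Amb n → ℝ} (hG : SmoothOn G Ω) (l m : ℝ) :
    ∃ a, ExpansionPsi Ω l m (symbInt l m G) a ∧ a 0 = symbInt l m (leadPsi κ m G) := by
  obtain ⟨Gs, rfl, hs, hd⟩ := exists_expansion_snd hΩ hκ hG m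
  refine ⟨fun k => symbInt l (m - k) (leadPsi κ (m - k) (Gs k)), ⟨fun k => ?_, fun N => ?_⟩, by simp⟩
  · have hS := smoothOn_leadPsi hΩ hκ (hs k) (m - k)
    obtain ⟨b, hb, -⟩ := exists_homExpansionE hΩ hS l (m - k)
      (homPsiNear_leadPsi hκ (Gs k) (m - k))
    exact ⟨SG_symbInt hΩ hS _ _, evHomPsi_leadPsi hΩ hκ _ _ _, b, hb⟩
  · rw [symbInt_sub_sum_leadPsi hd]
    exact clE_symbInt hΩ (hs _) _ _

/-! ### Boundary parts of open sets and principal symbols -/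

theorem relOpen_inter_bdry : RelOpen (Ω ∩ bdry n) (bdry n) := by
  obtain ⟨O, hO, rfl⟩ := hΩ
  refine ⟨O, hO, ?_⟩
  ext p
  exact ⟨fun h => ⟨h.1.1, h.2⟩, fun h => ⟨⟨h.1, mem_dbl_of_bdry h.2⟩, h.2⟩⟩

omit hΩ in
theorem coneE_inter_bdry : coneE (Ω ∩ bdry n) = coneE Ω := by
  ext z
  exact ⟨fun h => ⟨h.1, h.2.1⟩, fun h => ⟨h.1, h.2, .inl (ptE_mem_faceE h.1)⟩⟩

omit hΩ in
theorem conePsi_inter_bdry : conePsi (Ω ∩ bdry n) = conePsi Ω := by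
  ext z
  exact ⟨fun h => ⟨h.1, h.2.1⟩, fun h => ⟨h.1, h.2, .inr (ptPsi_mem_facePsi h.1)⟩⟩

omit hΩ in
theorem coneCorner_inter_bdry : coneCorner (Ω ∩ bdry n) = coneCorner Ω := by
  ext z
  exact ⟨fun h => ⟨h.1, h.2.1, h.2.2.1⟩,
    fun h => ⟨h.1, h.2.1, h.2.2, .inl (ptCorner_mem_corner h.1 h.2.1).1⟩⟩

omit hΩ in
theorem prE_ptInt (z : Phase n) : prE (ptInt z) = ptE z := by
  rw [ptInt_eq, ptE_eq, prE_nu2 (mk_one_ne_zero _)]; rfl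

omit hΩ in
theorem prPsi_ptInt (z : Phase n) : prPsi (ptInt z) = ptPsi z := by
  rw [ptInt_eq, ptPsi_eq, prPsi_nu2 (mk_one_ne_zero _)]; rfl

omit hΩ in
theorem prE_ptPsi (z : Phase n) : prE (ptPsi z) = ptCorner z := by
  rw [ptPsi_eq, ptCorner_eq, prE_nu2 (mk_one_ne_zero _)]; rfl

omit hΩ in
theorem ptE_smul (z : Phase n) {r : ℝ} (hr : 0 < r) : ptE (r • z.1, z.2) = ptE z := by
  simp only [ptE, dir_eq, nu_smul_fst hr]

omit hΩ in
theorem ptPsi_smul (z : Phase n) {r : ℝ} (hr : 0 < r) : ptPsi (z.1, r • z.2) = ptPsi z := by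
  simp only [ptPsi, dir_eq, nu_smul_fst hr]

omit hΩ in
theorem ptCorner_smul (z : Phase n) {r t : ℝ} (hr : 0 < r) (ht : 0 < t) :
    ptCorner (r • z.1, t • z.2) = ptCorner z := by
  simp only [ptCorner, dir_eq, nu_smul_fst hr, nu_smul_fst ht]

theorem hasSymbE_symbInt {G : Amb n → ℝ} (hG : SmoothOn G Ω) (l m : ℝ) {s : Phase n → ℝ}
    (hs : EqOn s (symbE l m G) (coneE Ω)) : HasSymbE Ω l m (symbInt l m G) s := by
  obtain ⟨κ, hκ⟩ := exists_isCutE hΩ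
  obtain ⟨a, ha, ha0⟩ := exists_expansionE hΩ hκ hG l m
  refine ⟨?_, fun z hz r hr => ?_, a, ha, fun K hK hKc => ?_⟩
  · refine ContDiffOn.congr ?_ hs
    rw [symbE_eq, ← coneE_inter_bdry]
    exact contDiffOn_hext_E (relOpen_inter_bdry hΩ) (hG.mono fun p hp => hp.1.1) l m
  · have hz' : (r • z.1, z.2) ∈ coneE Ω := ⟨smul_ne_zero hr.ne' hz.1, by
      rw [ptE_smul z hr]; exact hz.2⟩
    rw [hs hz, hs hz', symbE_smul _ _ _ hr]
  · obtain ⟨c, hc0, hc⟩ := exists_large_fst hΩ hKc hK (P := fun q => κ q = 1 ∧ prE q ∈ Ω)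
      fun p hp => by
        filter_upwards [hκ.one p hp, eventually_prE_mem hΩ hp] with q h1 h2 hq
          using ⟨h1, (h2 hq).1⟩
    refine ⟨c, fun z hz hcz => ?_⟩
    obtain ⟨h1, h2⟩ := hc _ _ hz hcz
    rw [ha0, symbInt_leadE h1, hs ⟨ne_zero_of_lt_norm hc0 hcz, prE_ptInt z ▸ h2⟩]

theorem hasSymbPsi_symbInt {G : Amb n → ℝ} (hG : SmoothOn G Ω) (l m : ℝ) {s : Phase n → ℝ}
    (hs : EqOn s (symbPsi l m G) (conePsi Ω)) : HasSymbPsi Ω l m (symbInt l m G) s := by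
  obtain ⟨κ, hκ⟩ := exists_isCutPsi hΩ
  obtain ⟨a, ha, ha0⟩ := exists_expansionPsi hΩ hκ hG l m
  refine ⟨?_, fun z hz r hr => ?_, a, ha, fun K hK hKc => ?_⟩
  · refine ContDiffOn.congr ?_ hs
    rw [symbPsi_eq, ← conePsi_inter_bdry]
    exact contDiffOn_hext_Psi (relOpen_inter_bdry hΩ) (hG.mono fun p hp => hp.1.1) l m
  · have hz' : (z.1, r • z.2) ∈ conePsi Ω := ⟨smul_ne_zero hr.ne' hz.1, by
      rw [ptPsi_smul z hr]; exact hz.2⟩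
    rw [hs hz, hs hz', symbPsi_smul _ _ _ hr]
  · obtain ⟨c, hc0, hc⟩ := exists_large_snd hΩ hKc hK (P := fun q => κ q = 1 ∧ prPsi q ∈ Ω)
      fun p hp => by
        filter_upwards [hκ.one p hp, eventually_prPsi_mem hΩ hp] with q h1 h2 hq
          using ⟨h1, (h2 hq).1⟩
    refine ⟨c, fun z hz hcz => ?_⟩
    obtain ⟨h1, h2⟩ := hc _ _ hz hcz
    rw [ha0, symbInt_leadPsi h1, hs ⟨ne_zero_of_lt_norm hc0 hcz, prPsi_ptInt z ▸ h2⟩]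

omit hΩ in
theorem leadPsi_of_facePsi (hκ : IsCutPsi Ω κ) (G : Amb n → ℝ)
    (m : ℝ) {p : Amb n} (hp : p ∈ Ω ∩ facePsi n) : leadPsi κ m G p = G p := by
  rw [leadPsi, (hκ.one p hp).self_of_nhds, prPsi_of_facePsi hp.2, nrm_fst_of_zero hp.2.1.2 hp.2.2]
  simp

theorem exists_large_ptCorner {K : Set (Amb n)} (hK : K ⊆ Ω) (hKc : IsCompact K) :
    ∃ c : ℝ, 0 < c ∧ ∀ z : Phase n, ptInt z ∈ K → c < ‖z.1‖ → c < ‖z.2‖ → z ∈ coneCorner Ω := by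
  obtain ⟨c, hc0, hc⟩ := exists_large_both hΩ hKc hK (P := fun q => prE (prPsi q) ∈ Ω)
    fun p hp => by
      filter_upwards [eventually_prPsi_mem hΩ ⟨hp.1, hp.2.2⟩,
        (tendsto_prPsi hp.2.2).eventually (eventually_prE_mem hΩ ⟨hp.1, hp.2.1⟩)]
        with q h1 h2 hq using (h2 (h1 hq).1).1
  refine ⟨c, hc0, fun z hz h1 h2 => ⟨ne_zero_of_lt_norm hc0 h1, ne_zero_of_lt_norm hc0 h2, ?_⟩⟩
  have := hc z hz h1 h2
  rwa [prPsi_ptInt, prE_ptPsi] at this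

/-- In either order, the leading term of the leading term is the bihomogeneous function given by the
corner values of `leadPsi` or `leadE`. Both agree with `G` at the corner, so the two iterated
symbols coincide. -/
theorem hasSymbCorner_symbInt {G : Amb n → ℝ} (hG : SmoothOn G Ω) (l m : ℝ) {s : Phase n → ℝ}
    (hs : EqOn s (symbCorner l m G) (coneCorner Ω)) : HasSymbCorner Ω l m (symbInt l m G) s := by
  refine ⟨?_, fun z hz r t hr ht => ?_, ?_, ?_⟩
  · refine ContDiffOn.congr ?_ hs
    rw [symbCorner_eq, ← coneCorner_inter_bdry]
    exact contDiffOn_hext_corner (relOpen_inter_bdry hΩ) (hG.mono fun p hp => hp.1.1) l m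
  · have hz' : (r • z.1, t • z.2) ∈ coneCorner Ω :=
      ⟨smul_ne_zero hr.ne' hz.1, smul_ne_zero ht.ne' hz.2.1, by
        rw [ptCorner_smul z hr ht]; exact hz.2.2⟩
    rw [hs hz, hs hz', symbCorner_smul _ _ _ hr ht]
  · obtain ⟨κ, hκ⟩ := exists_isCutPsi hΩ
    obtain ⟨a, ha, ha0⟩ := exists_expansionPsi hΩ hκ hG l m
    obtain ⟨b, hb, hb0⟩ := exists_homExpansionE hΩ (smoothOn_leadPsi hΩ hκ hG m) l m
      (homPsiNear_leadPsi hκ G m)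
    refine ⟨a, b, ha, ha0 ▸ hb, fun K hK hKc => ?_⟩
    obtain ⟨c, hc⟩ := hb0 K hK hKc
    obtain ⟨c', hc0', hc'⟩ := exists_large_ptCorner hΩ hK hKc
    refine ⟨max c c', fun z hz h1 h2 => ?_⟩
    have hz' := hc' z hz ((le_max_right _ _).trans_lt h1) ((le_max_right _ _).trans_lt h2)
    rw [hc z hz ((le_max_left _ _).trans_lt h1) ((le_max_left _ _).trans_lt h2), hs hz',
      symbCorner, symbCorner,
      leadPsi_of_facePsi hκ _ _ ⟨hz'.2.2, (ptCorner_mem_corner hz'.1 hz'.2.1).2⟩]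
  · obtain ⟨κ, hκ⟩ := exists_isCutE hΩ
    obtain ⟨a, ha, ha0⟩ := exists_expansionE hΩ hκ hG l m
    obtain ⟨b, hb, hb0⟩ := exists_homExpansionPsi hΩ (smoothOn_leadE hΩ hκ hG l) l m
      (homENear_leadE hκ G l)
    refine ⟨a, b, ha, ha0 ▸ hb, fun K hK hKc => ?_⟩
    obtain ⟨c, hc⟩ := hb0 K hK hKc
    obtain ⟨c', hc0', hc'⟩ := exists_large_ptCorner hΩ hK hKc
    refine ⟨max c c', fun z hz h1 h2 => ?_⟩
    have hz' := hc' z hz ((le_max_right _ _).trans_lt h1) ((le_max_right _ _).trans_lt h2)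
    rw [hc z hz ((le_max_left _ _).trans_lt h1) ((le_max_left _ _).trans_lt h2), hs hz',
      symbCorner, symbCorner,
      leadE_of_faceE hκ _ _ ⟨hz'.2.2, (ptCorner_mem_corner hz'.1 hz'.2.1).1⟩]

/-- A smooth function on a neighbourhood of part of the boundary defines a classical `SG`-symbol,
whose principal symbol is given by the restrictions to the faces and the corner. -/
theorem classicalSGWithSymbol_symbInt {G : Amb n → ℝ} (hG : SmoothOn G Ω) (l m : ℝ)
    {se sp sc : Phase n → ℝ} (hse : EqOn se (symbE l m G) (coneE Ω))
    (hsp : EqOn sp (symbPsi l m G) (conePsi Ω))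
    (hsc : EqOn sc (symbCorner l m G) (coneCorner Ω)) :
    ClassicalSGWithSymbol Ω l m (symbInt l m G) se sp sc := by
  have h1 := hasSymbE_symbInt hΩ hG l m hse
  have h2 := hasSymbPsi_symbInt hΩ hG l m hsp
  obtain ⟨a, ha, -⟩ := h1.2.2
  obtain ⟨b, hb, -⟩ := h2.2.2
  exact ⟨⟨SG_symbInt hΩ hG l m, ⟨b, hb⟩, a, ha⟩, h1, h2, hasSymbCorner_symbInt hΩ hG l m hsc⟩

/-! ## Classical symbols on the faces -/

/-- The Taylor expansion at fibre infinity that serves on the interior is used again, on the slice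
with heights `(0, 1)` in place of `(1, 1)`. -/
theorem classicalE_symbE {G : Amb n → ℝ} (hG : SmoothOn G Ω) (m : ℝ) {f : Phase n → ℝ}
    (hf : EqOn f (symbE 0 m G) (coneE Ω)) : ClassicalE (Ω ∩ bdry n) m f := by
  have hU := relOpen_inter_bdry hΩ
  have hS : ∀ {G : Amb n → ℝ} (_ : SmoothOn G Ω) (m : ℝ), SymbolE (Ω ∩ bdry n) m (symbE 0 m G) :=
    fun hG m => SymbolE_symbE hU (hG.mono fun p hp => hp.1.1) m
  rw [← coneE_inter_bdry] at hf
  obtain ⟨κ, hκ⟩ := exists_isCutPsi hΩ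
  obtain ⟨Gs, rfl, hs, hd⟩ := exists_expansion_snd hΩ hκ hG m
  refine ⟨(hS hG m).congr hU hf, fun k => symbE 0 (m - k) (leadPsi κ (m - k) (Gs k)),
    fun k => ⟨hS (smoothOn_leadPsi hΩ hκ (hs k) _) _, fun K hK hKc => ?_⟩, fun N => ?_⟩
  · obtain ⟨c, hc0, hc⟩ := exists_large_snd hΩ hKc (fun p hp => (hK hp).1.1)
      (P := fun q => κ q = 1) fun p hp => (hκ.one p hp).mono fun q hq _ => hq
    have key : ∀ z : Phase n, z.1 ≠ 0 → c < ‖z.2‖ → ptE z ∈ K →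
        symbE 0 (m - k) (leadPsi κ (m - k) (Gs k)) z = symbCorner 0 (m - k) (Gs k) z := by
      intro z h0 h1 h2
      rw [symbE_apply, symbCorner_apply]
      exact hext_leadPsi (mk_one_ne_zero _) (by rw [← ptE_eq]; exact hc _ _ h2 h1) _ _ _
    refine ⟨c, fun z s hs1 h0 h1 h2 h3 => ?_⟩
    beta_reduce
    rw [key z h0 h1 h2, key (z.1, s • z.2) h0 (lt_norm_smul hs1 h1) h3]
    have := symbCorner_smul 0 (m - k) (Gs k) one_pos (one_pos.trans_le hs1) z
    simpa using this
  · refine (hS (hs (N + 1)) (m - N - 1)).congr hU fun z hz => ?_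
    have := hext_sub_sum_leadPsi hd 0 (p := emb 0 1 z) rfl (N + 1)
    simp only [← symbE_apply] at this
    rw [hf hz, this]
    push_cast; rw [sub_sub]

theorem classicalPsi_symbPsi {G : Amb n → ℝ} (hG : SmoothOn G Ω) (m : ℝ) {f : Phase n → ℝ}
    (hf : EqOn f (symbPsi m 0 G) (conePsi Ω)) : ClassicalPsi (Ω ∩ bdry n) m f := by
  have hU := relOpen_inter_bdry hΩ
  have hS : ∀ {G : Amb n → ℝ} (_ : SmoothOn G Ω) (m : ℝ),
      SymbolPsi (Ω ∩ bdry n) m (symbPsi m 0 G) :=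
    fun hG m => SymbolPsi_symbPsi hU (hG.mono fun p hp => hp.1.1) m
  rw [← conePsi_inter_bdry] at hf
  obtain ⟨κ, hκ⟩ := exists_isCutE hΩ
  obtain ⟨Gs, rfl, hs, hd⟩ := exists_expansion_fst hΩ hκ hG m
  refine ⟨(hS hG m).congr hU hf, fun k => symbPsi (m - k) 0 (leadE κ (m - k) (Gs k)),
    fun k => ⟨hS (smoothOn_leadE hΩ hκ (hs k) _) _, fun K hK hKc => ?_⟩, fun N => ?_⟩
  · obtain ⟨c, hc0, hc⟩ := exists_large_fst hΩ hKc (fun p hp => (hK hp).1.1)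
      (P := fun q => κ q = 1) fun p hp => (hκ.one p hp).mono fun q hq _ => hq
    have key : ∀ z : Phase n, z.2 ≠ 0 → c < ‖z.1‖ → ptPsi z ∈ K →
        symbPsi (m - k) 0 (leadE κ (m - k) (Gs k)) z = symbCorner (m - k) 0 (Gs k) z := by
      intro z h0 h1 h2
      rw [symbPsi_apply, symbCorner_apply]
      exact hext_leadE (mk_one_ne_zero _) (by rw [← ptPsi_eq]; exact hc _ _ h2 h1) _ _ _
    refine ⟨c, fun z s hs1 h0 h1 h2 h3 => ?_⟩
    beta_reduce
    rw [key z h0 h1 h2, key (s • z.1, z.2) h0 (lt_norm_smul hs1 h1) h3]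
    have := symbCorner_smul (m - k) 0 (Gs k) (one_pos.trans_le hs1) one_pos z
    simpa using this
  · refine (hS (hs (N + 1)) (m - N - 1)).congr hU fun z hz => ?_
    have := hext_sub_sum_leadE hd 0 (p := emb 1 0 z) rfl (N + 1)
    simp only [← symbPsi_apply] at this
    rw [hf hz, this]
    push_cast; rw [sub_sub]

end

end

end ScGeom

namespace ScGeom

noncomputable section

variable {n : ℕ}

/-! ## Extension of boundary functions -/

section Extension

variable {F : Type} [NormedAddCommGroup F] [NormedSpace ℝ F]

/-- Away from the corner only one face is present and its local smooth extension suffices. At the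
corner the extensions from the two faces are glued by inclusion and exclusion. -/
theorem exists_local_extension {U : Set (Amb n)} (hU : RelOpen U (bdry n)) {f : Amb n → F}
    (hE : SmoothOn f (U ∩ faceE n)) (hP : SmoothOn f (U ∩ facePsi n)) {x : Amb n} (hx : x ∈ U) :
    ∃ (W : Set (Amb n)) (E : Amb n → F), IsOpen W ∧ x ∈ W ∧ ContDiffOn ℝ ∞ E W ∧
      ∀ q ∈ W, q ∈ U → E q = f q := by
  suffices ∃ (W : Set (Amb n)) (E : Amb n → F), IsOpen W ∧ x ∈ W ∧ ContDiffOn ℝ ∞ E W ∧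
      ∀ᶠ q in 𝓝 x, q ∈ U → E q = f q by
    obtain ⟨W, E, hW, hxW, hE, he⟩ := this
    obtain ⟨Q, hQ, hQo, hxQ⟩ := eventually_nhds_iff.1 he
    exact ⟨W ∩ Q, E, hW.inter hQo, ⟨hxW, hxQ⟩, hE.mono inter_subset_left, fun q hq => hQ q hq.2⟩
  by_cases hxE : x ∈ faceE n
  · obtain ⟨F₁, hF₁, he₁⟩ := hE.exists_contDiff ⟨hx, hxE⟩
    by_cases hxP : x ∈ facePsi n
    · obtain ⟨F₂, hF₂, he₂⟩ := hP.exists_contDiff ⟨hx, hxP⟩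
      have hW : IsOpen {p : Amb n | p.1.1 ≠ 0 ∧ p.2.1 ≠ 0} :=
        isOpen_fst_ne.inter (isOpen_ne.preimage (continuous_fst.comp continuous_snd))
      -- On the e-face the last two terms cancel, because `prE` fixes `prPsi q`. On the ψ-face the
      -- first and third cancel, because `F₁` and `F₂` both represent `f` at the corner point `prE
      -- q`.
      refine ⟨_, fun q => F₁ (prE q) + F₂ (prPsi q) - F₂ (prE (prPsi q)), hW,
        ⟨fst_ne_zero_of_faceE hxE, fst_ne_zero_of_hemi hxP.1.2 hxP.2⟩, fun p hp => ?_, ?_⟩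
      · refine ContDiffAt.contDiffWithinAt ?_
        have h1 := contDiffAt_prE hp.1
        have h2 := contDiffAt_prPsi hp.2
        have h3 : ContDiffAt ℝ ∞ (fun q : Amb n => prE (prPsi q)) p :=
          ContDiffAt.comp (g := prE) p (contDiffAt_prE hp.1) h2
        exact ((hF₁.contDiffAt.comp p h1).add (hF₂.contDiffAt.comp p h2)).sub
          (hF₂.contDiffAt.comp p h3)
      · filter_upwards [he₁, he₂, (tendsto_prE hxE).eventually he₁,
          (tendsto_prE hxE).eventually he₂, (tendsto_prE hxE).eventually (hU.eventually hx),
          eventually_fst_ne_zero hxE] with q h1 h2 h3 h4 h5 h6 hq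
        rcases hU.subset hq with hqE | hqP
        · have h7 : prE (prPsi q) = prPsi q := by
            change prPsi (prE q) = prPsi q
            rw [prE_of_faceE hqE]
          rw [h7, prE_of_faceE hqE, add_sub_cancel_right, h1 ⟨hq, hqE⟩]
        · have h7 : prE q ∈ faceE n := prE_mem_faceE hqP.1 h6
          have h8 : prE q ∈ facePsi n := ⟨h7.1, hqP.2⟩
          have h9 : prE q ∈ U := h5 (.inl h7)
          rw [prPsi_of_facePsi hqP, ← h3 ⟨h9, h7⟩, ← h4 ⟨h9, h8⟩, add_sub_cancel_left,
            h2 ⟨hq, hqP⟩]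
    · refine ⟨univ, F₁, isOpen_univ, mem_univ _, hF₁.contDiffOn, ?_⟩
      filter_upwards [he₁, isClosed_facePsi.isOpen_compl.mem_nhds hxP] with q h1 h2 hq
      exact (h1 ⟨hq, (hU.subset hq).resolve_right h2⟩).symm
  · have hxP := (hU.subset hx).resolve_left hxE
    obtain ⟨F₂, hF₂, he₂⟩ := hP.exists_contDiff ⟨hx, hxP⟩
    refine ⟨univ, F₂, isOpen_univ, mem_univ _, hF₂.contDiffOn, ?_⟩
    filter_upwards [he₂, isClosed_faceE.isOpen_compl.mem_nhds hxE] with q h1 h2 hq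
    exact (h1 ⟨hq, (hU.subset hq).resolve_left h2⟩).symm

/-- The largest relatively open set whose boundary part is `U`. -/
def fill (U : Set (Amb n)) : Set (Amb n) := U ∪ (dbl n \ bdry n)

theorem fill_inter_bdry {U : Set (Amb n)} (hU : U ⊆ bdry n) : fill U ∩ bdry n = U := by
  ext p
  constructor
  · rintro ⟨h | h, hb⟩
    · exact h
    · exact (h.2 hb).elim
  · exact fun h => ⟨.inl h, hU h⟩

theorem fill_bdry : fill (bdry n) = dbl n :=
  union_sdiff_cancel fun _ => mem_dbl_of_bdry

theorem fill_eq {O : Set (Amb n)} : fill (O ∩ bdry n) = (O ∪ (bdry n)ᶜ) ∩ dbl n := by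
  ext p
  constructor
  · rintro (h | h)
    · exact ⟨.inl h.1, mem_dbl_of_bdry h.2⟩
    · exact ⟨.inr h.2, h.1⟩
  · rintro ⟨h | h, hd⟩
    · by_cases hb : p ∈ bdry n
      · exact .inl ⟨h, hb⟩
      · exact .inr ⟨hd, hb⟩
    · exact .inr ⟨hd, h⟩

theorem relOpen_fill {U : Set (Amb n)} (hU : RelOpen U (bdry n)) : RelOpen (fill U) (dbl n) := by
  obtain ⟨O, hO, rfl⟩ := hU
  exact ⟨_, hO.union isClosed_bdry.isOpen_compl, fill_eq⟩

open scoped Manifold in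
/-- Boundary functions which are smooth on both faces extend smoothly to the interior. -/
theorem exists_extension {U : Set (Amb n)} (hU : RelOpen U (bdry n)) {f : Amb n → F}
    (hE : SmoothOn f (U ∩ faceE n)) (hP : SmoothOn f (U ∩ facePsi n)) :
    ∃ G : Amb n → F, SmoothOn G (fill U) ∧ EqOn G f U := by
  classical
  obtain ⟨O, hO, hUO⟩ := id hU
  let M : TopologicalSpace.Opens (Amb n) := ⟨O ∪ (bdry n)ᶜ, hO.union isClosed_bdry.isOpen_compl⟩
  have hfill : fill U = (M : Set (Amb n)) ∩ dbl n := by rw [hUO]; exact fill_eq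
  have : LocallyCompactSpace M := M.isOpen.locallyCompactSpace
  have : SigmaCompactSpace M := inferInstance
  -- Prescribing the value at points of `U`, and nothing elsewhere, is a convex condition, so a
  -- partition of unity on the open set `O ∪ (bdry n)ᶜ` glues the local extensions.
  obtain ⟨g, hg⟩ := exists_contMDiffMap_forall_mem_convex_of_local (n := ⊤) 𝓘(ℝ, Amb n)
    (M := M) (F := F) (t := fun x => {y | (x : Amb n) ∈ U → y = f x}) (fun x => by
      intro a ha b hb s t _ _ hst hx
      simp only [ha hx, hb hx]
      rw [← add_smul, hst, one_smul]) (fun x => by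
      by_cases hx : (x : Amb n) ∈ bdry n
      · have hxU : (x : Amb n) ∈ U := by
          rw [hUO]
          exact ⟨x.2.resolve_right fun h => h hx, hx⟩
        obtain ⟨W, E, hW, hxW, hE', he⟩ := exists_local_extension hU hE hP hxU
        refine ⟨Subtype.val ⁻¹' W, (hW.preimage continuous_subtype_val).mem_nhds hxW,
          fun y => E y, fun y hy => ?_, fun y hy hyU => he _ hy hyU⟩
        refine ContMDiffAt.contMDiffWithinAt ?_
        refine contMDiffAt_subtype_iff.2 ?_
        exact (hE'.contDiffAt (hW.mem_nhds hy)).contMDiffAt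
      · refine ⟨Subtype.val ⁻¹' (bdry n)ᶜ,
          (isClosed_bdry.isOpen_compl.preimage continuous_subtype_val).mem_nhds hx, fun _ => 0,
          contMDiffOn_const, fun y hy hyU => (hy (hU.subset hyU)).elim⟩)
  refine ⟨fun p => if h : p ∈ M then g ⟨p, h⟩ else 0, ?_, fun p hp => ?_⟩
  · refine SmoothOn.of_contDiffOn M.isOpen (hfill ▸ inter_subset_left) fun p hp => ?_
    have h1 := g.contMDiff ⟨p, hp⟩
    have h2 : (g : M → F) = fun x : M => (fun p => if h : p ∈ M then g ⟨p, h⟩ else 0) (x : Amb n) := by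
      funext x; simp
    rw [h2] at h1
    have h3 := (contMDiffAt_subtype_iff (I := 𝓘(ℝ, Amb n)) (I' := 𝓘(ℝ, F)) (U := M)
      (f := fun p => if h : p ∈ M then g ⟨p, h⟩ else 0) (x := ⟨p, hp⟩)).1 h1
    exact h3.contDiffAt.contDiffWithinAt
  · have hpM : p ∈ M := by
      have : p ∈ fill U := .inl hp
      rw [hfill] at this; exact this.1
    simp only [hpM, dif_pos]
    exact hg ⟨p, hpM⟩ hp

end Extension

end

end ScGeom

namespace ScGeom

noncomputable section

variable {n : ℕ}

/-! ## Radial factors -/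

section BdryDiffeo

variable {χ : PartialEquiv (Amb n) (Amb n)} (hχ : IsBdryDiffeo χ)

include hχ

theorem IsBdryDiffeo.symm : IsBdryDiffeo χ.symm where
  source_open := hχ.target_open
  target_open := hχ.source_open
  map_faceE p hp := by
    have := hχ.map_faceE (χ.symm p) (χ.map_target hp)
    rw [χ.right_inv hp] at this; exact this.symm
  map_facePsi p hp := by
    have := hχ.map_facePsi (χ.symm p) (χ.map_target hp)
    rw [χ.right_inv hp] at this; exact this.symm
  smoothE := hχ.symm_smoothE
  smoothPsi := hχ.symm_smoothPsi
  symm_smoothE := by simpa using hχ.smoothE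
  symm_smoothPsi := by simpa using hχ.smoothPsi

theorem IsBdryDiffeo.mem_dbl {p : Amb n} (hp : p ∈ χ.source) : p ∈ dbl n :=
  mem_dbl_of_bdry (hχ.source_open.subset hp)

theorem IsBdryDiffeo.map_mem_dbl {p : Amb n} (hp : p ∈ χ.source) : χ p ∈ dbl n :=
  mem_dbl_of_bdry (hχ.target_open.subset (χ.map_source hp))

theorem IsBdryDiffeo.map_fst_eq_zero {p : Amb n} (hp : p ∈ χ.source) :
    (χ p).1.2 = 0 ↔ p.1.2 = 0 :=
  ⟨fun h => ((hχ.map_faceE p hp).1 ⟨hχ.map_mem_dbl hp, h⟩).2,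
    fun h => ((hχ.map_faceE p hp).2 ⟨hχ.mem_dbl hp, h⟩).2⟩

theorem IsBdryDiffeo.map_snd_eq_zero {p : Amb n} (hp : p ∈ χ.source) :
    (χ p).2.2 = 0 ↔ p.2.2 = 0 :=
  ⟨fun h => ((hχ.map_facePsi p hp).1 ⟨hχ.map_mem_dbl hp, h⟩).2,
    fun h => ((hχ.map_facePsi p hp).2 ⟨hχ.mem_dbl hp, h⟩).2⟩

theorem IsBdryDiffeo.map_fst_pos {p : Amb n} (hp : p ∈ χ.source) (h : 0 < p.1.2) :
    0 < (χ p).1.2 :=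
  (hχ.map_mem_dbl hp).1.2.lt_of_ne fun h' => h.ne' ((hχ.map_fst_eq_zero hp).1 h'.symm)

theorem IsBdryDiffeo.map_snd_pos {p : Amb n} (hp : p ∈ χ.source) (h : 0 < p.2.2) :
    0 < (χ p).2.2 :=
  (hχ.map_mem_dbl hp).2.2.lt_of_ne fun h' => h.ne' ((hχ.map_snd_eq_zero hp).1 h'.symm)

theorem IsBdryDiffeo.restrictsToDiffeo {S : Set (Amb n)} (hS : S ⊆ faceE n ∨ S ⊆ facePsi n)
    (h : ∀ p ∈ χ.source, χ p ∈ S ↔ p ∈ S) : RestrictsToDiffeo χ S := by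
  refine ⟨⟨fun p hp => ⟨χ.map_source hp.1, (h p hp.1).2 hp.2⟩,
    χ.injOn.mono inter_subset_left, fun p hp => ⟨χ.symm p, ⟨χ.map_target hp.1, ?_⟩,
      χ.right_inv hp.1⟩⟩, ?_, ?_⟩
  · have := h (χ.symm p) (χ.map_target hp.1)
    rw [χ.right_inv hp.1] at this
    exact this.1 hp.2
  · rcases hS with hS | hS
    · exact hχ.smoothE.mono (inter_subset_inter_right _ hS)
    · exact hχ.smoothPsi.mono (inter_subset_inter_right _ hS)
  · rcases hS with hS | hS
    · exact hχ.symm_smoothE.mono (inter_subset_inter_right _ hS)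
    · exact hχ.symm_smoothPsi.mono (inter_subset_inter_right _ hS)

end BdryDiffeo

/-- `φ` and `ψ` are smooth positive extensions across the corner of the radial factors of the
homogeneous lifts of `χ`; they measure how `χ` acts on the boundary defining functions. -/
structure IsRadial (χ : PartialEquiv (Amb n) (Amb n)) (ge gp φ ψ : Amb n → ℝ) : Prop where
  smooth_fst : SmoothBdry χ.source φ
  smooth_snd : SmoothBdry χ.source ψ
  pos_fst : ∀ p ∈ χ.source, 0 < φ p
  pos_snd : ∀ p ∈ χ.source, 0 < ψ p
  eq_fst : ∀ p ∈ χ.source, p.1.2 = φ p * (χ p).1.2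
  eq_snd : ∀ p ∈ χ.source, p.2.2 = ψ p * (χ p).2.2
  eq_ge : ∀ z ∈ coneE χ.source, (ge (ptE z))⁻¹ = φ (ptE z)
  eq_gp : ∀ z ∈ conePsi χ.source, (gp (ptPsi z))⁻¹ = ψ (ptPsi z)

/-- A limit of positive values is only nonnegative; the reciprocal function, continuous up to the
same point, excludes zero. It is used at the corner, with the pull-backs of opposite orders as `φ`
and `φ'`. -/
theorem pos_of_mul_eq_one_near {φ φ' : Amb n → ℝ} {S : Set (Amb n)} {p : Amb n}
    (h : ContinuousWithinAt φ S p) (h' : ContinuousWithinAt φ' S p)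
    (hf : ∃ᶠ q in 𝓝 p, q ∈ S ∧ 0 < φ q ∧ φ q * φ' q = 1) : 0 < φ p := by
  have h1 : φ p * φ' p = 1 := eq_of_frequently_eq (f := fun q => φ q * φ' q) (g := fun _ => 1)
    (h.mul h') continuousWithinAt_const (hf.mono fun q hq => ⟨hq.1, hq.2.2⟩)
  have h2 : φ p = |φ p| := eq_of_frequently_eq (g := fun q => |φ q|) h h.abs
    (hf.mono fun q hq => ⟨hq.1, (abs_of_pos hq.2.1).symm⟩)
  rw [h2]
  exact abs_pos.2 fun h0 => by simp [h0] at h1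

theorem frequently_faceE {U : Set (Amb n)} (hU : RelOpen U (bdry n)) {p : Amb n}
    (hp : p ∈ U ∩ corner n) : ∃ᶠ q in 𝓝 p, q ∈ U ∩ faceE n ∧ q ∉ facePsi n := by
  refine ((frequently_pos_snd hp.2.1.1).and_eventually (hU.eventually hp.1)).mono ?_
  rintro q ⟨⟨h1, h2, h3⟩, h4⟩
  have hq : q ∈ faceE n := ⟨h1, by rw [h3]; exact hp.2.1.2⟩
  exact ⟨⟨h4 (.inl hq), hq⟩, fun h => h2.ne' h.2⟩

theorem frequently_facePsi {U : Set (Amb n)} (hU : RelOpen U (bdry n)) {p : Amb n}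
    (hp : p ∈ U ∩ corner n) : ∃ᶠ q in 𝓝 p, q ∈ U ∩ facePsi n ∧ q ∉ faceE n := by
  refine ((frequently_pos_fst hp.2.1.1).and_eventually (hU.eventually hp.1)).mono ?_
  rintro q ⟨⟨h1, h2, h3⟩, h4⟩
  have hq : q ∈ facePsi n := ⟨h1, by rw [h3]; exact hp.2.2.2⟩
  exact ⟨⟨h4 (.inr hq), hq⟩, fun h => h2.ne' h.2⟩

/-- A boundary defining function is itself, up to sign of the order, a section of one of the
bundles. That its pull-back is smooth on both faces is the matching condition at the corner, and it
produces the extended radial factors. -/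
theorem exists_isRadial {χ : PartialEquiv (Amb n) (Amb n)} (hχ : IsBdryDiffeo χ)
    {ge gp : Amb n → ℝ} (hge : IsContactE χ ge) (hgp : IsContactPsi χ gp)
    (hP : PreservesPoisson χ ge gp) : ∃ φ ψ, IsRadial χ ge gp φ ψ := by
  have h1s : SmoothBdry χ.target (fun _ => (1 : ℝ)) :=
    ⟨.of_contDiff contDiff_const, .of_contDiff contDiff_const⟩
  have hgeE : ∀ z ∈ coneE χ.source, 0 < ge (ptE z) := fun z hz => hge.2.1 _ ⟨hz.2,
    ptE_mem_faceE hz.1, fun h => ptE_notMem_facePsi z h.2⟩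
  have hgpP : ∀ z ∈ conePsi χ.source, 0 < gp (ptPsi z) := fun z hz => hgp.2.1 _ ⟨hz.2,
    ptPsi_mem_facePsi hz.1, fun h => ptPsi_notMem_faceE z h.1⟩
  have hT : ∀ z ∈ coneE χ.source, ‖compT χ z‖ = 1 := fun z hz =>
    nrm_fst_of_zero (hχ.map_mem_dbl hz.2).1 ((hχ.map_fst_eq_zero hz.2).2 rfl)
  have hG : ∀ z ∈ conePsi χ.source, ‖compG χ z‖ = 1 := fun z hz =>
    nrm_fst_of_zero (hχ.map_mem_dbl hz.2).2 ((hχ.map_snd_eq_zero hz.2).2 rfl)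
  have hY : ∀ z ∈ conePsi χ.source, jb (compY χ z) = (χ (ptPsi z)).1.2⁻¹ := fun z hz =>
    jb_Rinv (hχ.map_mem_dbl hz.2).1 (hχ.map_fst_pos hz.2 (R_snd_pos _))
  have hH : ∀ z ∈ coneE χ.source, jb (compH χ z) = (χ (ptE z)).2.2⁻¹ := fun z hz =>
    jb_Rinv (hχ.map_mem_dbl hz.2).2 (hχ.map_snd_pos hz.2 (R_snd_pos _))
  -- The constant function `1` with orders `(±1, 0)` and `(0, ±1)`. On its own open face, `φ` is the
  -- radial factor `1/g_e`, while `φ'` is `g_e` and serves only to show that `φ` does not vanish at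
  -- the corner; likewise `ψ` and `ψ'`.
  obtain ⟨φ, hφs, hφE, hφP⟩ := hP.1 1 0 _ h1s
  obtain ⟨φ', hφ's, hφ'E, -⟩ := hP.1 (-1) 0 _ h1s
  obtain ⟨ψ, hψs, hψE, hψP⟩ := hP.1 0 1 _ h1s
  obtain ⟨ψ', hψ's, -, hψ'P⟩ := hP.1 0 (-1) _ h1s
  have eφE : ∀ z ∈ coneE χ.source, φ (ptE z) = (ge (ptE z))⁻¹ := fun z hz => by
    have := hφE hz
    have hx := norm_pos_iff.2 hz.1
    simp only [symbE, Function.comp, liftE, Real.rpow_one, Real.rpow_zero, mul_one, norm_smul,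
      hT z hz, norm_mul, norm_inv, abs_norm, Real.norm_eq_abs, abs_of_pos (hgeE z hz)] at this
    exact mul_left_cancel₀ hx.ne' this
  have eφ'E : ∀ z ∈ coneE χ.source, φ' (ptE z) = ge (ptE z) := fun z hz => by
    have := hφ'E hz
    have hx := norm_pos_iff.2 hz.1
    simp only [symbE, Function.comp, liftE, Real.rpow_neg_one, Real.rpow_zero, mul_one, norm_smul,
      hT z hz, norm_mul, norm_inv, abs_norm, Real.norm_eq_abs, abs_of_pos (hgeE z hz), mul_inv,
      inv_inv] at this
    exact mul_left_cancel₀ (inv_ne_zero hx.ne') this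
  have eψP : ∀ z ∈ conePsi χ.source, ψ (ptPsi z) = (gp (ptPsi z))⁻¹ := fun z hz => by
    have := hψP hz
    have hx := norm_pos_iff.2 hz.1
    simp only [symbPsi, Function.comp, liftPsi, Real.rpow_one, Real.rpow_zero, mul_one, one_mul,
      norm_smul, hG z hz, norm_mul, norm_inv, abs_norm, Real.norm_eq_abs,
      abs_of_pos (hgpP z hz)] at this
    exact mul_left_cancel₀ hx.ne' this
  have eψ'P : ∀ z ∈ conePsi χ.source, ψ' (ptPsi z) = gp (ptPsi z) := fun z hz => by
    have := hψ'P hz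
    have hx := norm_pos_iff.2 hz.1
    simp only [symbPsi, Function.comp, liftPsi, Real.rpow_neg_one, Real.rpow_zero, mul_one, one_mul,
      norm_smul, hG z hz, norm_mul, norm_inv, abs_norm, Real.norm_eq_abs,
      abs_of_pos (hgpP z hz), mul_inv, inv_inv] at this
    exact mul_left_cancel₀ (inv_ne_zero hx.ne') this
  -- On the other face the same section is `⟨x⟩` and pulls back to `⟨Y⟩`, the inverse of a height.
  -- This gives the sign of `φ` there as well as the relation between heights.
  have eφP : ∀ z ∈ conePsi χ.source, jb z.1 * φ (ptPsi z) = (χ (ptPsi z)).1.2⁻¹ := fun z hz => by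
    have := hφP hz
    simpa only [symbPsi, Function.comp, liftPsi, Real.rpow_one, Real.rpow_zero, mul_one,
      hY z hz] using this
  have eψE : ∀ z ∈ coneE χ.source, jb z.2 * ψ (ptE z) = (χ (ptE z)).2.2⁻¹ := fun z hz => by
    have := hψE hz
    simpa only [symbE, Function.comp, liftE, Real.rpow_one, Real.rpow_zero, mul_one, one_mul,
      hH z hz] using this
  have pφP : ∀ z ∈ conePsi χ.source, 0 < φ (ptPsi z) := fun z hz => by
    have h1 := eφP z hz
    have h2 := inv_pos.2 (hχ.map_fst_pos hz.2 (R_snd_pos _))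
    rw [← h1] at h2
    exact pos_of_mul_pos_right h2 (jb_pos _).le
  have pψE : ∀ z ∈ coneE χ.source, 0 < ψ (ptE z) := fun z hz => by
    have h1 := eψE z hz
    have h2 := inv_pos.2 (hχ.map_snd_pos hz.2 (R_snd_pos _))
    rw [← h1] at h2
    exact pos_of_mul_pos_right h2 (jb_pos _).le
  refine ⟨φ, ψ, hφs, hψs, fun p hp => ?_, fun p hp => ?_, fun p hp => ?_, fun p hp => ?_,
    fun z hz => (eφE z hz).symm, fun z hz => (eψP z hz).symm⟩
  · by_cases hE : p ∈ faceE n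
    · by_cases hPsi : p ∈ facePsi n
      · refine pos_of_mul_eq_one_near (hφs.1.continuousOn p ⟨hp, hE⟩)
          (hφ's.1.continuousOn p ⟨hp, hE⟩) ?_
        refine (frequently_faceE hχ.source_open ⟨hp, hE, hPsi⟩).mono ?_
        rintro q ⟨hq, hqP⟩
        obtain ⟨z, hz, -, rfl⟩ := exists_ptE hq.2 hqP
        have hz' : z ∈ coneE χ.source := ⟨hz, hq.1⟩
        have := hgeE z hz'
        refine ⟨hq, ?_, ?_⟩
        · rw [eφE z hz']; exact inv_pos.2 this
        · rw [eφE z hz', eφ'E z hz', inv_mul_cancel₀ this.ne']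
      · obtain ⟨z, hz, -, rfl⟩ := exists_ptE hE hPsi
        rw [eφE z ⟨hz, hp⟩]
        exact inv_pos.2 (hgeE z ⟨hz, hp⟩)
    · obtain ⟨z, hz, -, rfl⟩ := exists_ptPsi ((hχ.source_open.subset hp).resolve_left hE) hE
      exact pφP z ⟨hz, hp⟩
  · by_cases hPsi : p ∈ facePsi n
    · by_cases hE : p ∈ faceE n
      · refine pos_of_mul_eq_one_near (hψs.2.continuousOn p ⟨hp, hPsi⟩)
          (hψ's.2.continuousOn p ⟨hp, hPsi⟩) ?_
        refine (frequently_facePsi hχ.source_open ⟨hp, hE, hPsi⟩).mono ?_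
        rintro q ⟨hq, hqP⟩
        obtain ⟨z, hz, -, rfl⟩ := exists_ptPsi hq.2 hqP
        have hz' : z ∈ conePsi χ.source := ⟨hz, hq.1⟩
        have := hgpP z hz'
        refine ⟨hq, ?_, ?_⟩
        · rw [eψP z hz']; exact inv_pos.2 this
        · rw [eψP z hz', eψ'P z hz', inv_mul_cancel₀ this.ne']
      · obtain ⟨z, hz, -, rfl⟩ := exists_ptPsi hPsi hE
        rw [eψP z ⟨hz, hp⟩]
        exact inv_pos.2 (hgpP z ⟨hz, hp⟩)
    · obtain ⟨z, hz, -, rfl⟩ := exists_ptE ((hχ.source_open.subset hp).resolve_right hPsi) hPsi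
      exact pψE z ⟨hz, hp⟩
  · by_cases hE : p ∈ faceE n
    · rw [hE.2, (hχ.map_fst_eq_zero hp).2 hE.2, mul_zero]
    · obtain ⟨z, hz, -, rfl⟩ := exists_ptPsi ((hχ.source_open.subset hp).resolve_left hE) hE
      have h1 := eφP z ⟨hz, hp⟩
      have h2 := (hχ.map_fst_pos hp (R_snd_pos _)).ne'
      have h3 := (jb_pos z.1).ne'
      change (jb z.1)⁻¹ = _
      field_simp at h1 ⊢
      linarith
  · by_cases hPsi : p ∈ facePsi n
    · rw [hPsi.2, (hχ.map_snd_eq_zero hp).2 hPsi.2, mul_zero]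
    · obtain ⟨z, hz, -, rfl⟩ := exists_ptE ((hχ.source_open.subset hp).resolve_right hPsi) hPsi
      have h1 := eψE z ⟨hz, hp⟩
      have h2 := (hχ.map_snd_pos hp (R_snd_pos _)).ne'
      have h3 := (jb_pos z.2).ne'
      change (jb z.2)⁻¹ = _
      field_simp at h1 ⊢
      linarith

/-! ## The lifts as slices of a single homogeneous map -/

/-- The slice at height `(s, u)` of the homogeneous map with components `y`, `h`. -/
def slice (y h : Amb n → Euc n) (s u : ℝ) (z : Phase n) : Phase n :=
  (hext 1 0 y (emb s u z), hext 0 1 h (emb s u z))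

/-- The rescaled first component of `χ`. -/
def scaledFst (χ : Amb n → Amb n) (φ : Amb n → ℝ) (p : Amb n) : Euc n := φ p • (χ p).1.1

/-- The rescaled second component of `χ`. -/
def scaledSnd (χ : Amb n → Amb n) (ψ : Amb n → ℝ) (p : Amb n) : Euc n := ψ p • (χ p).2.1

theorem slice_int (y h : Amb n → Euc n) (z : Phase n) :
    slice y h 1 1 z = (jb z.1 • y (ptInt z), jb z.2 • h (ptInt z)) := by
  simp [slice, hext, ptInt_eq, emb, jb_eq]

theorem slice_E (y h : Amb n → Euc n) (z : Phase n) :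
    slice y h 0 1 z = (‖z.1‖ • y (ptE z), jb z.2 • h (ptE z)) := by
  simp [slice, hext, ptE_eq, emb, jb_eq, norm_eq_nrm]

theorem slice_Psi (y h : Amb n → Euc n) (z : Phase n) :
    slice y h 1 0 z = (jb z.1 • y (ptPsi z), ‖z.2‖ • h (ptPsi z)) := by
  simp [slice, hext, ptPsi_eq, emb, jb_eq, norm_eq_nrm]

theorem slice_corner (y h : Amb n → Euc n) (z : Phase n) :
    slice y h 0 0 z = (‖z.1‖ • y (ptCorner z), ‖z.2‖ • h (ptCorner z)) := by
  simp [slice, hext, ptCorner_eq, emb, norm_eq_nrm]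

section Radial

variable {χ : PartialEquiv (Amb n) (Amb n)} {ge gp φ ψ : Amb n → ℝ}

/-- By definition `Y` is a component of `χ` divided by a height that vanishes towards the corner.
The relation between heights replaces this reciprocal by `⟨x⟩ φ`, whose second factor is smooth up
to the corner. -/
theorem IsRadial.compY_eq (h : IsRadial χ ge gp φ ψ) {z : Phase n} (hz : z ∈ conePsi χ.source) :
    compY χ z = jb z.1 • scaledFst χ φ (ptPsi z) := by
  have h1 : (jb z.1)⁻¹ = φ (ptPsi z) * (χ (ptPsi z)).1.2 := h.eq_fst _ hz.2
  have h2 := h.pos_fst _ hz.2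
  have h3 := jb_pos z.1
  have h4 : (χ (ptPsi z)).1.2⁻¹ = jb z.1 * φ (ptPsi z) := by
    have h5 : (χ (ptPsi z)).1.2 = (jb z.1 * φ (ptPsi z))⁻¹ := by
      rw [mul_inv, h1]; field_simp
    rw [h5, inv_inv]
  rw [compY, Rinv, scaledFst, smul_smul, h4]

theorem IsRadial.compH_eq (h : IsRadial χ ge gp φ ψ) {z : Phase n} (hz : z ∈ coneE χ.source) :
    compH χ z = jb z.2 • scaledSnd χ ψ (ptE z) := by
  have h1 : (jb z.2)⁻¹ = ψ (ptE z) * (χ (ptE z)).2.2 := h.eq_snd _ hz.2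
  have h2 := h.pos_snd _ hz.2
  have h3 := jb_pos z.2
  have h4 : (χ (ptE z)).2.2⁻¹ = jb z.2 * ψ (ptE z) := by
    have h5 : (χ (ptE z)).2.2 = (jb z.2 * ψ (ptE z))⁻¹ := by
      rw [mul_inv, h1]; field_simp
    rw [h5, inv_inv]
  rw [compH, Rinv, scaledSnd, smul_smul, h4]

/-- The same pair `scaledFst`, `scaledSnd` serves for all three lifts; only the slice changes. -/
theorem IsRadial.liftE_eq (h : IsRadial χ ge gp φ ψ) :
    EqOn (liftE χ φ) (slice (scaledFst χ φ) (scaledSnd χ ψ) 0 1) (coneE χ.source) := by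
  intro z hz
  rw [slice_E, liftE, h.compH_eq hz, mul_smul]; rfl

theorem IsRadial.liftPsi_eq (h : IsRadial χ ge gp φ ψ) :
    EqOn (liftPsi χ ψ) (slice (scaledFst χ φ) (scaledSnd χ ψ) 1 0) (conePsi χ.source) := by
  intro z hz
  rw [slice_Psi, liftPsi, h.compY_eq hz, mul_smul]; rfl

theorem liftCorner_eq (χ : Amb n → Amb n) (φ ψ : Amb n → ℝ) :
    liftCorner χ φ ψ = slice (scaledFst χ φ) (scaledSnd χ ψ) 0 0 := by
  funext z
  rw [slice_corner, liftCorner, mul_smul, mul_smul]; rfl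

theorem IsRadial.smooth_scaledFst (h : IsRadial χ ge gp φ ψ) (hχ : IsBdryDiffeo χ) :
    SmoothOn (scaledFst χ φ) (χ.source ∩ faceE n) ∧
      SmoothOn (scaledFst χ φ) (χ.source ∩ facePsi n) := by
  have h1 : SmoothOn (fun p : Amb n => p.1.1) univ := .of_contDiff contDiff_fst.fst
  exact ⟨h.smooth_fst.1.smul (h1.comp hχ.smoothE (mapsTo_univ _ _)),
    h.smooth_fst.2.smul (h1.comp hχ.smoothPsi (mapsTo_univ _ _))⟩

theorem IsRadial.smooth_scaledSnd (h : IsRadial χ ge gp φ ψ) (hχ : IsBdryDiffeo χ) :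
    SmoothOn (scaledSnd χ ψ) (χ.source ∩ faceE n) ∧
      SmoothOn (scaledSnd χ ψ) (χ.source ∩ facePsi n) := by
  have h1 : SmoothOn (fun p : Amb n => p.2.1) univ := .of_contDiff contDiff_snd.fst
  exact ⟨h.smooth_snd.1.smul (h1.comp hχ.smoothE (mapsTo_univ _ _)),
    h.smooth_snd.2.smul (h1.comp hχ.smoothPsi (mapsTo_univ _ _))⟩

end Radial

end

end ScGeom

namespace ScGeom

noncomputable section

variable {n : ℕ}

/-! ## Linear symplectic algebra -/

/-- A linear map which preserves the symplectic form. -/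
def IsSympl (L : Phase n →L[ℝ] Phase n) : Prop := ∀ a b, omega (L a) (L b) = omega a b

/-- The coordinate functionals on phase space. -/
def coordL : Fin n ⊕ Fin n → (Phase n →L[ℝ] ℝ)
  | .inl i => (EuclideanSpace.proj i).comp (.fst ℝ (Euc n) (Euc n))
  | .inr i => (EuclideanSpace.proj i).comp (.snd ℝ (Euc n) (Euc n))

/-- The Poisson bivector on linear functionals. -/
def pb (α β : Phase n →L[ℝ] ℝ) : ℝ :=
  ∑ j : Fin n, (α (0, EuclideanSpace.single j 1) * β (EuclideanSpace.single j 1, 0)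
    - α (EuclideanSpace.single j 1, 0) * β (0, EuclideanSpace.single j 1))

theorem poisson_eq_pb (f g : Phase n → ℝ) (z : Phase n) :
    poisson f g z = pb (fderiv ℝ f z) (fderiv ℝ g z) := rfl

theorem pb_sum_left {ι : Type*} (s : Finset ι) (c : ι → ℝ) (α : ι → Phase n →L[ℝ] ℝ)
    (β : Phase n →L[ℝ] ℝ) : pb (∑ i ∈ s, c i • α i) β = ∑ i ∈ s, c i * pb (α i) β := by
  simp only [pb, sum_apply, smul_apply, smul_eq_mul,
    Finset.sum_mul, Finset.mul_sum, ← Finset.sum_sub_distrib]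
  rw [Finset.sum_comm]
  refine Finset.sum_congr rfl fun i _ => Finset.sum_congr rfl fun j _ => by ring

/-- The components of `ω(w, ·)` in the coordinate functionals. -/
def omegaCoeff (w : Phase n) : Fin n ⊕ Fin n → ℝ
  | .inl i => w.2 i
  | .inr i => -w.1 i

theorem omega_eq_sum (w v : Phase n) :
    omega w v = (∑ a, omegaCoeff w a • coordL a) v := by
  simp [omega, omegaCoeff, coordL, PiLp.inner_apply, mul_comm, sub_eq_add_neg]

theorem euc_eq_sum (x : Euc n) : x = ∑ j, x j • EuclideanSpace.single j (1 : ℝ) := by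
  ext i
  simp [Finset.sum_apply, Pi.single_apply]

theorem phase_eq_sum (u : Phase n) : u = ∑ j : Fin n,
    (u.1 j • ((EuclideanSpace.single j (1 : ℝ), 0) : Phase n) +
      u.2 j • ((0, EuclideanSpace.single j (1 : ℝ)) : Phase n)) := by
  refine Prod.ext ?_ ?_
  · simp only [Prod.fst_sum, Prod.fst_add, Prod.smul_fst, smul_zero, add_zero]
    exact euc_eq_sum u.1
  · simp only [Prod.snd_sum, Prod.snd_add, Prod.smul_snd, smul_zero, zero_add]
    exact euc_eq_sum u.2

theorem omega_single_snd (w : Phase n) (j : Fin n) :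
    omega w (0, EuclideanSpace.single j 1) = -w.1 j := by
  simp [omega, EuclideanSpace.inner_single_left]

theorem omega_single_fst (w : Phase n) (j : Fin n) :
    omega w (EuclideanSpace.single j 1, 0) = w.2 j := by
  simp [omega, EuclideanSpace.inner_single_right]

/-- A linear map which preserves the Poisson bivector is symplectic. -/
theorem isSympl_of_pb (L : Phase n →L[ℝ] Phase n)
    (h : ∀ a b, pb ((coordL a).comp L) ((coordL b).comp L) = pb (coordL a) (coordL b)) :
    IsSympl L := by
  set α : Phase n → Phase n →L[ℝ] ℝ := fun w => ∑ a, omegaCoeff w a • coordL a with hα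
  have hom : ∀ w v, omega w v = α w v := omega_eq_sum
  have hpb : ∀ (w : Phase n) (β : Phase n →L[ℝ] ℝ), pb (α w) β = -β w := fun w β => by
    conv_rhs => rw [phase_eq_sum w]
    simp only [pb, ← hom, omega_single_snd, omega_single_fst, map_sum, map_add, map_smul,
      smul_eq_mul, ← Finset.sum_neg_distrib]
    exact Finset.sum_congr rfl fun j _ => by ring
  have hL : ∀ w b, pb ((α w).comp L) ((coordL b).comp L) = pb (α w) (coordL b) := fun w b => by
    have : (α w).comp L = ∑ a, omegaCoeff w a • (coordL a).comp L := by
      ext v <;> simp [hα]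
    rw [this, hα]
    simp only [pb_sum_left, h]
  -- The adjoint of `L` with respect to `ω`; its components are read off by pairing with the basis
  -- vectors.
  have hdag : ∀ w, ∃ w', ∀ v, omega w' v = omega w (L v) := fun w => by
    refine ⟨(WithLp.toLp 2 fun j => -omega w (L (0, EuclideanSpace.single j 1)),
      WithLp.toLp 2 fun j => omega w (L (EuclideanSpace.single j 1, 0))), fun v => ?_⟩
    have hs : ∀ β : Phase n →L[ℝ] ℝ, β v = ∑ j : Fin n,
        (v.1 j * β (EuclideanSpace.single j 1, 0) + v.2 j * β (0, EuclideanSpace.single j 1)) :=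
      fun β => by
        conv_lhs => rw [phase_eq_sum v]
        simp only [map_sum, map_add, map_smul, smul_eq_mul]
    have h1 := hs ((α w).comp L)
    simp only [ContinuousLinearMap.comp_apply, ← hom] at h1
    rw [h1, hom, hs]
    simp only [← hom, omega_single_snd, omega_single_fst, neg_neg]
  choose dag hdag using hdag
  -- Preservation of the bivector says that the adjoint is a right inverse of `L`: since `pb (α w) β
  -- = -β w`, bracketing `α (dag w) = α w ∘ L` with `coordL b ∘ L` gives the coordinates of `L (dag
  -- w)` on one side and those of `w` on the other. In finite dimension a right inverse is a left
  -- inverse, which is preservation of `ω`.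
  have hLdag : ∀ w, L (dag w) = w := fun w => by
    have h1 : ∀ b, coordL b (L (dag w)) = coordL b w := fun b => by
      have h2 : α (dag w) = (α w).comp L := by
        ext v <;> simp [← hom, hdag]
      have h3 := hL w b
      rw [← h2, hpb, hpb] at h3
      simpa using h3
    refine Prod.ext ?_ ?_
    · ext i; exact h1 (.inl i)
    · ext i; exact h1 (.inr i)
  have hinj : Function.Injective L :=
    (LinearMap.injective_iff_surjective (f := (L : Phase n →ₗ[ℝ] Phase n))).2 fun w => ⟨dag w, hLdag w⟩
  intro a b
  rw [← hdag, hinj (hLdag (L a))]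

theorem IsSympl.injective {L : Phase n →L[ℝ] Phase n} (h : IsSympl L) {a : Phase n}
    (ha : L a = 0) : a = 0 := by
  have h1 : ∀ b, omega a b = 0 := fun b => by rw [← h a b, ha]; simp [omega]
  refine Prod.ext ?_ ?_
  · ext j
    have := h1 (0, EuclideanSpace.single j 1)
    rw [omega_single_snd] at this
    simpa using this
  · ext j
    have := h1 (EuclideanSpace.single j 1, 0)
    rw [omega_single_fst] at this
    simpa using this

theorem isSympl_of_poisson {C : Phase n → Phase n} {z : Phase n} (hC : DifferentiableAt ℝ C z)
    (h : ∀ a b, poisson (coordL a ∘ C) (coordL b ∘ C) z = poisson (coordL a) (coordL b) (C z)) :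
    IsSympl (fderiv ℝ C z) := by
  refine isSympl_of_pb _ fun a b => ?_
  have h1 : ∀ a, fderiv ℝ (coordL a ∘ C) z = (coordL a).comp (fderiv ℝ C z) := fun a =>
    ((coordL a).hasFDerivAt.comp z hC.hasFDerivAt).fderiv
  have := h a b
  simp only [poisson_eq_pb, h1, ContinuousLinearMap.fderiv] at this
  exact this

/-- The dilation `(x, ξ) ↦ (a x, b ξ)`. -/
def dil (a b : ℝ) : Phase n →L[ℝ] Phase n :=
  (a • ContinuousLinearMap.fst ℝ (Euc n) (Euc n)).prod
    (b • ContinuousLinearMap.snd ℝ (Euc n) (Euc n))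

theorem dil_apply (a b : ℝ) (z : Phase n) : dil a b z = (a • z.1, b • z.2) := rfl

theorem omega_dil (a b : ℝ) (u v : Phase n) : omega (dil a b u) (dil a b v) = a * b * omega u v := by
  simp only [omega, dil_apply, real_inner_smul_left, real_inner_smul_right]; ring

theorem dil_inv_dil {a b : ℝ} (ha : a ≠ 0) (hb : b ≠ 0) (z : Phase n) :
    dil a⁻¹ b⁻¹ (dil a b z) = z := by
  simp [dil_apply, smul_smul, ha, hb]

/-- The dilation multiplies `ω` by `a * b` and its inverse divides by it, so the conjugation leaves
the condition unchanged. -/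
theorem isSympl_conj_dil {a b : ℝ} (ha : a ≠ 0) (hb : b ≠ 0) {L : Phase n →L[ℝ] Phase n} :
    IsSympl ((dil a b).comp (L.comp (dil a⁻¹ b⁻¹))) ↔ IsSympl L := by
  have h0 : a * b * (a⁻¹ * b⁻¹) = 1 := by field_simp
  constructor
  · intro h u v
    have := h (dil a b u) (dil a b v)
    simp only [ContinuousLinearMap.comp_apply, dil_inv_dil ha hb, omega_dil] at this
    exact mul_left_cancel₀ (mul_ne_zero ha hb) this
  · intro h u v
    simp only [ContinuousLinearMap.comp_apply, omega_dil, h _ _]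
    rw [← mul_assoc, h0, one_mul]

/-! ## The derivative of the homogeneous map -/

/-- The homogeneous map with components `y`, `h`. -/
def hpair (y h : Amb n → Euc n) (p : Amb n) : Phase n := (hext 1 0 y p, hext 0 1 h p)

/-- The part of the derivative of the homogeneous map in the directions of phase space. -/
def hpairD (y h : Amb n → Euc n) (p : Amb n) : Phase n →L[ℝ] Phase n :=
  (fderiv ℝ (hpair y h) p).comp (scaleL 1 1)

theorem contDiffAt_hpair {y h : Amb n → Euc n} (hy : ContDiff ℝ ∞ y) (hh : ContDiff ℝ ∞ h)
    {p : Amb n} (hp : p.1 ≠ 0) (hp' : p.2 ≠ 0) : ContDiffAt ℝ ∞ (hpair y h) p :=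
  (contDiffAt_hext 1 0 hy hp hp').prodMk (contDiffAt_hext 0 1 hh hp hp')

theorem hpair_smul (y h : Amb n → Euc n) {a b : ℝ} (ha : 0 < a) (hb : 0 < b) (p : Amb n) :
    hpair y h (a • p.1, b • p.2) = dil a b (hpair y h p) := by
  simp [hpair, hext_smul _ _ _ ha hb, dil_apply]

theorem slice_eq_dil (y h : Amb n → Euc n) {a b : ℝ} (ha : 0 < a) (hb : 0 < b) (s u : ℝ)
    (z : Phase n) : slice y h s u z =
      dil a b (hpair y h (scaleL 1 1 (dil a⁻¹ b⁻¹ z) + ((0, a⁻¹ * s), (0, b⁻¹ * u)))) := by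
  rw [← hpair_smul y h ha hb]
  have : (a • (scaleL 1 1 (dil a⁻¹ b⁻¹ z) + (((0, a⁻¹ * s), (0, b⁻¹ * u)) : Amb n)).1,
      b • (scaleL 1 1 (dil a⁻¹ b⁻¹ z) + (((0, a⁻¹ * s), (0, b⁻¹ * u)) : Amb n)).2) =
      emb s u z := by
    simp [scaleL_apply, dil_apply, emb, smul_smul, ha.ne', hb.ne']
  rw [this]; rfl

/-- By homogeneity the derivative of a slice at `z` is that of the homogeneous map at the normalised
point, conjugated by the dilation with the norms at `z`. Slices of different heights can thus be
compared on the product of spheres. -/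
theorem hasFDerivAt_slice {y h : Amb n → Euc n} (hy : ContDiff ℝ ∞ y) (hh : ContDiff ℝ ∞ h)
    {s u : ℝ} {z : Phase n} (h1 : (emb s u z).1 ≠ 0) (h2 : (emb s u z).2 ≠ 0) :
    HasFDerivAt (slice y h s u)
      ((dil (nrm (emb s u z).1) (nrm (emb s u z).2)).comp ((hpairD y h (nu2 (emb s u z))).comp
        (dil (nrm (emb s u z).1)⁻¹ (nrm (emb s u z).2)⁻¹))) z := by
  have ha := nrm_pos h1
  have hb := nrm_pos h2
  set a := nrm (emb s u z).1 with ha'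
  set b := nrm (emb s u z).2 with hb'
  set q : Amb n := ((0, a⁻¹ * s), (0, b⁻¹ * u)) with hq
  have hz : scaleL 1 1 (dil a⁻¹ b⁻¹ z) + q = nu2 (emb s u z) := by
    simp only [scaleL_apply, dil_apply, one_smul, hq, nu2, nu, ← ha', ← hb']
    simp [emb]
  have hne : (nu2 (emb s u z)).1 ≠ 0 ∧ (nu2 (emb s u z)).2 ≠ 0 :=
    ⟨smul_ne_zero (inv_ne_zero ha.ne') h1, smul_ne_zero (inv_ne_zero hb.ne') h2⟩
  have hd : HasFDerivAt (hpair y h) (fderiv ℝ (hpair y h) (nu2 (emb s u z)))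
      (scaleL 1 1 (dil a⁻¹ b⁻¹ z) + q) := by
    rw [hz]
    exact ((contDiffAt_hpair hy hh hne.1 hne.2).differentiableAt (by simp)).hasFDerivAt
  have hin : HasFDerivAt (fun z : Phase n => scaleL 1 1 (dil a⁻¹ b⁻¹ z) + q)
      ((scaleL 1 1).comp (dil a⁻¹ b⁻¹)) z :=
    ((scaleL 1 1).comp (dil a⁻¹ b⁻¹)).hasFDerivAt.add_const q
  have := (dil a b).hasFDerivAt.comp z (hd.comp z hin)
  refine this.congr_of_eventuallyEq (Eventually.of_forall fun w => ?_)
  exact slice_eq_dil y h ha hb s u w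

theorem isSympl_slice_iff {y h : Amb n → Euc n} (hy : ContDiff ℝ ∞ y) (hh : ContDiff ℝ ∞ h)
    {s u : ℝ} {z : Phase n} (h1 : (emb s u z).1 ≠ 0) (h2 : (emb s u z).2 ≠ 0) :
    IsSympl (fderiv ℝ (slice y h s u) z) ↔ IsSympl (hpairD y h (nu2 (emb s u z))) := by
  rw [(hasFDerivAt_slice hy hh h1 h2).fderiv]
  exact isSympl_conj_dil (nrm_pos h1).ne' (nrm_pos h2).ne'

theorem continuous_omega : Continuous fun p : Phase n × Phase n => omega p.1 p.2 := by
  unfold omega; fun_prop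

/-- The derivative is continuous in the base point and the condition is an identity, hence closed.
-/
theorem isSympl_hpairD_of_frequently {y h : Amb n → Euc n} (hy : ContDiff ℝ ∞ y)
    (hh : ContDiff ℝ ∞ h) {p : Amb n} (h1 : p.1 ≠ 0) (h2 : p.2 ≠ 0)
    (hf : ∃ᶠ q in 𝓝 p, IsSympl (hpairD y h q)) : IsSympl (hpairD y h p) := by
  intro a b
  have hc : ContinuousAt (fderiv ℝ (hpair y h)) p :=
    ((contDiffAt_hpair hy hh h1 h2).fderiv_right (m := 0) (by simp)).continuousAt
  have hc' : ∀ a, ContinuousAt (fun q => hpairD y h q a) p := fun a =>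
    (hc.clm_apply continuousAt_const : ContinuousAt (fun q => fderiv ℝ (hpair y h) q (scaleL 1 1 a)) p)
  refine eq_of_frequently_eq (S := univ) (f := fun q => omega (hpairD y h q a) (hpairD y h q b))
    (g := fun _ => omega a b) ?_ continuousWithinAt_const
    (hf.mono fun q hq => ⟨mem_univ _, hq a b⟩)
  exact (continuous_omega.continuousAt.comp ((hc' a).prodMk (hc' b))).continuousWithinAt

/-! ## The lifts are symplectic -/

section Lifts

variable {χ : PartialEquiv (Amb n) (Amb n)} {ge gp φ ψ : Amb n → ℝ}

theorem slice_eventuallyEq {y y' h h' : Amb n → Euc n} {S : Set (Amb n)} {s u : ℝ}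
    {z : Phase n} (h1 : (emb s u z).1 ≠ 0) (h2 : (emb s u z).2 ≠ 0)
    (hS : ∀ᶠ w in 𝓝 z, nu2 (emb s u w) ∈ S)
    (hy : ∀ᶠ q in 𝓝 (nu2 (emb s u z)), q ∈ S → y q = y' q)
    (hh : ∀ᶠ q in 𝓝 (nu2 (emb s u z)), q ∈ S → h q = h' q) :
    slice y h s u =ᶠ[𝓝 z] slice y' h' s u := by
  filter_upwards [hext_emb_eventuallyEq h1 h2 hS hy 1 0, hext_emb_eventuallyEq h1 h2 hS hh 0 1]
    with w hw hw'
  exact Prod.ext hw hw'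

/-- The coordinate functions are sections of the bundles, so the hypothesis on Poisson brackets can
be applied to them. -/
theorem symbE_fst_coord (j : Fin n) : symbE 1 0 (fun p : Amb n => p.1.1 j) = coordL (.inl j) := by
  funext z
  by_cases h : z.1 = 0
  · simp [symbE, coordL, h]
  · have := norm_ne_zero_iff.2 h
    simp [symbE, coordL, ptE, dir, this]

theorem symbE_snd_coord (j : Fin n) : symbE 0 1 (fun p : Amb n => p.2.1 j) = coordL (.inr j) := by
  funext z
  simp [symbE, coordL, ptE, R, (jb_pos z.2).ne']

theorem symbPsi_fst_coord (j : Fin n) :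
    symbPsi 1 0 (fun p : Amb n => p.1.1 j) = coordL (.inl j) := by
  funext z
  simp [symbPsi, coordL, ptPsi, R, (jb_pos z.1).ne']

theorem symbPsi_snd_coord (j : Fin n) :
    symbPsi 0 1 (fun p : Amb n => p.2.1 j) = coordL (.inr j) := by
  funext z
  by_cases h : z.2 = 0
  · simp [symbPsi, coordL, h]
  · have := norm_ne_zero_iff.2 h
    simp [symbPsi, coordL, ptPsi, dir, this]

theorem smoothBdry_coord (S : Set (Amb n)) (j : Fin n) :
    SmoothBdry S (fun p : Amb n => p.1.1 j) ∧ SmoothBdry S (fun p : Amb n => p.2.1 j) := by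
  have h1 : ContDiff ℝ ∞ (fun p : Amb n => p.1.1 j) :=
    (EuclideanSpace.proj j : Euc n →L[ℝ] ℝ).contDiff.comp contDiff_fst.fst
  have h2 : ContDiff ℝ ∞ (fun p : Amb n => p.2.1 j) :=
    (EuclideanSpace.proj j : Euc n →L[ℝ] ℝ).contDiff.comp contDiff_snd.fst
  exact ⟨⟨.of_contDiff h1, .of_contDiff h1⟩, .of_contDiff h2, .of_contDiff h2⟩

theorem IsRadial.contDiffOn_liftE (h : IsRadial χ ge gp φ ψ) (hχ : IsBdryDiffeo χ) :
    ContDiffOn ℝ ∞ (liftE χ φ) (coneE χ.source) :=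
  ((contDiffOn_hext_E hχ.source_open (h.smooth_scaledFst hχ).1 1 0).prodMk
    (contDiffOn_hext_E hχ.source_open (h.smooth_scaledSnd hχ).1 0 1)).congr h.liftE_eq

theorem IsRadial.contDiffOn_liftPsi (h : IsRadial χ ge gp φ ψ) (hχ : IsBdryDiffeo χ) :
    ContDiffOn ℝ ∞ (liftPsi χ ψ) (conePsi χ.source) :=
  ((contDiffOn_hext_Psi hχ.source_open (h.smooth_scaledFst hχ).2 1 0).prodMk
    (contDiffOn_hext_Psi hχ.source_open (h.smooth_scaledSnd hχ).2 0 1)).congr h.liftPsi_eq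

theorem IsRadial.contDiffOn_liftCorner (h : IsRadial χ ge gp φ ψ) (hχ : IsBdryDiffeo χ) :
    ContDiffOn ℝ ∞ (liftCorner χ φ ψ) (coneCorner χ.source) := by
  have hs : χ.source ∩ corner n ⊆ χ.source ∩ faceE n := fun p hp => ⟨hp.1, hp.2.1⟩
  rw [liftCorner_eq]
  exact (contDiffOn_hext_corner hχ.source_open ((h.smooth_scaledFst hχ).1.mono hs) 1 0).prodMk
    (contDiffOn_hext_corner hχ.source_open ((h.smooth_scaledSnd hχ).1.mono hs) 0 1)

/-- The hypothesis gives the brackets of all pairs of coordinates composed with the lift, and these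
determine the Poisson bivector. -/
theorem IsRadial.isSympl_liftE (h : IsRadial χ ge gp φ ψ) (hχ : IsBdryDiffeo χ)
    (hP : PreservesPoisson χ ge gp) {z : Phase n} (hz : z ∈ coneE χ.source) :
    IsSympl (fderiv ℝ (liftE χ φ) z) := by
  have hopen := (isOpen_coneE hχ.source_open).mem_nhds hz
  have heq : liftE χ (fun p => (ge p)⁻¹) =ᶠ[𝓝 z] liftE χ φ := by
    filter_upwards [hopen] with w hw
    simp only [liftE, h.eq_ge w hw]
  rw [← heq.fderiv_eq]
  refine isSympl_of_poisson ?_ fun a b => ?_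
  · exact (((h.contDiffOn_liftE hχ).contDiffAt hopen).congr_of_eventuallyEq heq).differentiableAt
      (by simp)
  · rcases a with i | i <;> rcases b with j | j
    · simpa only [symbE_fst_coord, symbE_snd_coord, Function.comp] using (hP.2 1 0 1 0 _ _ (smoothBdry_coord _ i).1 (smoothBdry_coord _ j).1).1 hz
    · simpa only [symbE_fst_coord, symbE_snd_coord, Function.comp] using (hP.2 1 0 0 1 _ _ (smoothBdry_coord _ i).1 (smoothBdry_coord _ j).2).1 hz
    · simpa only [symbE_fst_coord, symbE_snd_coord, Function.comp] using (hP.2 0 1 1 0 _ _ (smoothBdry_coord _ i).2 (smoothBdry_coord _ j).1).1 hz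
    · simpa only [symbE_fst_coord, symbE_snd_coord, Function.comp] using (hP.2 0 1 0 1 _ _ (smoothBdry_coord _ i).2 (smoothBdry_coord _ j).2).1 hz

theorem IsRadial.isSympl_liftPsi (h : IsRadial χ ge gp φ ψ) (hχ : IsBdryDiffeo χ)
    (hP : PreservesPoisson χ ge gp) {z : Phase n} (hz : z ∈ conePsi χ.source) :
    IsSympl (fderiv ℝ (liftPsi χ ψ) z) := by
  have hopen := (isOpen_conePsi hχ.source_open).mem_nhds hz
  have heq : liftPsi χ (fun p => (gp p)⁻¹) =ᶠ[𝓝 z] liftPsi χ ψ := by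
    filter_upwards [hopen] with w hw
    simp only [liftPsi, h.eq_gp w hw]
  rw [← heq.fderiv_eq]
  refine isSympl_of_poisson ?_ fun a b => ?_
  · exact (((h.contDiffOn_liftPsi hχ).contDiffAt hopen).congr_of_eventuallyEq heq).differentiableAt
      (by simp)
  · rcases a with i | i <;> rcases b with j | j
    · simpa only [symbPsi_fst_coord, symbPsi_snd_coord, Function.comp] using (hP.2 1 0 1 0 _ _ (smoothBdry_coord _ i).1 (smoothBdry_coord _ j).1).2 hz
    · simpa only [symbPsi_fst_coord, symbPsi_snd_coord, Function.comp] using (hP.2 1 0 0 1 _ _ (smoothBdry_coord _ i).1 (smoothBdry_coord _ j).2).2 hz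
    · simpa only [symbPsi_fst_coord, symbPsi_snd_coord, Function.comp] using (hP.2 0 1 1 0 _ _ (smoothBdry_coord _ i).2 (smoothBdry_coord _ j).1).2 hz
    · simpa only [symbPsi_fst_coord, symbPsi_snd_coord, Function.comp] using (hP.2 0 1 0 1 _ _ (smoothBdry_coord _ i).2 (smoothBdry_coord _ j).2).2 hz

/-- The homogeneous extension of the scaled components is symplectic along the boundary. -/
theorem IsRadial.isSympl_hpairD (h : IsRadial χ ge gp φ ψ) (hχ : IsBdryDiffeo χ)
    (hP : PreservesPoisson χ ge gp) {y k : Amb n → Euc n} (hy : ContDiff ℝ ∞ y)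
    (hk : ContDiff ℝ ∞ k) {p : Amb n} (hp : p ∈ χ.source)
    (hyp : ∀ᶠ q in 𝓝 p, q ∈ χ.source → scaledFst χ φ q = y q)
    (hkp : ∀ᶠ q in 𝓝 p, q ∈ χ.source → scaledSnd χ ψ q = k q) :
    IsSympl (hpairD y k p) := by
  -- Stated for an arbitrary point of the open e-face, because at a corner point it is applied to
  -- nearby points and followed by a limit.
  have hE : ∀ {p : Amb n}, p ∈ χ.source → p ∈ faceE n → p ∉ facePsi n →
      (∀ᶠ q in 𝓝 p, q ∈ χ.source → scaledFst χ φ q = y q) →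
      (∀ᶠ q in 𝓝 p, q ∈ χ.source → scaledSnd χ ψ q = k q) → IsSympl (hpairD y k p) := by
    intro p hp hpE hpP hyp hkp
    obtain ⟨z, hz, -, rfl⟩ := exists_ptE hpE hpP
    have hz' : z ∈ coneE χ.source := ⟨hz, hp⟩
    rw [ptE_eq] at hyp hkp ⊢
    rw [← isSympl_slice_iff hy hk (mk_zero_ne_zero hz) (mk_one_ne_zero _)]
    have h1 := slice_eventuallyEq (mk_zero_ne_zero hz) (mk_one_ne_zero _)
      ((eventually_ptE_mem hχ.source_open hz').mono fun w hw => hw.1) hyp hkp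
    have h2 : liftE χ φ =ᶠ[𝓝 z] slice (scaledFst χ φ) (scaledSnd χ ψ) 0 1 :=
      h.liftE_eq.eventuallyEq_of_mem ((isOpen_coneE hχ.source_open).mem_nhds hz')
    rw [← (h2.trans h1).fderiv_eq]
    exact h.isSympl_liftE hχ hP hz'
  by_cases hpE : p ∈ faceE n
  · by_cases hpP : p ∈ facePsi n
    · have hd := hχ.mem_dbl hp
      refine isSympl_hpairD_of_frequently hy hk (ne_zero_of_hemi hd.1) (ne_zero_of_hemi hd.2) ?_
      refine ((frequently_faceE hχ.source_open ⟨hp, hpE, hpP⟩).and_eventually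
        ((eventually_eventually_nhds.2 hyp).and (eventually_eventually_nhds.2 hkp))).mono ?_
      rintro q ⟨⟨hq, hqP⟩, h1, h2⟩
      exact hE hq.1 hq.2 hqP h1 h2
    · exact hE hp hpE hpP hyp hkp
  · obtain ⟨z, hz, -, rfl⟩ := exists_ptPsi ((hχ.source_open.subset hp).resolve_left hpE) hpE
    have hz' : z ∈ conePsi χ.source := ⟨hz, hp⟩
    rw [ptPsi_eq] at hyp hkp ⊢
    rw [← isSympl_slice_iff hy hk (mk_one_ne_zero _) (mk_zero_ne_zero hz)]
    have h1 := slice_eventuallyEq (mk_one_ne_zero _) (mk_zero_ne_zero hz)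
      ((eventually_ptPsi_mem hχ.source_open hz').mono fun w hw => hw.1) hyp hkp
    have h2 : liftPsi χ ψ =ᶠ[𝓝 z] slice (scaledFst χ φ) (scaledSnd χ ψ) 1 0 :=
      h.liftPsi_eq.eventuallyEq_of_mem ((isOpen_conePsi hχ.source_open).mem_nhds hz')
    rw [← (h2.trans h1).fderiv_eq]
    exact h.isSympl_liftPsi hχ hP hz'

/-- The hypothesis on brackets says nothing directly about the corner lift; it is the slice of
heights `(0, 0)`, and the homogeneous map is symplectic at the corner by continuity. -/
theorem IsRadial.isSympl_liftCorner (h : IsRadial χ ge gp φ ψ) (hχ : IsBdryDiffeo χ)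
    (hP : PreservesPoisson χ ge gp) {G : Amb n → Euc n × Euc n} (hG : SmoothOn G (fill χ.source))
    (hGχ : ∀ p ∈ χ.source, G p = (scaledFst χ φ p, scaledSnd χ ψ p))
    {z : Phase n} (hz : z ∈ coneCorner χ.source) :
    IsSympl (fderiv ℝ (liftCorner χ φ ψ) z) := by
  obtain ⟨F, hF, hGF⟩ := hG.exists_contDiff (.inl hz.2.2)
  have hy : ∀ᶠ q in 𝓝 (ptCorner z), q ∈ χ.source → scaledFst χ φ q = (F q).1 := by
    filter_upwards [hGF] with q hq hqU
    rw [← hq (.inl hqU), hGχ q hqU]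
  have hk : ∀ᶠ q in 𝓝 (ptCorner z), q ∈ χ.source → scaledSnd χ ψ q = (F q).2 := by
    filter_upwards [hGF] with q hq hqU
    rw [← hq (.inl hqU), hGχ q hqU]
  have h1 := h.isSympl_hpairD hχ hP hF.fst hF.snd hz.2.2 hy hk
  rw [ptCorner_eq] at h1 hy hk
  rw [← isSympl_slice_iff hF.fst hF.snd (mk_zero_ne_zero hz.1) (mk_zero_ne_zero hz.2.1)] at h1
  rw [liftCorner_eq, (slice_eventuallyEq (mk_zero_ne_zero hz.1) (mk_zero_ne_zero hz.2.1)
      ((eventually_ptCorner_mem hχ.source_open hz).mono fun w hw => hw.1) hy hk).fderiv_eq]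
  exact h1

end Lifts

end

end ScGeom

namespace ScGeom

noncomputable section

variable {n : ℕ}

/-! ## A criterion for injectivity near a set -/

/-- A map which is a homeomorphism onto its image on `A` and locally injective at each point of `A`
is injective on a neighbourhood of `A`. -/
theorem exists_isOpen_injOn {X : Type*} [PseudoMetricSpace X] {f g : X → X} {A M : Set X}
    (hg : LeftInvOn g f A) (hgc : ContinuousOn g (f '' A))
    (hfc : ∀ a ∈ A, ContinuousWithinAt f M a)
    (hloc : ∀ a ∈ A, ∃ N ∈ 𝓝 a, InjOn f (N ∩ M)) :
    ∃ O : Set X, IsOpen O ∧ A ⊆ O ∧ InjOn f (O ∩ M) := by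
  have hr : ∀ a : A, ∃ r : ℝ, 0 < r ∧ InjOn f (Metric.ball (a : X) (2 * r) ∩ M) := fun a => by
    obtain ⟨N, hN, hi⟩ := hloc a a.2
    obtain ⟨ε, hε, hb⟩ := Metric.mem_nhds_iff.1 hN
    exact ⟨ε / 2, by positivity, hi.mono (inter_subset_inter_left _ (by
      rwa [mul_div_cancel₀ _ two_ne_zero]))⟩
  choose r hr hinj using hr
  have hδ : ∀ a : A, ∃ δ : ℝ, 0 < δ ∧ δ ≤ r a ∧ ∀ b ∈ A, dist (f b) (f a) < δ →
      dist b (a : X) < r a := fun a => by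
    obtain ⟨δ, hδ, h⟩ := Metric.continuousWithinAt_iff.1 (hgc (f a) ⟨a, a.2, rfl⟩) (r a) (hr a)
    refine ⟨min δ (r a), lt_min hδ (hr a), min_le_right _ _, fun b hb hd => ?_⟩
    have := h ⟨b, hb, rfl⟩ (hd.trans_le (min_le_left _ _))
    rwa [hg hb, hg a.2] at this
  choose δ hδ hδr hδd using hδ
  have hε : ∀ a : A, ∃ ε : ℝ, 0 < ε ∧ ε ≤ δ a ∧ ∀ p ∈ M, dist p (a : X) < ε →
      dist (f p) (f a) < δ a / 2 := fun a => by
    obtain ⟨ε, hε, h⟩ := Metric.continuousWithinAt_iff.1 (hfc a a.2) (δ a / 2) (half_pos (hδ a))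
    exact ⟨min ε (δ a), lt_min hε (hδ a), min_le_right _ _, fun p hp hd =>
      h hp (hd.trans_le (min_le_left _ _))⟩
  choose ε hε hεδ hεd using hε
  -- A common value of `f` at `p` and `q` forces `f a` and `f b` to be closer than `δ a`. Continuity
  -- of the inverse on `f '' A` then puts `b` within `r a` of `a`, so that `p` and `q` both lie in
  -- the ball of radius `2 * r a`, where `f` is injective.
  have key : ∀ a b : A, δ b ≤ δ a → ∀ p ∈ M, ∀ q ∈ M, dist p (a : X) < ε a →
      dist q (b : X) < ε b → f p = f q → p = q := by
    intro a b hab p hp q hq hpa hqb hpq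
    have h1 := hεd a p hp hpa
    have h2 := hεd b q hq hqb
    have h3 : dist (f b) (f a) < δ a := by
      have := dist_triangle_left (f b) (f a) (f q)
      rw [← hpq] at this h2
      linarith
    have h4 := hδd a b b.2 h3
    refine hinj a ⟨?_, hp⟩ ⟨?_, hq⟩ hpq
    · rw [Metric.mem_ball]; linarith [hεδ a, hδr a, hr a]
    · rw [Metric.mem_ball]
      have := dist_triangle q (b : X) (a : X)
      linarith [hεδ b, hδr a]
  refine ⟨⋃ a : A, Metric.ball (a : X) (ε a), isOpen_iUnion fun _ => Metric.isOpen_ball,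
    fun a ha => mem_iUnion.2 ⟨⟨a, ha⟩, Metric.mem_ball_self (hε _)⟩, ?_⟩
  rintro p ⟨hp, hpM⟩ q ⟨hq, hqM⟩ hpq
  obtain ⟨a, ha⟩ := mem_iUnion.1 hp
  obtain ⟨b, hb⟩ := mem_iUnion.1 hq
  rcases le_total (δ b) (δ a) with h | h
  · exact key a b h p hpM q hqM ha hb hpq
  · exact (key b a h q hqM p hpM hb ha hpq.symm).symm

/-! ## The local inverse of the map on the compactified phase space -/

/-- The lift of `F` to the ambient space, with the boundary defining functions as components. -/
def withHeights (F : Amb n → Phase n) (p : Amb n) : Amb n :=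
  (((F p).1, p.1.2), ((F p).2, p.2.2))

/-- The homogeneous map of the ambient space given by `F`, which preserves the heights. -/
def homMap (F : Amb n → Phase n) (p : Amb n) : Amb n :=
  withHeights (hpair (fun q => (F q).1) fun q => (F q).2) p

/-- The map on the compactified phase space given by `G`. -/
def normMap (G : Amb n → Phase n) (p : Amb n) : Amb n := nu2 (withHeights G p)

theorem homMap_smul (F : Amb n → Phase n) {a b : ℝ} (ha : 0 < a) (hb : 0 < b) (p : Amb n) :
    homMap F (a • p.1, b • p.2) = (a • (homMap F p).1, b • (homMap F p).2) := by
  simp only [homMap, withHeights, hpair_smul _ _ ha hb, dil_apply]; rfl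

theorem homMap_of_dbl (F : Amb n → Phase n) {p : Amb n} (h : p ∈ dbl n) :
    homMap F p = withHeights F p := by
  simp only [homMap, withHeights, hpair, hext_of_dbl _ _ _ h]

theorem contDiffAt_homMap {F : Amb n → Phase n} (hF : ContDiff ℝ ∞ F) {p : Amb n}
    (h1 : p.1 ≠ 0) (h2 : p.2 ≠ 0) : ContDiffAt ℝ ∞ (homMap F) p := by
  have h := contDiffAt_hpair hF.fst hF.snd h1 h2
  exact (h.fst.prodMk contDiffAt_fst.snd).prodMk (h.snd.prodMk contDiffAt_snd.snd)

/-- Near `q` the map given by `G` is a restriction of a homogeneous local diffeomorphism. -/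
def IsRegular (G : Amb n → Phase n) (S : Set (Amb n)) (q : Amb n) : Prop :=
  ∃ F : Amb n → Phase n, ContDiff ℝ ∞ F ∧ (∀ᶠ p in 𝓝 q, p ∈ S → G p = F p) ∧
    (homMap F q).1 ≠ 0 ∧ (homMap F q).2 ≠ 0 ∧ (fderiv ℝ (homMap F) q).IsInvertible

theorem IsRegular.eventually {G : Amb n → Phase n} {S : Set (Amb n)} {q : Amb n}
    (h : IsRegular G S q) (h1 : q.1 ≠ 0) (h2 : q.2 ≠ 0) : ∀ᶠ p in 𝓝 q, IsRegular G S p := by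
  obtain ⟨F, hF, hGF, hn1, hn2, e, he⟩ := h
  have hs := contDiffAt_homMap hF h1 h2
  have hd : ContinuousAt (fderiv ℝ (homMap F)) q := (hs.fderiv_right (m := 0) (by simp)).continuousAt
  have hi : ∀ᶠ p in 𝓝 q, (fderiv ℝ (homMap F) p).IsInvertible :=
    hd.eventually (he ▸ ContinuousLinearEquiv.nhds e)
  filter_upwards [eventually_eventually_nhds.2 hGF, hi,
    hs.continuousAt.fst.eventually_ne hn1, hs.continuousAt.snd.eventually_ne hn2]
    with p hp1 hp2 hp3 hp4
  exact ⟨F, hF, hp1, hp3, hp4, hp2⟩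

theorem IsRegular.mono {G : Amb n → Phase n} {S T : Set (Amb n)} {q : Amb n}
    (h : IsRegular G S q) (hT : T ⊆ S) : IsRegular G T q := by
  obtain ⟨F, hF, hGF, h'⟩ := h
  exact ⟨F, hF, hGF.mono fun p hp hT' => hp (hT hT'), h'⟩

section LocalInverse

variable {G : Amb n → Phase n} {S : Set (Amb n)} {q : Amb n}

theorem IsRegular.withHeights_ne (h : IsRegular G S q) (hS : S ⊆ dbl n) (hq : q ∈ S) :
    (withHeights G q).1 ≠ 0 ∧ (withHeights G q).2 ≠ 0 := by
  obtain ⟨F, -, hGF, hn1, hn2, -⟩ := h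
  rw [homMap_of_dbl F (hS hq)] at hn1 hn2
  rw [withHeights, hGF.self_of_nhds hq]
  exact ⟨hn1, hn2⟩

theorem IsRegular.continuousWithinAt (h : IsRegular G S q) (hS : S ⊆ dbl n) (hq : q ∈ S) :
    ContinuousWithinAt (normMap G) S q := by
  have hne := h.withHeights_ne hS hq
  obtain ⟨F, hF, hGF, -⟩ := h
  have hc : Continuous (withHeights F) := by
    have := hF.continuous
    unfold withHeights; fun_prop
  have h1 : withHeights G q = withHeights F q := by
    rw [withHeights, hGF.self_of_nhds hq]; rfl
  rw [h1] at hne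
  have h2 : ContinuousAt (fun p => nu2 (withHeights F p)) q :=
    ContinuousAt.comp (f := withHeights F) (continuousAt_nu2 hne.1 hne.2) hc.continuousAt
  refine h2.continuousWithinAt.congr_of_eventuallyEq ?_ (by rw [normMap, h1])
  filter_upwards [self_mem_nhdsWithin, mem_nhdsWithin_of_mem_nhds hGF] with p hp hp'
  rw [normMap, withHeights, hp' hp]; rfl

/-- The map on the compactified phase space has a smooth local inverse at a regular point. -/
theorem IsRegular.exists_inverse (h : IsRegular G S q) (hS : RelOpen S (dbl n)) (hq : q ∈ S) :
    ∃ k : Amb n → Amb n, ContDiffAt ℝ ∞ k (normMap G q) ∧ k (normMap G q) = q ∧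
      (∀ᶠ p in 𝓝 q, p ∈ S → k (normMap G p) = p) ∧
      ∀ᶠ w in 𝓝 (normMap G q), w ∈ dbl n → k w ∈ S ∧ normMap G (k w) = w := by
  obtain ⟨F, hF, hGF, hn1, hn2, e, he⟩ := h
  have hqd := hS.subset hq
  have hq1 := ne_zero_of_hemi hqd.1
  have hq2 := ne_zero_of_hemi hqd.2
  have hs := contDiffAt_homMap hF hq1 hq2
  have hd : HasFDerivAt (homMap F) (e : Amb n →L[ℝ] Amb n) q := by
    rw [he]; exact (hs.differentiableAt (by simp)).hasFDerivAt
  have hst := hs.hasStrictFDerivAt' hd (by simp)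
  set g := hs.localInverse hd (by simp) with hg
  have hgs : ContDiffAt ℝ ∞ g (homMap F q) := hs.to_localInverse hd (by simp)
  have hgq : g (homMap F q) = q := hs.localInverse_apply_image hd (by simp)
  have hleft : ∀ᶠ p in 𝓝 q, g (homMap F p) = p := hst.eventually_left_inverse
  have hright : ∀ᶠ w in 𝓝 (homMap F q), homMap F (g w) = w := hst.eventually_right_inverse
  set c := nrm (homMap F q).1 with hc
  set d := nrm (homMap F q).2 with hd'
  have hc0 : 0 < c := nrm_pos hn1
  have hd0 : 0 < d := nrm_pos hn2
  have hGq : ∀ {p}, p ∈ S → G p = F p → withHeights G p = homMap F p := fun {p} hp h => by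
    rw [homMap_of_dbl F (hS.subset hp), withHeights, h]; rfl
  have hnq : normMap G q = nu2 (homMap F q) := by
    rw [normMap, hGq hq (hGF.self_of_nhds hq)]
  -- `m` undoes the normalisation at `q`: it takes `normMap G q` back to `homMap F q`, near which
  -- the local inverse `g` is defined.
  let m : Amb n → Amb n := fun w => (c • w.1, d • w.2)
  have hm : ContDiff ℝ ∞ m := by fun_prop
  have hmq : m (nu2 (homMap F q)) = homMap F q :=
    Prod.ext (nrm_smul_nu hn1) (nrm_smul_nu hn2)
  have hgm : ContDiffAt ℝ ∞ (fun w => g (m w)) (nu2 (homMap F q)) :=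
    ContDiffAt.comp (g := g) (f := m) _ (by rw [hmq]; exact hgs) hm.contDiffAt
  have hgmq : g (m (nu2 (homMap F q))) = q := by rw [hmq, hgq]
  have hk : ContDiffAt ℝ ∞ (fun w => nu2 (g (m w))) (nu2 (homMap F q)) :=
    ContDiffAt.comp (g := nu2) (f := fun w => g (m w)) _
      (by rw [hgmq]; exact contDiffAt_nu2 hq1 hq2) hgm
  have hkq : nu2 (g (m (nu2 (homMap F q)))) = q := by rw [hgmq, nu2_of_dbl hqd]
  rw [hnq]
  refine ⟨fun w => nu2 (g (m w)), hk, hkq, ?_, ?_⟩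
  -- By homogeneity `m (normMap G p)` is the image under `homMap F` of a rescaling of `p`. The
  -- rescaled point tends to `q` as `p` does and has the same normalisation as `p`.
  · have hcont1 : ContinuousAt (fun p => c * (nrm (homMap F p).1)⁻¹) q :=
      continuousAt_const.mul ((continuous_nrm.continuousAt.comp hs.continuousAt.fst).inv₀ hc0.ne')
    have hcont2 : ContinuousAt (fun p => d * (nrm (homMap F p).2)⁻¹) q :=
      continuousAt_const.mul ((continuous_nrm.continuousAt.comp hs.continuousAt.snd).inv₀ hd0.ne')
    have hcont : ContinuousAt (fun p : Amb n => ((c * (nrm (homMap F p).1)⁻¹) • p.1,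
        (d * (nrm (homMap F p).2)⁻¹) • p.2)) q :=
      (hcont1.smul continuousAt_fst).prodMk (hcont2.smul continuousAt_snd)
    have hval : (((c * (nrm (homMap F q).1)⁻¹) • q.1, (d * (nrm (homMap F q).2)⁻¹) • q.2) : Amb n)
        = q := by
      rw [← hc, ← hd', mul_inv_cancel₀ hc0.ne', mul_inv_cancel₀ hd0.ne', one_smul, one_smul]
    have hev := hcont.eventually (p := fun p => g (homMap F p) = p) (by beta_reduce; rw [hval]; exact hleft)
    filter_upwards [hev, hGF, hs.continuousAt.fst.eventually_ne hn1,
      hs.continuousAt.snd.eventually_ne hn2] with p hp hpF hp1 hp2 hpS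
    have ha : 0 < c * (nrm (homMap F p).1)⁻¹ := mul_pos hc0 (inv_pos.2 (nrm_pos hp1))
    have hb : 0 < d * (nrm (homMap F p).2)⁻¹ := mul_pos hd0 (inv_pos.2 (nrm_pos hp2))
    have hmp : m (normMap G p) = homMap F ((c * (nrm (homMap F p).1)⁻¹) • p.1,
        (d * (nrm (homMap F p).2)⁻¹) • p.2) := by
      rw [homMap_smul F ha hb, normMap, hGq hpS (hpF hpS)]
      simp only [m, nu2, nu, smul_smul]
    simp only [hmp, hp]
    rw [nu2, nu_smul ha, nu_smul hb]
    exact nu2_of_dbl (hS.subset hpS)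
  · have hev1 := (hm.continuous.continuousAt (x := nu2 (homMap F q))).eventually
      (p := fun w => homMap F (g w) = w) (by rw [hmq]; exact hright)
    have hev2 := hgm.continuousAt.eventually_mem
      (by rw [hgmq]; exact isOpen_ne_ne.mem_nhds ⟨hq1, hq2⟩)
    have hev3 := hk.continuousAt.eventually (p := fun p => (p ∈ dbl n → p ∈ S) ∧ (p ∈ S → G p = F p))
      (by beta_reduce; rw [hkq]; exact (hS.eventually hq).and hGF)
    filter_upwards [hev1, hev2, hev3] with w hw1 hw2 hw3 hwd
    set r := g (m w) with hr
    -- `homMap F` preserves heights, so those of `r` are nonnegative when those of `w` are. This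
    -- keeps the local inverse inside the manifold with corners.
    have hr1 : r.1.2 = c * w.1.2 := congrArg (fun p : Amb n => p.1.2) hw1
    have hr2 : r.2.2 = d * w.2.2 := congrArg (fun p : Amb n => p.2.2) hw1
    have hdr : nu2 r ∈ dbl n := nu2_mem_dbl hw2.1 hw2.2
      (by rw [hr1]; exact mul_nonneg hc0.le hwd.1.2) (by rw [hr2]; exact mul_nonneg hd0.le hwd.2.2)
    have hSr := hw3.1 hdr
    refine ⟨hSr, ?_⟩
    have ha := inv_pos.2 (nrm_pos hw2.1)
    have hb := inv_pos.2 (nrm_pos hw2.2)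
    have hH : homMap F (nu2 r) = ((nrm r.1)⁻¹ • (c • w.1), (nrm r.2)⁻¹ • (d • w.2)) := by
      have := homMap_smul F ha hb r
      rw [hw1] at this; exact this
    rw [normMap, hGq hSr (hw3.2 hSr), hH, nu2, nu_smul ha, nu_smul hb, nu_smul hc0, nu_smul hd0]
    exact nu2_of_dbl hwd

end LocalInverse

end

end ScGeom

namespace ScGeom

noncomputable section

variable {n : ℕ}

/-! ## The diffeomorphism near the boundary -/

theorem normMap_mem_dbl {G : Amb n → Phase n} {p : Amb n} (hp : p ∈ dbl n)
    (h : (withHeights G p).1 ≠ 0 ∧ (withHeights G p).2 ≠ 0) : normMap G p ∈ dbl n :=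
  nu2_mem_dbl h.1 h.2 hp.1.2 hp.2.2

theorem normMap_mem_bdry {G : Amb n → Phase n} {p : Amb n} (hp : p ∈ dbl n)
    (h : (withHeights G p).1 ≠ 0 ∧ (withHeights G p).2 ≠ 0) :
    normMap G p ∈ bdry n ↔ p ∈ bdry n := by
  have h1 : (normMap G p).1.2 = 0 ↔ p.1.2 = 0 := nu_snd_eq_zero h.1
  have h2 : (normMap G p).2.2 = 0 ↔ p.2.2 = 0 := nu_snd_eq_zero h.2
  have hd := normMap_mem_dbl hp h
  exact or_congr ⟨fun h' => ⟨hp, h1.1 h'.2⟩, fun h' => ⟨hd, h1.2 h'.2⟩⟩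
    ⟨fun h' => ⟨hp, h2.1 h'.2⟩, fun h' => ⟨hd, h2.2 h'.2⟩⟩

/-- The point `⟨x⟩ y` compactifies to the normalisation of `(y, 1/⟨x⟩)`, whose height is that of `R
x`. So the map on phase space is, in compactified form, `normMap G`, which is also meaningful on the
boundary. -/
theorem ptInt_slice (G : Amb n → Phase n) (z : Phase n) :
    ptInt (slice (fun q => (G q).1) (fun q => (G q).2) 1 1 z) = normMap G (ptInt z) := by
  have h : ∀ (x y : Euc n), R (jb x • y) = nu (y, (R x).2) := fun x y => by
    rw [R_eq, ← nu_smul (jb_pos x) (y, (R x).2)]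
    congr 1
    refine Prod.ext rfl ?_
    simp [R_snd, (jb_pos x).ne']
  rw [slice_int, ptInt, h, h]; rfl

theorem contDiff_ptInt : ContDiff ℝ ∞ (ptInt : Phase n → Amb n) := by
  rw [contDiff_iff_contDiffAt]
  intro z
  have h : ptInt = fun z : Phase n => nu2 (emb 1 1 z) := funext ptInt_eq
  rw [h]
  exact ContDiffAt.comp (f := emb 1 1) z (contDiffAt_nu2 (mk_one_ne_zero _) (mk_one_ne_zero _))
    (contDiff_emb 1 1).contDiffAt

theorem contDiffAt_Rinv {p : Euc n × ℝ} (h : p.2 ≠ 0) : ContDiffAt ℝ ∞ Rinv p :=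
  (contDiffAt_snd.inv h).smul contDiffAt_fst

/-- The inverse of `ptInt`. -/
def ptIntInv (p : Amb n) : Phase n := (Rinv p.1, Rinv p.2)

theorem ptIntInv_ptInt (z : Phase n) : ptIntInv (ptInt z) = z :=
  Prod.ext (Rinv_R z.1) (Rinv_R z.2)

theorem contDiffAt_ptIntInv (z : Phase n) : ContDiffAt ℝ ∞ ptIntInv (ptInt z) :=
  (ContDiffAt.comp (g := Rinv) (f := Prod.fst) (ptInt z) (contDiffAt_Rinv (R_snd_pos z.1).ne')
    contDiffAt_fst).prodMk (ContDiffAt.comp (g := Rinv) (f := Prod.snd) (ptInt z)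
      (contDiffAt_Rinv (R_snd_pos z.2).ne') contDiffAt_snd)

section

variable {G : Amb n → Phase n} {Ω : Set (Amb n)}

theorem relOpen_image_normMap (hΩ : RelOpen Ω (dbl n)) (hreg : ∀ q ∈ Ω, IsRegular G Ω q) :
    RelOpen (normMap G '' Ω) (dbl n) := by
  refine relOpen_of_eventually ?_ ?_
  · rintro _ ⟨q, hq, rfl⟩
    exact normMap_mem_dbl (hΩ.subset hq) ((hreg q hq).withHeights_ne hΩ.subset hq)
  · rintro _ ⟨q, hq, rfl⟩
    obtain ⟨k, -, -, -, hk⟩ := (hreg q hq).exists_inverse hΩ hq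
    filter_upwards [hk] with w hw hwd
    exact ⟨k w, (hw hwd).1, (hw hwd).2⟩

/-- If the map on the compactified phase space is injective and regular, it gives a diffeomorphism
on the interior. -/
theorem isDiffeoOn_slice (hΩ : RelOpen Ω (dbl n)) (hG : SmoothOn G Ω)
    (hreg : ∀ q ∈ Ω, IsRegular G Ω q) (hinj : InjOn (normMap G) Ω) :
    IsDiffeoOn (slice (fun q => (G q).1) (fun q => (G q).2) 1 1) (intPart Ω)
      (intPart (normMap G '' Ω)) := by
  set C := slice (fun q => (G q).1) (fun q => (G q).2) 1 1 with hC
  have h1 : SmoothOn (fun q => (G q).1) Ω := SmoothOn.comp (T := univ) (g := Prod.fst)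
    (.of_contDiff contDiff_fst) hG (mapsTo_univ _ _)
  have h2 : SmoothOn (fun q => (G q).2) Ω := SmoothOn.comp (T := univ) (g := Prod.snd)
    (.of_contDiff contDiff_snd) hG (mapsTo_univ _ _)
  have hpt : ∀ z, ptInt (C z) = normMap G (ptInt z) := ptInt_slice G
  have hCinj : InjOn C (intPart Ω) := fun z hz w hw hzw => by
    have := congrArg ptInt hzw
    rw [hpt, hpt] at this
    exact ptInt_injective (hinj hz hw this)
  have hmaps : MapsTo C (intPart Ω) (intPart (normMap G '' Ω)) := fun z hz => by
    exact ⟨ptInt z, hz, (hpt z).symm⟩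
  have hsurj : SurjOn C (intPart Ω) (intPart (normMap G '' Ω)) := by
    rintro w ⟨p, hp, hpw⟩
    have hpb : p ∉ bdry n := fun h => by
      rw [← normMap_mem_bdry (hΩ.subset hp) ((hreg p hp).withHeights_ne hΩ.subset hp), hpw] at h
      exact ptInt_notMem_bdry w h
    obtain ⟨z, rfl⟩ := exists_ptInt (hΩ.subset hp) hpb
    exact ⟨z, hp, ptInt_injective (by rw [hpt, hpw])⟩
  have hbij : BijOn C (intPart Ω) (intPart (normMap G '' Ω)) := ⟨hmaps, hCinj, hsurj⟩
  refine ⟨(contDiffOn_hext_int hΩ h1 1 0).prodMk (contDiffOn_hext_int hΩ h2 0 1), hbij,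
    Function.invFunOn C (intPart Ω), fun w hw => ?_, hbij.invOn_invFunOn⟩
  obtain ⟨z, hz, rfl⟩ := hsurj hw
  obtain ⟨k, hk, hkq, -, hk'⟩ := (hreg _ hz).exists_inverse hΩ hz
  rw [← hpt] at hk hkq hk'
  have hs : ContDiffAt ℝ ∞ (fun w => ptIntInv (k (ptInt w))) (C z) := by
    have h3 : ContDiffAt ℝ ∞ (fun w => k (ptInt w)) (C z) :=
      ContDiffAt.comp (g := k) (f := ptInt) _ hk contDiff_ptInt.contDiffAt
    refine ContDiffAt.comp (g := ptIntInv) (f := fun w => k (ptInt w)) _ ?_ h3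
    rw [hkq]; exact contDiffAt_ptIntInv z
  -- The set-theoretic inverse coincides near `C z` with the smooth local inverse, since the values
  -- of the latter stay in `Ω` and `normMap G` is injective there.
  refine (hs.congr_of_eventuallyEq ?_).contDiffWithinAt
  have h4 := contDiff_ptInt.continuous.continuousAt.eventually hk'
  filter_upwards [h4] with w hw
  obtain ⟨h5, h6⟩ := hw (ptInt_mem_dbl w)
  obtain ⟨v, hv, rfl⟩ : w ∈ C '' intPart Ω := hsurj ⟨_, h5, h6⟩
  rw [hbij.invOn_invFunOn.1 hv]
  rw [hpt v] at h5 h6 ⊢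
  rw [hinj h5 hv h6, ptIntInv_ptInt]

end

section Radial

variable {χ : PartialEquiv (Amb n) (Amb n)} {ge gp φ ψ : Amb n → ℝ} {G : Amb n → Phase n}

theorem IsBdryDiffeo.continuousOn (hχ : IsBdryDiffeo χ) : ContinuousOn χ χ.source := by
  intro p hp
  have h1 : ContinuousWithinAt χ (χ.source ∩ faceE n) p := by
    by_cases h : p ∈ faceE n
    · exact hχ.smoothE.continuousOn p ⟨hp, h⟩
    · exact continuousWithinAt_of_notMem_closure fun h' =>
        h (isClosed_faceE.closure_subset_iff.2 inter_subset_right h')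
  have h2 : ContinuousWithinAt χ (χ.source ∩ facePsi n) p := by
    by_cases h : p ∈ facePsi n
    · exact hχ.smoothPsi.continuousOn p ⟨hp, h⟩
    · exact continuousWithinAt_of_notMem_closure fun h' =>
        h (isClosed_facePsi.closure_subset_iff.2 inter_subset_right h')
  refine (h1.union h2).mono fun q hq => ?_
  exact (hχ.source_open.subset hq).imp (⟨hq, ·⟩) (⟨hq, ·⟩)

/-- The relation between heights makes the heights of `p` exactly those of `χ p` rescaled by `φ` and
`ψ`. Hence normalising removes the radial factors and returns `χ p`. -/
theorem IsRadial.withHeights_eq (h : IsRadial χ ge gp φ ψ) {p : Amb n} (hp : p ∈ χ.source)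
    (hG : G p = (scaledFst χ φ p, scaledSnd χ ψ p)) :
    withHeights G p = (φ p • (χ p).1, ψ p • (χ p).2) := by
  rw [withHeights, hG, h.eq_fst p hp, h.eq_snd p hp]; rfl

theorem IsRadial.normMap_eq (h : IsRadial χ ge gp φ ψ) (hχ : IsBdryDiffeo χ) {p : Amb n}
    (hp : p ∈ χ.source) (hG : G p = (scaledFst χ φ p, scaledSnd χ ψ p)) : normMap G p = χ p := by
  rw [normMap, h.withHeights_eq hp hG, nu2, nu_smul (h.pos_fst p hp), nu_smul (h.pos_snd p hp)]
  exact nu2_of_dbl (hχ.map_mem_dbl hp)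

/-- The differential is injective because its heights are the identity and its restriction to
directions of zero height is, in the remaining components, symplectic. -/
theorem IsRadial.isRegular (h : IsRadial χ ge gp φ ψ) (hχ : IsBdryDiffeo χ)
    (hP : PreservesPoisson χ ge gp) (hG : SmoothOn G (fill χ.source))
    (hGχ : ∀ p ∈ χ.source, G p = (scaledFst χ φ p, scaledSnd χ ψ p)) {p : Amb n}
    (hp : p ∈ χ.source) : IsRegular G (fill χ.source) p := by
  obtain ⟨F, hF, hGF⟩ := hG.exists_contDiff (.inl hp)
  have hy : ∀ᶠ q in 𝓝 p, q ∈ χ.source → scaledFst χ φ q = (F q).1 := by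
    filter_upwards [hGF] with q hq hqU
    rw [← hq (.inl hqU), hGχ q hqU]
  have hk : ∀ᶠ q in 𝓝 p, q ∈ χ.source → scaledSnd χ ψ q = (F q).2 := by
    filter_upwards [hGF] with q hq hqU
    rw [← hq (.inl hqU), hGχ q hqU]
  have hs := h.isSympl_hpairD hχ hP hF.fst hF.snd hp hy hk
  have hd := hχ.mem_dbl hp
  have hd' := hχ.map_mem_dbl hp
  have hFp : F p = (scaledFst χ φ p, scaledSnd χ ψ p) := by
    rw [← hGF.self_of_nhds (.inl hp), hGχ p hp]
  have hv : homMap F p = (φ p • (χ p).1, ψ p • (χ p).2) := by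
    rw [homMap_of_dbl F hd, h.withHeights_eq hp hFp]
  have h1 := ne_zero_of_hemi hd.1
  have h2 := ne_zero_of_hemi hd.2
  refine ⟨F, hF, hGF, ?_, ?_, ?_⟩
  · rw [hv]; exact smul_ne_zero (h.pos_fst p hp).ne' (ne_zero_of_hemi hd'.1)
  · rw [hv]; exact smul_ne_zero (h.pos_snd p hp).ne' (ne_zero_of_hemi hd'.2)
  · set L := fderiv ℝ (homMap F) p with hL
    have hH : HasFDerivAt (hpair (fun q => (F q).1) fun q => (F q).2)
        (fderiv ℝ (hpair (fun q => (F q).1) fun q => (F q).2) p) p :=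
      ((contDiffAt_hpair hF.fst hF.snd h1 h2).differentiableAt (by simp)).hasFDerivAt
    set D := fderiv ℝ (hpair (fun q => (F q).1) fun q => (F q).2) p with hD
    -- Block triangular form: a vector in the kernel has zero heights, so it comes from phase space,
    -- where `D` restricts to the symplectic map `hpairD`.
    have hLv : ∀ v, L v = (((D v).1, v.1.2), ((D v).2, v.2.2)) := fun v => by
      have h3 : HasFDerivAt (homMap F) _ p := ((hH.fst.prodMk
        (hasFDerivAt_fst (𝕜 := ℝ) (p := p)).snd).prodMk
        (hH.snd.prodMk (hasFDerivAt_snd (𝕜 := ℝ) (p := p)).snd))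
      rw [hL, h3.fderiv]; rfl
    have hinj : Function.Injective L := (injective_iff_map_eq_zero L).2 fun v hv => by
      rw [hLv] at hv
      have e1 : (D v).1 = 0 := congrArg (fun p : Amb n => p.1.1) hv
      have e2 : v.1.2 = 0 := congrArg (fun p : Amb n => p.1.2) hv
      have e3 : (D v).2 = 0 := congrArg (fun p : Amb n => p.2.1) hv
      have e4 : v.2.2 = 0 := congrArg (fun p : Amb n => p.2.2) hv
      have e5 : scaleL 1 1 (v.1.1, v.2.1) = v := by
        rw [scaleL_apply, one_smul, one_smul]
        exact Prod.ext (Prod.ext rfl e2.symm) (Prod.ext rfl e4.symm)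
      have e6 : ((v.1.1, v.2.1) : Phase n) = 0 := hs.injective (by
        change D (scaleL 1 1 (v.1.1, v.2.1)) = 0
        rw [e5]; exact Prod.ext e1 e3)
      rw [← e5, e6, map_zero]
    exact ⟨(LinearEquiv.ofInjectiveEndo (L : Amb n →ₗ[ℝ] Amb n) hinj).toContinuousLinearEquiv,
      by ext v <;> rfl⟩

/-- On the source, `normMap G` is `χ`, a homeomorphism onto the target, and it is locally injective
there by regularity. It is therefore injective near the source, and regularity is an open condition.
-/
theorem IsRadial.exists_diffeo (h : IsRadial χ ge gp φ ψ) (hχ : IsBdryDiffeo χ)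
    (hP : PreservesPoisson χ ge gp) (hG : SmoothOn G (fill χ.source))
    (hGχ : ∀ p ∈ χ.source, G p = (scaledFst χ φ p, scaledSnd χ ψ p)) :
    ∃ Ω Ω' : Set (Amb n), RelOpen Ω (dbl n) ∧ RelOpen Ω' (dbl n) ∧
      Ω ∩ bdry n = χ.source ∧ Ω' ∩ bdry n = χ.target ∧ Ω ⊆ fill χ.source ∧
      IsDiffeoOn (slice (fun q => (G q).1) (fun q => (G q).2) 1 1) (intPart Ω) (intPart Ω') := by
  have hfo := relOpen_fill hχ.source_open
  have hreg : ∀ p ∈ χ.source, IsRegular G (fill χ.source) p := fun p hp =>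
    h.isRegular hχ hP hG hGχ hp
  have hχG : ∀ p ∈ χ.source, normMap G p = χ p := fun p hp => h.normMap_eq hχ hp (hGχ p hp)
  have himg : normMap G '' χ.source = χ.target := by
    rw [← χ.image_source_eq_target]
    exact image_congr hχG
  obtain ⟨O, hO, hUO, hinj⟩ := exists_isOpen_injOn (f := normMap G) (g := χ.symm) (A := χ.source)
    (M := fill χ.source) (fun p hp => by rw [hχG p hp, χ.left_inv hp])
    (by rw [himg]; exact hχ.symm.continuousOn)
    (fun p hp => (hreg p hp).continuousWithinAt hfo.subset (.inl hp))
    (fun p hp => by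
      obtain ⟨k, -, -, hk, -⟩ := (hreg p hp).exists_inverse hfo (.inl hp)
      refine ⟨_, hk, fun q hq q' hq' heq => ?_⟩
      rw [← hq.1 hq.2, heq, hq'.1 hq'.2])
  set Ω := {q | q ∈ O ∧ q ∈ fill χ.source ∧ IsRegular G (fill χ.source) q} with hΩ
  have hsub : Ω ⊆ fill χ.source := fun q hq => hq.2.1
  have hsub' : Ω ⊆ O ∩ fill χ.source := fun q hq => ⟨hq.1, hq.2.1⟩
  have hΩo : RelOpen Ω (dbl n) := by
    refine relOpen_of_eventually (fun q hq => hfo.subset hq.2.1) fun q hq => ?_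
    have hd := hfo.subset hq.2.1
    filter_upwards [hO.mem_nhds hq.1, hfo.eventually hq.2.1,
      hq.2.2.eventually (ne_zero_of_hemi hd.1) (ne_zero_of_hemi hd.2)] with p h1 h2 h3 hp
    exact ⟨h1, h2 hp, h3⟩
  have hΩr : ∀ q ∈ Ω, IsRegular G Ω q := fun q hq => hq.2.2.mono hsub
  have hUΩ : χ.source ⊆ Ω := fun p hp => ⟨hUO hp, .inl hp, hreg p hp⟩
  have hΩb : Ω ∩ bdry n = χ.source := by
    refine Subset.antisymm ?_ fun p hp => ⟨hUΩ hp, hχ.source_open.subset hp⟩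
    rw [← fill_inter_bdry hχ.source_open.subset]
    exact inter_subset_inter_left _ hsub
  refine ⟨Ω, normMap G '' Ω, hΩo, relOpen_image_normMap hΩo hΩr, hΩb, ?_, hsub,
    isDiffeoOn_slice hΩo (hG.mono hsub) hΩr (hinj.mono hsub')⟩
  refine Subset.antisymm ?_ ?_
  · rintro _ ⟨⟨q, hq, rfl⟩, hb⟩
    rw [normMap_mem_bdry (hΩo.subset hq) ((hΩr q hq).withHeights_ne hΩo.subset hq)] at hb
    rw [← himg]
    have hqU : q ∈ Ω ∩ bdry n := ⟨hq, hb⟩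
    rw [hΩb] at hqU
    exact ⟨q, hqU, rfl⟩
  · intro w hw
    refine ⟨?_, hχ.target_open.subset hw⟩
    rw [← himg] at hw
    exact image_mono hUΩ hw

end Radial

end

end ScGeom

namespace ScGeom

noncomputable section

variable {n : ℕ}

/-! ## Limits at the corner -/

/-- The point `ptE (x, s ξ)` is the normalisation of `((x, 0), (ξ, 1/s))`, and the last height tends
to zero. -/
theorem tendsto_ptE {U : Set (Amb n)} (hU : RelOpen U (bdry n)) {z : Phase n}
    (hz : z ∈ coneCorner U) :
    Tendsto (fun s : ℝ => ptE (z.1, s • z.2)) atTop (𝓝[U ∩ faceE n] ptCorner z) := by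
  have h1 : Tendsto (fun s : ℝ => nu2 (((z.1, 0), (z.2, s⁻¹)) : Amb n)) atTop
      (𝓝 (ptCorner z)) := by
    rw [ptCorner_eq]
    refine (continuousAt_nu2 (mk_zero_ne_zero hz.1) (mk_zero_ne_zero hz.2.1)).tendsto.comp ?_
    exact tendsto_const_nhds.prodMk_nhds (tendsto_const_nhds.prodMk_nhds tendsto_inv_atTop_zero)
  have h2 : Tendsto (fun s : ℝ => ptE (z.1, s • z.2)) atTop (𝓝 (ptCorner z)) := by
    refine h1.congr' ?_
    filter_upwards [eventually_gt_atTop 0] with s hs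
    rw [ptE_eq, nu2, nu2, emb]
    refine Prod.ext rfl ?_
    rw [← nu_smul hs (z.2, s⁻¹)]
    simp [hs.ne']
  refine tendsto_nhdsWithin_iff.2 ⟨h2, ?_⟩
  filter_upwards [h2.eventually (hU.eventually hz.2.2)] with s hs
  have hE : ptE (z.1, s • z.2) ∈ faceE n := ptE_mem_faceE hz.1
  exact ⟨hs (.inl hE), hE⟩

theorem tendsto_ptPsi {U : Set (Amb n)} (hU : RelOpen U (bdry n)) {z : Phase n}
    (hz : z ∈ coneCorner U) :
    Tendsto (fun s : ℝ => ptPsi (s • z.1, z.2)) atTop (𝓝[U ∩ facePsi n] ptCorner z) := by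
  have h1 : Tendsto (fun s : ℝ => nu2 (((z.1, s⁻¹), (z.2, 0)) : Amb n)) atTop
      (𝓝 (ptCorner z)) := by
    rw [ptCorner_eq]
    refine (continuousAt_nu2 (mk_zero_ne_zero hz.1) (mk_zero_ne_zero hz.2.1)).tendsto.comp ?_
    exact (tendsto_const_nhds.prodMk_nhds tendsto_inv_atTop_zero).prodMk_nhds tendsto_const_nhds
  have h2 : Tendsto (fun s : ℝ => ptPsi (s • z.1, z.2)) atTop (𝓝 (ptCorner z)) := by
    refine h1.congr' ?_
    filter_upwards [eventually_gt_atTop 0] with s hs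
    rw [ptPsi_eq, nu2, nu2, emb]
    refine Prod.ext ?_ rfl
    rw [← nu_smul hs (z.1, s⁻¹)]
    simp [hs.ne']
  refine tendsto_nhdsWithin_iff.2 ⟨h2, ?_⟩
  filter_upwards [h2.eventually (hU.eventually hz.2.2)] with s hs
  have hP : ptPsi (s • z.1, z.2) ∈ facePsi n := ptPsi_mem_facePsi hz.2.1
  exact ⟨hs (.inr hP), hP⟩

theorem tendsto_inv_mul_jb (x : Euc n) :
    Tendsto (fun s : ℝ => s⁻¹ * jb (s • x)) atTop (𝓝 ‖x‖) := by
  have h1 : Tendsto (fun s : ℝ => nrm (x, s⁻¹)) atTop (𝓝 ‖x‖) := by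
    rw [norm_eq_nrm]
    exact continuous_nrm.continuousAt.tendsto.comp
      (tendsto_const_nhds.prodMk_nhds tendsto_inv_atTop_zero)
  refine h1.congr' ?_
  filter_upwards [eventually_gt_atTop 0] with s hs
  have h2 : ((s • x, 1) : Euc n × ℝ) = s • (x, s⁻¹) := by simp [hs.ne']
  rw [jb_eq, h2, nrm_smul, abs_of_pos hs, inv_mul_cancel_left₀ hs.ne']

/-! ## The lifts as diffeomorphisms -/

theorem isDiffeoOn_of_inverse {X Y : Type*} [NormedAddCommGroup X] [NormedSpace ℝ X]
    [NormedAddCommGroup Y] [NormedSpace ℝ Y] {C : X → Y} {D : Y → X} {W : Set X} {W' : Set Y}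
    (hC : ContDiffOn ℝ ∞ C W) (hD : ContDiffOn ℝ ∞ D W') (h : MapsTo C W W')
    (h' : MapsTo D W' W) (hi : LeftInvOn D C W) (hi' : LeftInvOn C D W') : IsDiffeoOn C W W' :=
  ⟨hC, InvOn.bijOn ⟨hi, hi'⟩ h h', D, hD, hi, hi'⟩

theorem dir_smul {c : ℝ} (hc : 0 < c) (x : Euc n) : dir (c • x) = dir x := by
  rw [dir_eq, dir_eq, ← nu_smul hc (x, 0)]
  simp

section Radial

variable {χ : PartialEquiv (Amb n) (Amb n)} {ge gp φ ψ : Amb n → ℝ}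

/-- The inverse has the inverse radial factors. -/
theorem IsRadial.symm (h : IsRadial χ ge gp φ ψ) (hχ : IsBdryDiffeo χ) :
    IsRadial χ.symm (fun p => φ (χ.symm p)) (fun p => ψ (χ.symm p)) (fun p => (φ (χ.symm p))⁻¹)
      (fun p => (ψ (χ.symm p))⁻¹) := by
  have hE : MapsTo χ.symm (χ.target ∩ faceE n) (χ.source ∩ faceE n) := fun p hp =>
    ⟨χ.map_target hp.1, (hχ.symm.map_faceE p hp.1).2 hp.2⟩
  have hPsi : MapsTo χ.symm (χ.target ∩ facePsi n) (χ.source ∩ facePsi n) := fun p hp =>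
    ⟨χ.map_target hp.1, (hχ.symm.map_facePsi p hp.1).2 hp.2⟩
  have p1 : ∀ p ∈ χ.target, 0 < φ (χ.symm p) := fun p hp => h.pos_fst _ (χ.map_target hp)
  have p2 : ∀ p ∈ χ.target, 0 < ψ (χ.symm p) := fun p hp => h.pos_snd _ (χ.map_target hp)
  -- The contact factors of the inverse enter only through their reciprocals. They are taken to be
  -- the inverses of the new radial factors, which makes the last two conditions hold by definition.
  refine ⟨⟨?_, ?_⟩, ⟨?_, ?_⟩, fun p hp => inv_pos.2 (p1 p hp), fun p hp => inv_pos.2 (p2 p hp),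
    fun p hp => ?_, fun p hp => ?_, fun _ _ => rfl, fun _ _ => rfl⟩
  · exact (h.smooth_fst.1.comp hχ.symm_smoothE hE).inv fun p hp => (p1 p hp.1).ne'
  · exact (h.smooth_fst.2.comp hχ.symm_smoothPsi hPsi).inv fun p hp => (p1 p hp.1).ne'
  · exact (h.smooth_snd.1.comp hχ.symm_smoothE hE).inv fun p hp => (p2 p hp.1).ne'
  · exact (h.smooth_snd.2.comp hχ.symm_smoothPsi hPsi).inv fun p hp => (p2 p hp.1).ne'
  · rw [h.eq_fst _ (χ.map_target hp), χ.right_inv hp, inv_mul_cancel_left₀ (p1 p hp).ne']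
  · rw [h.eq_snd _ (χ.map_target hp), χ.right_inv hp, inv_mul_cancel_left₀ (p2 p hp).ne']

theorem IsBdryDiffeo.norm_fst (hχ : IsBdryDiffeo χ) {p : Amb n} (hp : p ∈ χ.source)
    (h0 : p.1.2 = 0) : ‖(χ p).1.1‖ = 1 :=
  nrm_fst_of_zero (hχ.map_mem_dbl hp).1 ((hχ.map_fst_eq_zero hp).2 h0)

theorem IsBdryDiffeo.norm_snd (hχ : IsBdryDiffeo χ) {p : Amb n} (hp : p ∈ χ.source)
    (h0 : p.2.2 = 0) : ‖(χ p).2.1‖ = 1 :=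
  nrm_fst_of_zero (hχ.map_mem_dbl hp).2 ((hχ.map_snd_eq_zero hp).2 h0)

theorem IsBdryDiffeo.dir_smul_fst (hχ : IsBdryDiffeo χ) {p : Amb n} (hp : p ∈ χ.source)
    (h0 : p.1.2 = 0) {c : ℝ} (hc : 0 < c) : dir (c • (χ p).1.1) = (χ p).1 := by
  rw [dir_smul hc, dir_fst (hχ.map_mem_dbl hp).1 ((hχ.map_fst_eq_zero hp).2 h0)]

theorem IsBdryDiffeo.dir_smul_snd (hχ : IsBdryDiffeo χ) {p : Amb n} (hp : p ∈ χ.source)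
    (h0 : p.2.2 = 0) {c : ℝ} (hc : 0 < c) : dir (c • (χ p).2.1) = (χ p).2 := by
  rw [dir_smul hc, dir_fst (hχ.map_mem_dbl hp).2 ((hχ.map_snd_eq_zero hp).2 h0)]

theorem IsBdryDiffeo.smul_fst_ne (hχ : IsBdryDiffeo χ) {p : Amb n} (hp : p ∈ χ.source)
    (h0 : p.1.2 = 0) {c : ℝ} (hc : 0 < c) : c • (χ p).1.1 ≠ 0 := by
  have := hχ.norm_fst hp h0
  exact smul_ne_zero hc.ne' (norm_ne_zero_iff.1 (by rw [this]; exact one_ne_zero))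

theorem IsBdryDiffeo.smul_snd_ne (hχ : IsBdryDiffeo χ) {p : Amb n} (hp : p ∈ χ.source)
    (h0 : p.2.2 = 0) {c : ℝ} (hc : 0 < c) : c • (χ p).2.1 ≠ 0 := by
  have := hχ.norm_snd hp h0
  exact smul_ne_zero hc.ne' (norm_ne_zero_iff.1 (by rw [this]; exact one_ne_zero))

theorem IsRadial.ptE_liftE (h : IsRadial χ ge gp φ ψ) (hχ : IsBdryDiffeo χ) {z : Phase n}
    (hz : z ∈ coneE χ.source) : ptE (liftE χ φ z) = χ (ptE z) :=
  Prod.ext (hχ.dir_smul_fst hz.2 rfl (mul_pos (norm_pos_iff.2 hz.1) (h.pos_fst _ hz.2)))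
    (R_Rinv (hχ.map_mem_dbl hz.2).2 (hχ.map_snd_pos hz.2 (R_snd_pos _)))

theorem IsRadial.ptPsi_liftPsi (h : IsRadial χ ge gp φ ψ) (hχ : IsBdryDiffeo χ) {z : Phase n}
    (hz : z ∈ conePsi χ.source) : ptPsi (liftPsi χ ψ z) = χ (ptPsi z) :=
  Prod.ext (R_Rinv (hχ.map_mem_dbl hz.2).1 (hχ.map_fst_pos hz.2 (R_snd_pos _)))
    (hχ.dir_smul_snd hz.2 rfl (mul_pos (norm_pos_iff.2 hz.1) (h.pos_snd _ hz.2)))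

theorem IsRadial.ptCorner_liftCorner (h : IsRadial χ ge gp φ ψ) (hχ : IsBdryDiffeo χ)
    {z : Phase n} (hz : z ∈ coneCorner χ.source) :
    ptCorner (liftCorner χ φ ψ z) = χ (ptCorner z) :=
  Prod.ext (hχ.dir_smul_fst hz.2.2 rfl (mul_pos (norm_pos_iff.2 hz.1) (h.pos_fst _ hz.2.2)))
    (hχ.dir_smul_snd hz.2.2 rfl (mul_pos (norm_pos_iff.2 hz.2.1) (h.pos_snd _ hz.2.2)))

theorem IsRadial.mapsTo_liftE (h : IsRadial χ ge gp φ ψ) (hχ : IsBdryDiffeo χ) :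
    MapsTo (liftE χ φ) (coneE χ.source) (coneE χ.target) := fun z hz =>
  ⟨hχ.smul_fst_ne hz.2 rfl (mul_pos (norm_pos_iff.2 hz.1) (h.pos_fst _ hz.2)), by
    rw [h.ptE_liftE hχ hz]; exact χ.map_source hz.2⟩

theorem IsRadial.mapsTo_liftPsi (h : IsRadial χ ge gp φ ψ) (hχ : IsBdryDiffeo χ) :
    MapsTo (liftPsi χ ψ) (conePsi χ.source) (conePsi χ.target) := fun z hz =>
  ⟨hχ.smul_snd_ne hz.2 rfl (mul_pos (norm_pos_iff.2 hz.1) (h.pos_snd _ hz.2)), by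
    rw [h.ptPsi_liftPsi hχ hz]; exact χ.map_source hz.2⟩

theorem IsRadial.mapsTo_liftCorner (h : IsRadial χ ge gp φ ψ) (hχ : IsBdryDiffeo χ) :
    MapsTo (liftCorner χ φ ψ) (coneCorner χ.source) (coneCorner χ.target) := fun z hz =>
  ⟨hχ.smul_fst_ne hz.2.2 rfl (mul_pos (norm_pos_iff.2 hz.1) (h.pos_fst _ hz.2.2)),
    hχ.smul_snd_ne hz.2.2 rfl (mul_pos (norm_pos_iff.2 hz.2.1) (h.pos_snd _ hz.2.2)), by
    rw [h.ptCorner_liftCorner hχ hz]; exact χ.map_source hz.2.2⟩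

theorem radial_cancel {r f f' : ℝ} {T x : Euc n} (hr : r = ‖x‖) (hx : x ≠ 0) (hf : 0 < f)
    (hff : f' * f = 1) (hT : ‖T‖ = 1) : (‖(r * f) • T‖ * f') • ‖x‖⁻¹ • x = x := by
  have hx' := norm_pos_iff.2 hx
  rw [norm_smul, hT, mul_one, hr, Real.norm_of_nonneg (mul_pos hx' hf).le, mul_assoc,
    mul_comm f f', hff, mul_one, smul_smul, mul_inv_cancel₀ hx'.ne', one_smul]

variable {ge' gp' φ' ψ' : Amb n → ℝ}

theorem IsRadial.leftInvOn_liftE (h : IsRadial χ ge gp φ ψ) (hχ : IsBdryDiffeo χ)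
    (hφ : ∀ p ∈ χ.source, φ' (χ p) * φ p = 1) :
    LeftInvOn (liftE χ.symm φ') (liftE χ φ) (coneE χ.source) := fun z hz => by
  rw [liftE, compT, compH, h.ptE_liftE hχ hz, χ.left_inv hz.2]
  exact Prod.ext (radial_cancel rfl hz.1 (h.pos_fst _ hz.2) (hφ _ hz.2) (hχ.norm_fst hz.2 rfl))
    (Rinv_R z.2)

theorem IsRadial.leftInvOn_liftPsi (h : IsRadial χ ge gp φ ψ) (hχ : IsBdryDiffeo χ)
    (hψ : ∀ p ∈ χ.source, ψ' (χ p) * ψ p = 1) :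
    LeftInvOn (liftPsi χ.symm ψ') (liftPsi χ ψ) (conePsi χ.source) := fun z hz => by
  rw [liftPsi, compY, compG, h.ptPsi_liftPsi hχ hz, χ.left_inv hz.2]
  exact Prod.ext (Rinv_R z.1)
    (radial_cancel rfl hz.1 (h.pos_snd _ hz.2) (hψ _ hz.2) (hχ.norm_snd hz.2 rfl))

theorem IsRadial.leftInvOn_liftCorner (h : IsRadial χ ge gp φ ψ) (hχ : IsBdryDiffeo χ)
    (hφ : ∀ p ∈ χ.source, φ' (χ p) * φ p = 1) (hψ : ∀ p ∈ χ.source, ψ' (χ p) * ψ p = 1) :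
    LeftInvOn (liftCorner χ.symm φ' ψ') (liftCorner χ φ ψ) (coneCorner χ.source) := fun z hz => by
  rw [liftCorner, compA, compB, h.ptCorner_liftCorner hχ hz, χ.left_inv hz.2.2]
  exact Prod.ext
    (radial_cancel rfl hz.1 (h.pos_fst _ hz.2.2) (hφ _ hz.2.2) (hχ.norm_fst hz.2.2 rfl))
    (radial_cancel rfl hz.2.1 (h.pos_snd _ hz.2.2) (hψ _ hz.2.2) (hχ.norm_snd hz.2.2 rfl))

/-- The inverse of each lift is the lift of `χ.symm` with reciprocal radial factors, smooth for the
same reason as the lift itself. -/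
theorem IsRadial.isDiffeoOn_lift (h : IsRadial χ ge gp φ ψ) (hχ : IsBdryDiffeo χ) :
    IsDiffeoOn (liftE χ φ) (coneE χ.source) (coneE χ.target) ∧
      IsDiffeoOn (liftPsi χ ψ) (conePsi χ.source) (conePsi χ.target) ∧
      IsDiffeoOn (liftCorner χ φ ψ) (coneCorner χ.source) (coneCorner χ.target) := by
  have h' := h.symm hχ
  have hχ' := hχ.symm
  have e1 : ∀ p ∈ χ.source, (φ (χ.symm (χ p)))⁻¹ * φ p = 1 := fun p hp => by
    rw [χ.left_inv hp, inv_mul_cancel₀ (h.pos_fst p hp).ne']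
  have e2 : ∀ p ∈ χ.source, (ψ (χ.symm (χ p)))⁻¹ * ψ p = 1 := fun p hp => by
    rw [χ.left_inv hp, inv_mul_cancel₀ (h.pos_snd p hp).ne']
  have e3 : ∀ p ∈ χ.target, φ (χ.symm p) * (φ (χ.symm p))⁻¹ = 1 := fun p hp =>
    mul_inv_cancel₀ (h.pos_fst _ (χ.map_target hp)).ne'
  have e4 : ∀ p ∈ χ.target, ψ (χ.symm p) * (ψ (χ.symm p))⁻¹ = 1 := fun p hp =>
    mul_inv_cancel₀ (h.pos_snd _ (χ.map_target hp)).ne'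
  exact ⟨isDiffeoOn_of_inverse (h.contDiffOn_liftE hχ) (h'.contDiffOn_liftE hχ')
      (h.mapsTo_liftE hχ) (h'.mapsTo_liftE hχ') (h.leftInvOn_liftE hχ e1)
      (h'.leftInvOn_liftE hχ' e3),
    isDiffeoOn_of_inverse (h.contDiffOn_liftPsi hχ) (h'.contDiffOn_liftPsi hχ')
      (h.mapsTo_liftPsi hχ) (h'.mapsTo_liftPsi hχ') (h.leftInvOn_liftPsi hχ e2)
      (h'.leftInvOn_liftPsi hχ' e4),
    isDiffeoOn_of_inverse (h.contDiffOn_liftCorner hχ) (h'.contDiffOn_liftCorner hχ')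
      (h.mapsTo_liftCorner hχ) (h'.mapsTo_liftCorner hχ') (h.leftInvOn_liftCorner hχ e1 e2)
      (h'.leftInvOn_liftCorner hχ' e3 e4)⟩

theorem liftE_smul (χ : Amb n → Amb n) (f : Amb n → ℝ) (z : Phase n) {r : ℝ} (hr : 0 < r) :
    liftE χ f (r • z.1, z.2) = (r • (liftE χ f z).1, (liftE χ f z).2) := by
  simp only [liftE, compT, compH, ptE_smul z hr, norm_smul, Real.norm_of_nonneg hr.le, smul_smul,
    mul_assoc]

theorem liftPsi_smul (χ : Amb n → Amb n) (f : Amb n → ℝ) (z : Phase n) {r : ℝ} (hr : 0 < r) :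
    liftPsi χ f (z.1, r • z.2) = ((liftPsi χ f z).1, r • (liftPsi χ f z).2) := by
  simp only [liftPsi, compY, compG, ptPsi_smul z hr, norm_smul, Real.norm_of_nonneg hr.le,
    smul_smul, mul_assoc]

theorem liftCorner_smul (χ : Amb n → Amb n) (f f' : Amb n → ℝ) (z : Phase n) {r t : ℝ}
    (hr : 0 < r) (ht : 0 < t) : liftCorner χ f f' (r • z.1, t • z.2) =
      (r • (liftCorner χ f f' z).1, t • (liftCorner χ f f' z).2) := by
  simp only [liftCorner, compA, compB, ptCorner_smul z hr ht, norm_smul,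
    Real.norm_of_nonneg hr.le, Real.norm_of_nonneg ht.le, smul_smul, mul_assoc]

/-- Writing `Y` and `H` as `⟨x⟩` and `⟨ξ⟩` times the scaled components, which are continuous up to
the corner, the limits reduce to `⟨s x⟩ / s → |x|`. -/
theorem IsRadial.tendsto_corner (h : IsRadial χ ge gp φ ψ) (hχ : IsBdryDiffeo χ) {z : Phase n}
    (hz : z ∈ coneCorner χ.source) :
    Tendsto (fun s : ℝ => compT χ (z.1, s • z.2)) atTop (𝓝 (compA χ z)) ∧
      Tendsto (fun s : ℝ => s⁻¹ • compY χ (s • z.1, z.2)) atTop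
        (𝓝 ((‖z.1‖ * φ (ptCorner z)) • compA χ z)) ∧
      Tendsto (fun s : ℝ => s⁻¹ • compH χ (z.1, s • z.2)) atTop
        (𝓝 ((‖z.2‖ * ψ (ptCorner z)) • compB χ z)) ∧
      Tendsto (fun s : ℝ => compG χ (s • z.1, z.2)) atTop (𝓝 (compB χ z)) := by
  have hE := tendsto_ptE hχ.source_open hz
  have hP := tendsto_ptPsi hχ.source_open hz
  have hc := ptCorner_mem_corner hz.1 hz.2.1
  have hEc : ptCorner z ∈ χ.source ∩ faceE n := ⟨hz.2.2, hc.1⟩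
  have hPc : ptCorner z ∈ χ.source ∩ facePsi n := ⟨hz.2.2, hc.2⟩
  have hχE := (hχ.smoothE.continuousOn _ hEc).tendsto.comp hE
  have hχP := (hχ.smoothPsi.continuousOn _ hPc).tendsto.comp hP
  have hY := ((h.smooth_scaledFst hχ).2.continuousOn _ hPc).tendsto.comp hP
  have hH := ((h.smooth_scaledSnd hχ).1.continuousOn _ hEc).tendsto.comp hE
  refine ⟨hχE.fst_nhds.fst_nhds, ?_, ?_, hχP.snd_nhds.fst_nhds⟩
  · rw [mul_smul]
    refine ((tendsto_inv_mul_jb z.1).smul hY).congr' ?_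
    filter_upwards [(tendsto_nhdsWithin_iff.1 hP).2] with s hs
    rw [h.compY_eq (z := (s • z.1, z.2)) ⟨hz.2.1, hs.1⟩, smul_smul]; rfl
  · rw [mul_smul]
    refine ((tendsto_inv_mul_jb z.2).smul hH).congr' ?_
    filter_upwards [(tendsto_nhdsWithin_iff.1 hE).2] with s hs
    rw [h.compH_eq (z := (z.1, s • z.2)) ⟨hz.1, hs.1⟩, smul_smul]; rfl

end Radial

end

end ScGeom

namespace ScGeom

noncomputable section

variable {n : ℕ}

/-! ## The components of the lifts as symbols -/

section

variable {χ : PartialEquiv (Amb n) (Amb n)} {ge gp φ ψ : Amb n → ℝ} {G : Amb n → Phase n}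

theorem IsBdryDiffeo.mem_of_fill (hχ : IsBdryDiffeo χ) {p : Amb n} (hp : p ∈ fill χ.source)
    (hb : p ∈ bdry n) : p ∈ χ.source := by
  rw [← fill_inter_bdry hχ.source_open.subset]; exact ⟨hp, hb⟩

theorem IsRadial.liftE_eq_slice (h : IsRadial χ ge gp φ ψ) (hχ : IsBdryDiffeo χ)
    (hGχ : ∀ p ∈ χ.source, G p = (scaledFst χ φ p, scaledSnd χ ψ p)) {z : Phase n}
    (hz : z ∈ coneE (fill χ.source)) :
    liftE χ φ z = (‖z.1‖ • (G (ptE z)).1, jb z.2 • (G (ptE z)).2) := by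
  have hz' : z ∈ coneE χ.source := ⟨hz.1, hχ.mem_of_fill hz.2 (.inl (ptE_mem_faceE hz.1))⟩
  rw [h.liftE_eq hz', slice_E, hGχ _ hz'.2]

theorem IsRadial.liftPsi_eq_slice (h : IsRadial χ ge gp φ ψ) (hχ : IsBdryDiffeo χ)
    (hGχ : ∀ p ∈ χ.source, G p = (scaledFst χ φ p, scaledSnd χ ψ p)) {z : Phase n}
    (hz : z ∈ conePsi (fill χ.source)) :
    liftPsi χ ψ z = (jb z.1 • (G (ptPsi z)).1, ‖z.2‖ • (G (ptPsi z)).2) := by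
  have hz' : z ∈ conePsi χ.source := ⟨hz.1, hχ.mem_of_fill hz.2 (.inr (ptPsi_mem_facePsi hz.1))⟩
  rw [h.liftPsi_eq hz', slice_Psi, hGχ _ hz'.2]

theorem liftCorner_eq_slice (hχ : IsBdryDiffeo χ)
    (hGχ : ∀ p ∈ χ.source, G p = (scaledFst χ φ p, scaledSnd χ ψ p)) {z : Phase n}
    (hz : z ∈ coneCorner (fill χ.source)) :
    liftCorner χ φ ψ z = (‖z.1‖ • (G (ptCorner z)).1, ‖z.2‖ • (G (ptCorner z)).2) := by
  have hz' : ptCorner z ∈ χ.source :=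
    hχ.mem_of_fill hz.2.2 (.inl (ptCorner_mem_corner hz.1 hz.2.1).1)
  rw [liftCorner_eq, slice_corner, hGχ _ hz']

theorem SmoothOn.fst_coord {S : Set (Amb n)} (hG : SmoothOn G S) (i : Fin n) :
    SmoothOn (fun p => (G p).1 i) S :=
  SmoothOn.comp (T := univ) (g := fun z : Phase n => z.1 i)
    (.of_contDiff ((EuclideanSpace.proj i : Euc n →L[ℝ] ℝ).contDiff.comp contDiff_fst)) hG
    (mapsTo_univ _ _)

theorem SmoothOn.snd_coord {S : Set (Amb n)} (hG : SmoothOn G S) (i : Fin n) :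
    SmoothOn (fun p => (G p).2 i) S :=
  SmoothOn.comp (T := univ) (g := fun z : Phase n => z.2 i)
    (.of_contDiff ((EuclideanSpace.proj i : Euc n →L[ℝ] ℝ).contDiff.comp contDiff_snd)) hG
    (mapsTo_univ _ _)

theorem IsRadial.classicalE_compH (h : IsRadial χ ge gp φ ψ) (hχ : IsBdryDiffeo χ)
    (hG : SmoothOn G (fill χ.source))
    (hGχ : ∀ p ∈ χ.source, G p = (scaledFst χ φ p, scaledSnd χ ψ p)) (i : Fin n) :
    ClassicalE χ.source 1 (fun z => compH χ z i) := by
  have := classicalE_symbE (relOpen_fill hχ.source_open) (hG.snd_coord i) 1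
    (f := fun z => compH χ z i) fun z hz => by
      have := congrArg (fun w : Phase n => w.2 i) (h.liftE_eq_slice hχ hGχ hz)
      simpa [symbE, liftE] using this
  rwa [fill_inter_bdry hχ.source_open.subset] at this

theorem IsRadial.classicalPsi_compY (h : IsRadial χ ge gp φ ψ) (hχ : IsBdryDiffeo χ)
    (hG : SmoothOn G (fill χ.source))
    (hGχ : ∀ p ∈ χ.source, G p = (scaledFst χ φ p, scaledSnd χ ψ p)) (i : Fin n) :
    ClassicalPsi χ.source 1 (fun z => compY χ z i) := by
  have := classicalPsi_symbPsi (relOpen_fill hχ.source_open) (hG.fst_coord i) 1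
    (f := fun z => compY χ z i) fun z hz => by
      have := congrArg (fun w : Phase n => w.1 i) (h.liftPsi_eq_slice hχ hGχ hz)
      simpa [symbPsi, liftPsi] using this
  rwa [fill_inter_bdry hχ.source_open.subset] at this

/-- The components of the interior slice are the sections of order `(1, 0)` given by the components
of `G`; those of the lifts are the other slices of the same functions. -/
theorem IsRadial.classicalSG_fst (h : IsRadial χ ge gp φ ψ) (hχ : IsBdryDiffeo χ)
    (hG : SmoothOn G (fill χ.source))
    (hGχ : ∀ p ∈ χ.source, G p = (scaledFst χ φ p, scaledSnd χ ψ p)) (i : Fin n) :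
    ClassicalSGWithSymbol (fill χ.source) 1 0
      (fun z => (slice (fun q => (G q).1) (fun q => (G q).2) 1 1 z).1 i)
      (fun z => (liftE χ φ z).1 i) (fun z => (liftPsi χ ψ z).1 i)
      (fun z => (liftCorner χ φ ψ z).1 i) := by
  have h1 : (fun z => (slice (fun q => (G q).1) (fun q => (G q).2) 1 1 z).1 i) =
      symbInt 1 0 fun p => (G p).1 i := by
    funext z
    simp [slice_int, symbInt]
  rw [h1]
  refine classicalSGWithSymbol_symbInt (relOpen_fill hχ.source_open) (hG.fst_coord i) 1 0
    (fun z hz => ?_) (fun z hz => ?_) (fun z hz => ?_)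
  · simp [h.liftE_eq_slice hχ hGχ hz, symbE]
  · simp [h.liftPsi_eq_slice hχ hGχ hz, symbPsi]
  · simp [liftCorner_eq_slice hχ hGχ hz, symbCorner]

theorem IsRadial.classicalSG_snd (h : IsRadial χ ge gp φ ψ) (hχ : IsBdryDiffeo χ)
    (hG : SmoothOn G (fill χ.source))
    (hGχ : ∀ p ∈ χ.source, G p = (scaledFst χ φ p, scaledSnd χ ψ p)) (i : Fin n) :
    ClassicalSGWithSymbol (fill χ.source) 0 1
      (fun z => (slice (fun q => (G q).1) (fun q => (G q).2) 1 1 z).2 i)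
      (fun z => (liftE χ φ z).2 i) (fun z => (liftPsi χ ψ z).2 i)
      (fun z => (liftCorner χ φ ψ z).2 i) := by
  have h1 : (fun z => (slice (fun q => (G q).1) (fun q => (G q).2) 1 1 z).2 i) =
      symbInt 0 1 fun p => (G p).2 i := by
    funext z
    simp [slice_int, symbInt]
  rw [h1]
  refine classicalSGWithSymbol_symbInt (relOpen_fill hχ.source_open) (hG.snd_coord i) 0 1
    (fun z hz => ?_) (fun z hz => ?_) (fun z hz => ?_)
  · simp [h.liftE_eq_slice hχ hGχ hz, symbE]
  · simp [h.liftPsi_eq_slice hχ hGχ hz, symbPsi]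
  · simp [liftCorner_eq_slice hχ hGχ hz, symbCorner]

end

end

end ScGeom

/-! ### Assembly of the theorem -/

theorem mainTheorem11 (n : ℕ) (χ : PartialEquiv (Amb n) (Amb n)) (hχ : IsSCT χ)
    (hcorner : (χ.source ∩ corner n).Nonempty) :
    -- the triple of diffeomorphisms between the strata
    RestrictsToDiffeo χ (faceE n \ corner n) ∧
    RestrictsToDiffeo χ (facePsi n \ corner n) ∧
    RestrictsToDiffeo χ (corner n) ∧
    -- 1. and 2.: the fibre components are classical symbols of order 1
    (∀ i : Fin n, ClassicalE χ.source 1 (fun z => compH χ z i)) ∧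
    (∀ i : Fin n, ClassicalPsi χ.source 1 (fun z => compY χ z i)) ∧
    -- radial factors, smooth and positive up to the corner
    ∃ fe fp : Amb n → ℝ,
      SmoothOn fe (χ.source ∩ faceE n) ∧ (∀ p ∈ χ.source ∩ faceE n, 0 < fe p) ∧
      SmoothOn fp (χ.source ∩ facePsi n) ∧ (∀ p ∈ χ.source ∩ facePsi n, 0 < fp p) ∧
      -- 3.: compatibility limits at the corner
      (∀ z ∈ coneCorner χ.source,
        Tendsto (fun s : ℝ => compT χ (z.1, s • z.2)) atTop (𝓝 (compA χ z)) ∧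
        Tendsto (fun s : ℝ => s⁻¹ • compY χ (s • z.1, z.2)) atTop
          (𝓝 ((‖z.1‖ * fe (ptCorner z)) • compA χ z)) ∧
        Tendsto (fun s : ℝ => s⁻¹ • compH χ (z.1, s • z.2)) atTop
          (𝓝 ((‖z.2‖ * fp (ptCorner z)) • compB χ z)) ∧
        Tendsto (fun s : ℝ => compG χ (s • z.1, z.2)) atTop (𝓝 (compB χ z))) ∧
      -- 4.: homogeneous symplectic extensions
      ∃ Ce Cp Cpe : Phase n → Phase n,
        Ce = liftE χ fe ∧ Cp = liftPsi χ fp ∧ Cpe = liftCorner χ fe fp ∧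
        (IsDiffeoOn Ce (coneE χ.source) (coneE χ.target) ∧
          IsSymplecticOn Ce (coneE χ.source) ∧
          (∀ z ∈ coneE χ.source, ptE (Ce z) = χ (ptE z) ∧
            ∀ r : ℝ, 0 < r → Ce (r • z.1, z.2) = (r • (Ce z).1, (Ce z).2))) ∧
        (IsDiffeoOn Cp (conePsi χ.source) (conePsi χ.target) ∧
          IsSymplecticOn Cp (conePsi χ.source) ∧
          (∀ z ∈ conePsi χ.source, ptPsi (Cp z) = χ (ptPsi z) ∧
            ∀ r : ℝ, 0 < r → Cp (z.1, r • z.2) = ((Cp z).1, r • (Cp z).2))) ∧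
        (IsDiffeoOn Cpe (coneCorner χ.source) (coneCorner χ.target) ∧
          IsSymplecticOn Cpe (coneCorner χ.source) ∧
          (∀ z ∈ coneCorner χ.source, ptCorner (Cpe z) = χ (ptCorner z) ∧
            ∀ r t : ℝ, 0 < r → 0 < t →
              Cpe (r • z.1, t • z.2) = (r • (Cpe z).1, t • (Cpe z).2))) ∧
        -- 5.: a diffeomorphism near infinity with principal symbol `(Ce, Cp, Cpe)`
        ∃ (Ω₀ Ω Ω' : Set (Amb n)) (C : Phase n → Phase n),
          RelOpen Ω₀ (dbl n) ∧ RelOpen Ω (dbl n) ∧ RelOpen Ω' (dbl n) ∧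
          Ω₀ ∩ bdry n = χ.source ∧ Ω ∩ bdry n = χ.source ∧ Ω' ∩ bdry n = χ.target ∧
          Ω ⊆ Ω₀ ∧ (χ.source = bdry n → Ω₀ = dbl n) ∧
          (∀ i : Fin n, ClassicalSGWithSymbol Ω₀ 1 0 (fun z => (C z).1 i)
            (fun z => (Ce z).1 i) (fun z => (Cp z).1 i) (fun z => (Cpe z).1 i)) ∧
          (∀ i : Fin n, ClassicalSGWithSymbol Ω₀ 0 1 (fun z => (C z).2 i)
            (fun z => (Ce z).2 i) (fun z => (Cp z).2 i) (fun z => (Cpe z).2 i)) ∧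
          IsDiffeoOn C (intPart Ω) (intPart Ω') := by
  obtain ⟨hd, ge, gp, hge, hgp, hP⟩ := hχ
  have hP := hP hcorner
  obtain ⟨φ, ψ, h⟩ := exists_isRadial hd hge hgp hP
  -- One extension of the pair of scaled components determines `C` and, through its boundary slices,
  -- all three principal symbols.
  obtain ⟨G, hG, hGχ⟩ := exists_extension hd.source_open
    ((h.smooth_scaledFst hd).1.prodMk (h.smooth_scaledSnd hd).1)
    ((h.smooth_scaledFst hd).2.prodMk (h.smooth_scaledSnd hd).2)
  have hGχ' : ∀ p ∈ χ.source, G p = (scaledFst χ φ p, scaledSnd χ ψ p) := fun p hp => hGχ hp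
  obtain ⟨hE, hPsi, hC⟩ := h.isDiffeoOn_lift hd
  obtain ⟨Ω, Ω', h1, h2, h3, h4, h5, h6⟩ := h.exists_diffeo hd hP hG hGχ'
  have hc : ∀ p ∈ χ.source, χ p ∈ corner n ↔ p ∈ corner n := fun p hp =>
    and_congr (hd.map_faceE p hp) (hd.map_facePsi p hp)
  refine ⟨hd.restrictsToDiffeo (.inl sdiff_subset) fun p hp =>
      and_congr (hd.map_faceE p hp) (not_congr (hc p hp)),
    hd.restrictsToDiffeo (.inr sdiff_subset) fun p hp =>
      and_congr (hd.map_facePsi p hp) (not_congr (hc p hp)),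
    hd.restrictsToDiffeo (.inl inter_subset_left) hc,
    h.classicalE_compH hd hG hGχ', h.classicalPsi_compY hd hG hGχ', φ, ψ,
    h.smooth_fst.1, fun p hp => h.pos_fst p hp.1, h.smooth_snd.2, fun p hp => h.pos_snd p hp.1,
    fun z hz => h.tendsto_corner hd hz, liftE χ φ, liftPsi χ ψ, liftCorner χ φ ψ, rfl, rfl, rfl,
    ⟨hE, fun z hz => h.isSympl_liftE hd hP hz, fun z hz => ⟨h.ptE_liftE hd hz,
      fun r hr => liftE_smul χ φ z hr⟩⟩,
    ⟨hPsi, fun z hz => h.isSympl_liftPsi hd hP hz, fun z hz => ⟨h.ptPsi_liftPsi hd hz,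
      fun r hr => liftPsi_smul χ ψ z hr⟩⟩,
    ⟨hC, fun z hz => h.isSympl_liftCorner hd hP hG hGχ' hz, fun z hz => ⟨h.ptCorner_liftCorner hd hz,
      fun r t hr ht => liftCorner_smul χ φ ψ z hr ht⟩⟩,
    -- The symbol statements need only smoothness of `G`, so they hold over the whole filled set.
    -- The smaller `Ω` is needed only for regularity and injectivity.
    fill χ.source, Ω, Ω', slice (fun q => (G q).1) (fun q => (G q).2) 1 1,
    relOpen_fill hd.source_open, h1, h2, fill_inter_bdry hd.source_open.subset, h3, h4, h5,
    fun hb => by rw [hb, fill_bdry], h.classicalSG_fst hd hG hGχ', h.classicalSG_snd hd hG hGχ', h6⟩
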